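/- Let $d\ge 3$. Let $P_x$ be the law of simple random walk $(X_n)_{n\ge 0}$ on $\mathbb Z^d$ started at $x$, let $g(x,y)=\sum_{n\ge 0}P_x[X_n=y]$ be its Green function, and for finite $K\subset\mathbb Z^d$ let ${\rm cap}(K)=\sum_{x\in K}P_x[X_n\notin K\text{ for all }n\ge 1]$. Let $\mathbb P$ be the law on $\mathbb R^{\mathbb Z^d}$ of the Gaussian free field $\varphi=(\varphi_x)_{x\in\mathbb Z^d}$, i.e. of the centered Gaussian process with covariance $\mathbb E[\varphi_x\varphi_y]=g(x,y)$. For an integer $N\ge 0$ let $B_N=\{x\in\mathbb Z^d: |x|_\infty\le N\}$, and let $\partial B_N$ be the set of points of $\mathbb Z^d\setminus B_N$ having a nearest neighbor in $B_N$. Fix real numbers $M>1$ and $\alpha<0$, let $S_N=\{x\in\mathbb Z^d: |x|_\infty=[MN]\}$, where $[\cdot]$ is the integer part, and let $A_N$ be the event that there is no nearest neighbor path in $\{x\in\mathbb Z^d:\varphi_x\ge\alpha\}$ from $\partial B_N$ to $S_N$. **Theorem 3.2.** For every $N$ with $MN\ge N+1$, $$\mathbb P[A_N]\le 2\exp\Big\{-\tfrac12\,\alpha^2\,{\rm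 cap}(B_N)\Big\}.$$ Moreover, $$\limsup_{N\to\infty}\frac1{N^{d-2}}\log\mathbb P[A_N]\le-\frac1{2d}\,\alpha^2\,{\rm cap}_{\mathbb R^d}([-1,1]^d),$$ where ${\rm cap}_{\mathbb R^d}(K)$ denotes the Brownian capacity of a compact set $K\subset\mathbb R^d$: the supremum of $\mu(K)$ over finite Borel measures $\mu$ carried by $K$ with $\int G(x,y)\,\mu(dy)\le 1$ for all $x\in\mathbb R^d$, where $G(x,y)=\int_0^\infty(2\pi t)^{-d/2}e^{-|x-y|^2/(2t)}\,dt$ is the Green function of standard Brownian motion. -/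

import Mathlib

open MeasureTheory ProbabilityTheory
open scoped ENNReal

namespace GFF

/-- The lattice `ℤ^d`. -/
abbrev Lattice (d : ℕ) : Type := Fin d → ℤ

/-- `x` and `y` are neighbors: their Euclidean distance (here squared) equals `1`. -/
def Adj {d : ℕ} (x y : Lattice d) : Prop := ∑ i, (x i - y i) ^ 2 = 1

/-- The outer boundary `∂K` of `K ⊆ ℤ^d`. -/
def boundary {d : ℕ} (K : Set (Lattice d)) : Set (Lattice d) :=
  {y | y ∉ K ∧ ∃ x ∈ K, Adj y x}

/-- The box `B_N`, closed ball of center `0` and radius `N` for the sup-norm. -/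
noncomputable def box (d N : ℕ) : Finset (Lattice d) := Finset.Icc (fun _ => -(N : ℤ)) (fun _ => (N : ℤ))

/-- The sphere `S = {x ; |x|_∞ = n}` (the norm on `Fin d → ℤ` is the sup-norm). -/
def sphere (d n : ℕ) : Set (Lattice d) := {x | ‖x‖ = (n : ℝ)}

/-- `K` and `L` are connected by `U`: some nearest neighbor path with values in `U` starts in `K`
and ends in `L`. The path is `π 0, …, π n`; later values of `π` play no role. -/
def Connected {d : ℕ} (K U L : Set (Lattice d)) : Prop :=
  ∃ (n : ℕ) (π : ℕ → Lattice d), π 0 ∈ K ∧ π n ∈ L ∧ (∀ i ≤ n, π i ∈ U) ∧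
    ∀ i < n, Adj (π i) (π (i + 1))

/-! ### Simple random walk -/

/-- One step of simple random walk: uniform on the `2d` vectors `± e_i`. -/
noncomputable def stepPMF (d : ℕ) [NeZero d] : PMF (Lattice d) :=
  (PMF.uniformOfFintype (Fin d × Bool)).map
    fun p => Pi.single p.1 (if p.2 then (1 : ℤ) else -1)

/-- The law `P_x` on trajectories of simple random walk started at `x`: the walk is
`X_n = x + ξ_0 + ⋯ + ξ_{n-1}` with i.i.d. steps `ξ_i`. -/
noncomputable def walkLaw (d : ℕ) [NeZero d] (x : Lattice d) : Measure (ℕ → Lattice d) :=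
  (Measure.infinitePi fun _ : ℕ => (stepPMF d).toMeasure).map
    fun ξ n => x + ∑ i ∈ Finset.range n, ξ i

/-- The Green function `g(x, y) = ∑_{n ≥ 0} P_x[X_n = y]`. -/
noncomputable def green (d : ℕ) [NeZero d] (x y : Lattice d) : ℝ :=
  ∑' n : ℕ, (walkLaw d x).real {X | X n = y}

/-- The escape probability `P_x[X_n ∉ K for all n ≥ 1]`, whose restriction to `K` is the
equilibrium measure of `K`. -/
noncomputable def escape (d : ℕ) [NeZero d] (K : Finset (Lattice d)) (x : Lattice d) : ℝ :=
  (walkLaw d x).real {X | ∀ n : ℕ, 1 ≤ n → X n ∉ K}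

/-- The simple random walk capacity of the finite set `K`: total mass of its equilibrium measure. -/
noncomputable def capacity (d : ℕ) [NeZero d] (K : Finset (Lattice d)) : ℝ :=
  ∑ x ∈ K, escape d K x

/-! ### The Gaussian free field -/

/-- `P` is the canonical law of the Gaussian free field: under `P` the coordinate process is a
centered Gaussian process with covariance `g(x, y)`. -/
structure IsGFF (d : ℕ) [NeZero d] (P : Measure (Lattice d → ℝ)) : Prop where
  gaussian : IsGaussianProcess (fun (x : Lattice d) (φ : Lattice d → ℝ) => φ x) P
  centered : ∀ x : Lattice d, ∫ φ, φ x ∂P = 0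
  covariance : ∀ x y : Lattice d, ∫ φ, φ x * φ y ∂P = green d x y

/-- The excursion set of `φ` above level `α`. -/
def excursion {d : ℕ} (α : ℝ) (φ : Lattice d → ℝ) : Set (Lattice d) := {x | α ≤ φ x}

/-- The disconnection event `A_N`: no nearest neighbor path in the excursion set above `α` goes
from `∂B_N` to the sphere of radius `[MN]`. -/
def disconnection (d : ℕ) (M α : ℝ) (N : ℕ) : Set (Lattice d → ℝ) :=
  {φ | ¬ Connected (boundary (box d N : Set (Lattice d))) (excursion α φ) (sphere d ⌊M * N⌋₊)}

/-! ### Brownian capacity -/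

/-- The Green function of standard Brownian motion on `ℝ^d`, the time integral of its transition
density `(2πt)^(-d/2) exp(-|x-y|²/(2t))`. -/
noncomputable def brownianGreen (d : ℕ) (x y : EuclideanSpace ℝ (Fin d)) : ℝ≥0∞ :=
  ∫⁻ t in Set.Ioi (0 : ℝ), ENNReal.ofReal
    ((2 * Real.pi * t) ^ (-(d : ℝ) / 2) * Real.exp (-‖x - y‖ ^ 2 / (2 * t)))

/-- The Brownian capacity of a compact set `K ⊆ ℝ^d`: the largest total mass of a finite measure
carried by `K` whose Brownian potential is at most `1` everywhere. The maximizer is the equilibrium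
measure of `K`. -/
noncomputable def brownianCapacity (d : ℕ) (K : Set (EuclideanSpace ℝ (Fin d))) : ℝ≥0∞ :=
  sSup {c | ∃ μ : Measure (EuclideanSpace ℝ (Fin d)), IsFiniteMeasure μ ∧ μ Kᶜ = 0 ∧
    (∀ x, ∫⁻ y, brownianGreen d x y ∂μ ≤ 1) ∧ c = μ Set.univ}

/-- The cube `[-1,1]^d` in `ℝ^d`. -/
def cube (d : ℕ) : Set (EuclideanSpace ℝ (Fin d)) := {x | ∀ i, x i ∈ Set.Icc (-1 : ℝ) 1}

end GFF

/-! The finite-volume bound rests on the Markov property. With `R = ⌊M * N⌋₊`, explore inside `box d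
R` the clusters of `{φ ≥ α}` attached to the sphere of radius `R`. Under disconnection their union
`C` avoids the boundary of `B_N`, so `B_N` lies in the unrevealed region `U`, and every neighbour of
`U` outside `U` is a revealed point with `φ < α`. Given the revealed values, the field on `U` is the
harmonic extension of its boundary values, which is at most `α`, plus an independent centered
Gaussian field. So with conditional probability at least `1/2` the average of `φ` against the
equilibrium measure of `B_N` is at most `α cap(B_N)`; this costs the factor `2`
(`IsGFF.measure_not_connected_le`). That average is centered Gaussian of variance `cap(B_N)`,
because the equilibrium potential is one on `B_N`, and Chernoff's bound concludes.

The asymptotic bound needs only `N^(d-2) cap_{ℝ^d}([-1,1]^d) ≤ d cap(B_N)`, which is proved for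
every `N ≥ 1` without any convergence of random walk to Brownian motion. Dilate by `N` an admissible
measure of mass `m` on the cube: the Brownian energy becomes at most `N^(2-d) m`. Spread the result
over the lattice with multilinear hat functions, obtaining a charge `ν` on `B_N` of the same mass.
If its lattice energy is at most `d` times the Brownian energy, then Cauchy-Schwarz for the Green
form, tested against the equilibrium measure, gives `m² ≤ d N^(2-d) m cap(B_N)`.

The energy comparison is by duality (`tsum_potential_le`). Let `A` be the averaging operator, `f =
∑_{k<n} A^k ν` and `a = ⟨f, ν⟩`. By the choice of `ν`, `a` is the integral of the multilinear
interpolation of `f` against the continuous measure, of energy at most `e`. Interpolation does not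
increase Dirichlet energy (`heatForm_interp_le`), and a Dirichlet principle
(`sq_integral_le_of_heatForm_le`) bounds the squared integral by Dirichlet energy times Brownian
energy. Since `⟨f, f - A f⟩ ≤ a`, this reads `a² ≤ d a e`, so `a ≤ d e` uniformly in `n`. On the
continuous side Dirichlet energy enters only through `⟨F, F - P_t F⟩`, with `P_t` the heat
semigroup. Applied to Lebesgue measure on a cube, the same bound yields transience of the walk. -/

namespace GFF

/-! ### The heat kernel on `ℝ^d` -/

/-- The Euclidean space `ℝ^d`. -/
abbrev Space (d : ℕ) : Type := EuclideanSpace ℝ (Fin d)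

/-- The transition density of Brownian motion on `ℝ^d`. -/
noncomputable def heat (d : ℕ) (t : ℝ) (v : Space d) : ℝ :=
  (2 * Real.pi * t) ^ (-(d : ℝ) / 2) * Real.exp (-‖v‖ ^ 2 / (2 * t))

section Heat

variable {d : ℕ}

lemma heat_nonneg {t : ℝ} (ht : 0 ≤ t) (v : Space d) : 0 ≤ heat d t v := by
  unfold heat; positivity

lemma heat_neg (t : ℝ) (v : Space d) : heat d t (-v) = heat d t v := by
  simp [heat]

lemma heat_le {t : ℝ} (ht : 0 < t) (v : Space d) :
    heat d t v ≤ (2 * Real.pi * t) ^ (-(d : ℝ) / 2) := by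
  unfold heat
  have h : Real.exp (-‖v‖ ^ 2 / (2 * t)) ≤ 1 := by
    rw [Real.exp_le_one_iff]
    exact div_nonpos_of_nonpos_of_nonneg (by simp) (by positivity)
  exact mul_le_of_le_one_right (by positivity) h

lemma measurable_heat_uncurry : Measurable fun p : ℝ × Space d => heat d p.1 p.2 := by
  unfold heat
  fun_prop

lemma continuous_heat (t : ℝ) : Continuous (heat d t) := by
  unfold heat
  fun_prop

lemma measurable_heat (t : ℝ) : Measurable (heat d t) := (continuous_heat t).measurable

lemma integral_heat {t : ℝ} (ht : 0 < t) : ∫ v, heat d t v = 1 := by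
  unfold heat
  rw [integral_const_mul]
  have h := GaussianFourier.integral_rexp_neg_mul_sq_norm (V := Space d)
    (b := 1 / (2 * t)) (by positivity)
  have e : (fun v : Space d => Real.exp (-‖v‖ ^ 2 / (2 * t))) =
      fun v => Real.exp (-(1 / (2 * t)) * ‖v‖ ^ 2) := by
    ext v; congr 1; ring
  rw [e, h, finrank_euclideanSpace_fin, show Real.pi / (1 / (2 * t)) = 2 * Real.pi * t by
    field_simp, ← Real.rpow_add (by positivity)]
  rw [show -(d : ℝ) / 2 + d / 2 = 0 by ring, Real.rpow_zero]

lemma integrable_heat {t : ℝ} (ht : 0 < t) : Integrable (heat d t) :=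
  Integrable.of_integral_ne_zero (by rw [integral_heat ht]; exact one_ne_zero)

/-- Completing the square in `a`: the second factor is the density at an intermediate time of a
Brownian bridge from `0` to `c`. Integrating it out gives the semigroup property. -/
lemma heat_mul_heat {s t : ℝ} (hs : 0 < s) (ht : 0 < t) (a c : Space d) :
    heat d s a * heat d t (c - a) =
      heat d (s + t) c * heat d (s * t / (s + t)) (a - (s / (s + t)) • c) := by
  have hst : 0 < s + t := by positivity
  unfold heat
  rw [mul_mul_mul_comm _ (Real.exp (-‖a‖ ^ 2 / (2 * s))),
    mul_mul_mul_comm _ (Real.exp (-‖c‖ ^ 2 / (2 * (s + t)))), ← Real.exp_add, ← Real.exp_add,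
    ← Real.mul_rpow (by positivity) (by positivity), ← Real.mul_rpow (by positivity) (by positivity)]
  congr 2
  · field_simp
  · rw [norm_sub_sq_real, norm_sub_sq_real, real_inner_smul_right, norm_smul, real_inner_comm]
    rw [Real.norm_of_nonneg (by positivity)]
    field_simp
    ring

lemma integral_heat_mul_heat {s t : ℝ} (hs : 0 < s) (ht : 0 < t) (c : Space d) :
    ∫ a, heat d s a * heat d t (c - a) = heat d (s + t) c := by
  simp_rw [heat_mul_heat hs ht]
  rw [integral_const_mul, integral_sub_right_eq_self, integral_heat (by positivity), mul_one]

/-- Completing the square: an exponential tilt translates the Gaussian by `t • v`, whence its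
Laplace transform. -/
lemma heat_mul_exp {t : ℝ} (ht : 0 < t) (v w : Space d) :
    heat d t w * Real.exp (inner ℝ v w) = Real.exp (t * ‖v‖ ^ 2 / 2) * heat d t (w - t • v) := by
  unfold heat
  rw [mul_left_comm, mul_assoc, ← Real.exp_add, ← Real.exp_add]
  congr 2
  rw [norm_sub_sq_real, real_inner_smul_right, norm_smul, real_inner_comm,
    Real.norm_of_nonneg ht.le]
  field_simp
  ring

/-- The centered Gaussian measure of covariance `t` times the identity. -/
noncomputable def heatMeasure (d : ℕ) (t : ℝ) : Measure (Space d) :=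
  volume.withDensity fun v => ENNReal.ofReal (heat d t v)

lemma isProbabilityMeasure_heatMeasure {t : ℝ} (ht : 0 < t) :
    IsProbabilityMeasure (heatMeasure d t) := by
  constructor
  rw [heatMeasure, withDensity_apply _ MeasurableSet.univ, Measure.restrict_univ,
    ← ofReal_integral_eq_lintegral_ofReal (integrable_heat ht)
      (Filter.Eventually.of_forall fun v => heat_nonneg ht.le v), integral_heat ht]
  simp

lemma integral_heatMeasure {t : ℝ} (ht : 0 < t) (f : Space d → ℝ) :
    ∫ w, f w ∂(heatMeasure d t) = ∫ w, heat d t w * f w := by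
  rw [heatMeasure, integral_withDensity_eq_integral_toReal_smul
    (measurable_heat t).ennreal_ofReal (Filter.Eventually.of_forall fun _ => by simp)]
  refine integral_congr_ae (Filter.Eventually.of_forall fun w => ?_)
  simp [ENNReal.toReal_ofReal (heat_nonneg ht.le w)]

lemma lintegral_heatMeasure (t : ℝ) {f : Space d → ℝ≥0∞} (hf : Measurable f) :
    ∫⁻ w, f w ∂(heatMeasure d t) = ∫⁻ w, ENNReal.ofReal (heat d t w) * f w := by
  rw [heatMeasure, lintegral_withDensity_eq_lintegral_mul _ (measurable_heat t).ennreal_ofReal hf]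
  rfl

lemma lintegral_heatMeasure_exp {t : ℝ} (ht : 0 < t) (v : Space d) :
    ∫⁻ w, ENNReal.ofReal (Real.exp (inner ℝ v w)) ∂(heatMeasure d t) =
      ENNReal.ofReal (Real.exp (t * ‖v‖ ^ 2 / 2)) := by
  rw [lintegral_heatMeasure t (by fun_prop)]
  simp_rw [← ENNReal.ofReal_mul (heat_nonneg ht.le _), heat_mul_exp ht,
    ENNReal.ofReal_mul (Real.exp_nonneg _)]
  rw [lintegral_const_mul _ (by have := measurable_heat (d := d) t; fun_prop),
    lintegral_sub_right_eq_self (fun w => ENNReal.ofReal (heat d t w)),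
    ← ofReal_integral_eq_lintegral_ofReal (integrable_heat ht)
      (Filter.Eventually.of_forall fun v => heat_nonneg ht.le v), integral_heat ht]
  simp

/-- Half the second moment of a Gaussian is bounded by its Laplace transform. -/
lemma lintegral_heatMeasure_inner_sq_add_one_le {t : ℝ} (ht : 0 < t) (v : Space d) :
    ENNReal.ofReal 2 + ∫⁻ w, ENNReal.ofReal (inner ℝ v w ^ 2) ∂(heatMeasure d t) ≤
      ENNReal.ofReal (2 * Real.exp (t * ‖v‖ ^ 2 / 2)) := by
  have := isProbabilityMeasure_heatMeasure (d := d) ht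
  have h1 : ENNReal.ofReal (2 * Real.exp (t * ‖v‖ ^ 2 / 2)) =
      ∫⁻ w, (ENNReal.ofReal (Real.exp (inner ℝ v w)) + ENNReal.ofReal (Real.exp (inner ℝ (-v) w)))
        ∂(heatMeasure d t) := by
    rw [lintegral_add_left (by fun_prop), lintegral_heatMeasure_exp ht,
      lintegral_heatMeasure_exp ht, norm_neg, ← ENNReal.ofReal_add (by positivity) (by positivity),
      two_mul]
  have h2 : ENNReal.ofReal 2 + ∫⁻ w, ENNReal.ofReal (inner ℝ v w ^ 2) ∂(heatMeasure d t) =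
      ∫⁻ w, (ENNReal.ofReal 2 + ENNReal.ofReal (inner ℝ v w ^ 2)) ∂(heatMeasure d t) := by
    rw [lintegral_add_left (by fun_prop)]; simp
  rw [h1, h2]
  refine lintegral_mono fun w => ?_
  rw [← ENNReal.ofReal_add (by positivity) (by positivity),
    ← ENNReal.ofReal_add (by positivity) (by positivity)]
  refine ENNReal.ofReal_le_ofReal ?_
  rw [inner_neg_left]
  set x := inner ℝ v w
  -- The pointwise inequality `2 + x² ≤ exp x + exp (-x)` follows from this identity and `|u| ≤
  -- |sinh u|` at `u = x / 2`.
  have h1 : Real.cosh x = 1 + 2 * Real.sinh (x / 2) ^ 2 := by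
    have h := Real.cosh_two_mul (x / 2)
    rw [mul_div_cancel₀ x two_ne_zero, Real.cosh_sq] at h
    linarith
  have h2 : (x / 2) ^ 2 ≤ Real.sinh (x / 2) ^ 2 := by
    rw [sq_le_sq, Real.abs_sinh]
    exact Real.self_le_sinh_iff.2 (abs_nonneg _)
  rw [Real.cosh_eq] at h1
  linarith

/-- Replacing `v` by `√ε • v` in the previous bound gives `2 + ε I ≤ 2 exp (ε t ‖v‖² / 2)`. Subtract
`2`, divide by `ε` and let `ε` decrease to `0`: the derivative at `0` remains. -/
lemma lintegral_heatMeasure_inner_sq_le {t : ℝ} (ht : 0 < t) (v : Space d) :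
    ∫⁻ w, ENNReal.ofReal (inner ℝ v w ^ 2) ∂(heatMeasure d t) ≤
      ENNReal.ofReal (t * ‖v‖ ^ 2) := by
  set I := ∫⁻ w, ENNReal.ofReal (inner ℝ v w ^ 2) ∂(heatMeasure d t) with hI
  have key : ∀ ε : ℝ, 0 < ε → ENNReal.ofReal 2 + ENNReal.ofReal ε * I ≤
      ENNReal.ofReal (2 * Real.exp (ε * (t * ‖v‖ ^ 2 / 2))) := by
    intro ε hε
    have h := lintegral_heatMeasure_inner_sq_add_one_le ht (Real.sqrt ε • v)
    simp_rw [real_inner_smul_left, mul_pow, Real.sq_sqrt hε.le, ENNReal.ofReal_mul hε.le] at h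
    rw [lintegral_const_mul _ (by fun_prop), norm_smul, mul_pow,
      Real.norm_of_nonneg (Real.sqrt_nonneg _), Real.sq_sqrt hε.le] at h
    rwa [show ε * (t * ‖v‖ ^ 2 / 2) = t * (ε * ‖v‖ ^ 2) / 2 by ring]
  have hfin : I ≠ ⊤ := by
    intro h
    have := key 1 one_pos
    rw [h, ENNReal.mul_top (by simp), add_top, top_le_iff] at this
    exact ENNReal.ofReal_ne_top this
  have hreal : ∀ ε : ℝ, 0 < ε → I.toReal ≤
      ε⁻¹ * (2 * Real.exp (ε * (t * ‖v‖ ^ 2 / 2)) - 2) := by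
    intro ε hε
    have h := key ε hε
    rw [← ENNReal.ofReal_toReal hfin, ← ENNReal.ofReal_mul hε.le,
      ← ENNReal.ofReal_add (by positivity) (by positivity),
      ENNReal.ofReal_le_ofReal_iff (by positivity)] at h
    rw [le_inv_mul_iff₀ hε]
    linarith
  rw [← ENNReal.ofReal_toReal hfin]
  refine ENNReal.ofReal_le_ofReal ?_
  have hd : HasDerivAt (fun ε : ℝ => 2 * Real.exp (ε * (t * ‖v‖ ^ 2 / 2))) (t * ‖v‖ ^ 2) 0 := by
    have h := (((hasDerivAt_id (0 : ℝ)).mul_const (t * ‖v‖ ^ 2 / 2)).exp).const_mul 2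
    convert! h using 1
    simp; ring
  have hlim := hd.tendsto_slope_zero_right
  refine ge_of_tendsto hlim (Filter.eventually_of_mem self_mem_nhdsWithin fun ε hε => ?_)
  simpa using hreal ε hε

end Heat

/-! ### The Dirichlet form of the Gaussian walk -/

/-- The Cauchy-Schwarz inequality for integrals. -/
lemma sq_integral_mul_le {Ω : Type*} [MeasurableSpace Ω] {m : Measure Ω} {f g : Ω → ℝ}
    (hf : Integrable (fun x => f x * f x) m) (hfg : Integrable (fun x => f x * g x) m)
    (hg : Integrable (fun x => g x * g x) m) :
    (∫ x, f x * g x ∂m) ^ 2 ≤ (∫ x, f x * f x ∂m) * ∫ x, g x * g x ∂m := by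
  have h : ∀ c : ℝ, 0 ≤ (∫ x, f x * f x ∂m) * (c * c) + (2 * ∫ x, f x * g x ∂m) * c +
      ∫ x, g x * g x ∂m := by
    intro c
    have e : ∫ x, (c * f x + g x) ^ 2 ∂m = (∫ x, f x * f x ∂m) * (c * c) +
        (2 * ∫ x, f x * g x ∂m) * c + ∫ x, g x * g x ∂m := by
      rw [← integral_const_mul, ← integral_mul_const, ← integral_mul_const, ← integral_add,
        ← integral_add]
      · congr 1; ext x; ring
      · exact (hf.mul_const _).add ((hfg.const_mul _).mul_const _)
      · exact hg
      · exact hf.mul_const _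
      · exact (hfg.const_mul _).mul_const _
    rw [← e]
    exact integral_nonneg fun x => sq_nonneg _
  have := discrim_le_zero h
  rw [discrim] at this
  nlinarith

/-- Bounded integrable measurable functions on `ℝ^d`. -/
structure IsNice {d : ℕ} (F : Space d → ℝ) : Prop where
  measurable : Measurable F
  integrable : Integrable F
  bounded : ∃ C, ∀ x, ‖F x‖ ≤ C

section Form

variable {d : ℕ}

namespace IsNice

variable {F H : Space d → ℝ}

lemma add (hF : IsNice F) (hH : IsNice H) : IsNice fun x => F x + H x := by
  refine ⟨hF.measurable.add hH.measurable, hF.integrable.add hH.integrable, ?_⟩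
  obtain ⟨C, hC⟩ := hF.bounded
  obtain ⟨D, hD⟩ := hH.bounded
  exact ⟨C + D, fun x => (norm_add_le _ _).trans (add_le_add (hC x) (hD x))⟩

lemma const_mul (hF : IsNice F) (c : ℝ) : IsNice fun x => c * F x := by
  refine ⟨hF.measurable.const_mul c, hF.integrable.const_mul c, ?_⟩
  obtain ⟨C, hC⟩ := hF.bounded
  exact ⟨‖c‖ * C, fun x => by rw [norm_mul]; gcongr; exact hC x⟩

lemma sum {ι : Type*} {s : Finset ι} {F : ι → Space d → ℝ} (h : ∀ i ∈ s, IsNice (F i)) :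
    IsNice fun x => ∑ i ∈ s, F i x := by
  classical
  induction s using Finset.induction_on with
  | empty => simpa using ⟨measurable_const, integrable_zero _ _ _, 0, by simp⟩
  | insert a s ha ih =>
    simp_rw [Finset.sum_insert ha]
    exact (h a (by simp)).add (ih fun i hi => h i (by simp [hi]))

lemma integrable_mul (hF : IsNice F) (hH : IsNice H) : Integrable fun x => F x * H x := by
  obtain ⟨D, hD⟩ := hH.bounded
  exact hF.integrable.mul_bdd hH.measurable.aestronglyMeasurable (Filter.Eventually.of_forall hD)

end IsNice

/-- Averaging a function over a Gaussian displacement. -/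
noncomputable def heatConv (t : ℝ) (F : Space d → ℝ) (y : Space d) : ℝ :=
  ∫ w, F (y + w) ∂(heatMeasure d t)

lemma measurePreserving_neg_heatMeasure (t : ℝ) :
    MeasurePreserving (fun v => -v) (heatMeasure d t) (heatMeasure d t) := by
  refine ⟨measurable_neg, ?_⟩
  ext s hs
  rw [Measure.map_apply measurable_neg hs, heatMeasure, withDensity_apply _ (measurable_neg hs),
    withDensity_apply _ hs]
  rw [← (Measure.measurePreserving_neg (volume : Measure (Space d))).setLIntegral_comp_preimage hs
    (measurable_heat t).ennreal_ofReal]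
  simp [heat_neg]

variable {F H : Space d → ℝ} {t : ℝ}

lemma measurePreserving_add_heatMeasure (ht : 0 < t) :
    MeasurePreserving (fun z : Space d × Space d => (z.1 + z.2, z.2))
      (volume.prod (heatMeasure d t)) (volume.prod (heatMeasure d t)) :=
  have := isProbabilityMeasure_heatMeasure (d := d) ht
  measurePreserving_add_prod _ _

/-- Reversibility of the Gaussian walk: a jump from `y` by `w` is exchanged with the jump back from
`y + w` by `-w`. -/
lemma measurePreserving_reverse (ht : 0 < t) :
    MeasurePreserving (fun z : Space d × Space d => (z.1 + z.2, -z.2))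
      (volume.prod (heatMeasure d t)) (volume.prod (heatMeasure d t)) :=
  have := isProbabilityMeasure_heatMeasure (d := d) ht
  ((MeasurePreserving.id volume).prod (measurePreserving_neg_heatMeasure t)).comp
    (measurePreserving_add_heatMeasure ht)

lemma integral_fst_mul_fst (ht : 0 < t) (hF : IsNice F) (hH : IsNice H) :
    Integrable (fun z : Space d × Space d => F z.1 * H z.1) (volume.prod (heatMeasure d t)) ∧
    ∫ z : Space d × Space d, F z.1 * H z.1 ∂(volume.prod (heatMeasure d t)) =
      ∫ y, F y * H y := by
  have := isProbabilityMeasure_heatMeasure (d := d) ht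
  have h := (hF.integrable_mul hH).comp_fst (heatMeasure d t)
  refine ⟨h, ?_⟩
  rw [integral_prod _ h]
  simp

lemma integral_add_mul_add (ht : 0 < t) (hF : IsNice F) (hH : IsNice H) :
    Integrable (fun z : Space d × Space d => F (z.1 + z.2) * H (z.1 + z.2))
      (volume.prod (heatMeasure d t)) ∧
    ∫ z : Space d × Space d, F (z.1 + z.2) * H (z.1 + z.2) ∂(volume.prod (heatMeasure d t)) =
      ∫ y, F y * H y := by
  obtain ⟨h1, h2⟩ := integral_fst_mul_fst ht hF hH
  have hm := measurePreserving_add_heatMeasure (d := d) ht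
  refine ⟨(hm.integrable_comp h1.aestronglyMeasurable).2 h1, ?_⟩
  rw [← h2]
  conv_rhs => rw [← hm.map_eq]
  rw [integral_map hm.measurable.aemeasurable (by rw [hm.map_eq]; exact h1.aestronglyMeasurable)]

lemma integral_fst_mul_add (ht : 0 < t) (hF : IsNice F) (hH : IsNice H) :
    Integrable (fun z : Space d × Space d => F z.1 * H (z.1 + z.2))
      (volume.prod (heatMeasure d t)) ∧
    ∫ z : Space d × Space d, F z.1 * H (z.1 + z.2) ∂(volume.prod (heatMeasure d t)) =
      ∫ y, F y * heatConv t H y := by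
  have := isProbabilityMeasure_heatMeasure (d := d) ht
  obtain ⟨D, hD⟩ := hH.bounded
  have h : Integrable (fun z : Space d × Space d => F z.1 * H (z.1 + z.2))
      (volume.prod (heatMeasure d t)) :=
    (hF.integrable.comp_fst _).mul_bdd
      (hH.measurable.comp (measurable_fst.add measurable_snd)).aestronglyMeasurable
      (Filter.Eventually.of_forall fun z => hD _)
  refine ⟨h, ?_⟩
  rw [integral_prod _ h]
  simp_rw [integral_const_mul]
  rfl

lemma integral_add_mul_fst (ht : 0 < t) (hF : IsNice F) (hH : IsNice H) :
    Integrable (fun z : Space d × Space d => F (z.1 + z.2) * H z.1)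
      (volume.prod (heatMeasure d t)) ∧
    ∫ z : Space d × Space d, F (z.1 + z.2) * H z.1 ∂(volume.prod (heatMeasure d t)) =
      ∫ y, F y * heatConv t H y := by
  obtain ⟨h1, h2⟩ := integral_fst_mul_add ht hF hH
  have hm := measurePreserving_reverse (d := d) ht
  have e : (fun z : Space d × Space d => F (z.1 + z.2) * H z.1) =
      (fun z : Space d × Space d => F z.1 * H (z.1 + z.2)) ∘ fun z => (z.1 + z.2, -z.2) := by
    ext z; simp
  rw [e]
  refine ⟨(hm.integrable_comp h1.aestronglyMeasurable).2 h1, ?_⟩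
  rw [← h2]
  conv_rhs => rw [← hm.map_eq]
  rw [integral_map hm.measurable.aemeasurable (by rw [hm.map_eq]; exact h1.aestronglyMeasurable)]
  rfl

/-- The Dirichlet form of the walk with Gaussian steps of variance `t`. -/
noncomputable def heatForm (t : ℝ) (F H : Space d → ℝ) : ℝ :=
  ∫ z : Space d × Space d, (F (z.1 + z.2) - F z.1) * (H (z.1 + z.2) - H z.1)
    ∂(volume.prod (heatMeasure d t))

/-- After expanding, the two diagonal terms agree by translation invariance and the two cross terms
by reversibility. -/
lemma heatForm_eq (ht : 0 < t) (hF : IsNice F) (hH : IsNice H) :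
    Integrable (fun z : Space d × Space d => (F (z.1 + z.2) - F z.1) * (H (z.1 + z.2) - H z.1))
      (volume.prod (heatMeasure d t)) ∧
    heatForm t F H = 2 * ((∫ y, F y * H y) - ∫ y, F y * heatConv t H y) := by
  obtain ⟨a1, a2⟩ := integral_fst_mul_fst ht hF hH
  obtain ⟨b1, b2⟩ := integral_add_mul_add ht hF hH
  obtain ⟨c1, c2⟩ := integral_fst_mul_add ht hF hH
  obtain ⟨e1, e2⟩ := integral_add_mul_fst ht hF hH
  have e : (fun z : Space d × Space d => (F (z.1 + z.2) - F z.1) * (H (z.1 + z.2) - H z.1)) =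
      fun z => (F (z.1 + z.2) * H (z.1 + z.2) + F z.1 * H z.1) -
        (F z.1 * H (z.1 + z.2) + F (z.1 + z.2) * H z.1) := by
    ext z; ring
  rw [heatForm, e]
  refine ⟨(b1.add a1).sub (c1.add e1), ?_⟩
  have h := integral_sub (b1.add a1) (c1.add e1)
  simp only [Pi.add_apply] at h
  rw [h, integral_add b1 a1, integral_add c1 e1, a2, b2, c2, e2]
  ring

lemma sq_heatForm_le (ht : 0 < t) (hF : IsNice F) (hH : IsNice H) :
    heatForm t F H ^ 2 ≤ heatForm t F F * heatForm t H H :=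
  sq_integral_mul_le (heatForm_eq ht hF hF).1 (heatForm_eq ht hF hH).1 (heatForm_eq ht hH hH).1

/-! ### Heat flow of a measure -/

/-- The density at time `r` of the heat flow started from the measure `μ`. -/
noncomputable def heatFlow (μ : Measure (Space d)) (r : ℝ) (y : Space d) : ℝ :=
  ∫ x, heat d r (y - x) ∂μ

variable {μ : Measure (Space d)} {r : ℝ}

lemma heatFlow_nonneg (hr : 0 < r) (y : Space d) : 0 ≤ heatFlow μ r y :=
  integral_nonneg fun _ => heat_nonneg hr.le _

variable [IsFiniteMeasure μ]

lemma integrable_heat_sub (hr : 0 < r) (y : Space d) :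
    Integrable (fun x => heat d r (y - x)) μ := by
  refine Integrable.of_bound (((measurable_heat r).comp (by fun_prop)).aestronglyMeasurable)
    ((2 * Real.pi * r) ^ (-(d : ℝ) / 2)) (Filter.Eventually.of_forall fun x => ?_)
  rw [Real.norm_of_nonneg (heat_nonneg hr.le _)]
  exact heat_le hr _

lemma heatFlow_le (hr : 0 < r) (y : Space d) :
    heatFlow μ r y ≤ (2 * Real.pi * r) ^ (-(d : ℝ) / 2) * μ.real Set.univ := by
  have h := integral_mono (integrable_heat_sub (μ := μ) hr y) (integrable_const _)
    (fun x => heat_le hr (y - x))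
  rwa [integral_const, smul_eq_mul, mul_comm] at h

lemma integrable_prod_heat_sub (hr : 0 < r) :
    Integrable (fun z : Space d × Space d => heat d r (z.1 - z.2)) (volume.prod μ) := by
  have h := (integrable_heat (d := d) hr).comp_fst μ
  exact ((measurePreserving_sub_prod volume μ).integrable_comp h.aestronglyMeasurable).2 h

lemma isNice_heatFlow (hr : 0 < r) : IsNice (heatFlow μ r) := by
  have h := integrable_prod_heat_sub (μ := μ) hr
  refine ⟨?_, h.integral_prod_left, _, fun x => by
    rw [Real.norm_of_nonneg (heatFlow_nonneg hr x)]
    exact heatFlow_le hr x⟩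
  have hm : Measurable fun z : Space d × Space d => heat d r (z.1 - z.2) :=
    (measurable_heat r).comp (by fun_prop)
  exact (hm.stronglyMeasurable.integral_prod_right (ν := μ)).measurable

lemma integral_mul_heatFlow (hr : 0 < r) (hF : IsNice F) :
    ∫ y, F y * heatFlow μ r y = ∫ x, heatConv r F x ∂μ := by
  have h : Integrable (fun z : Space d × Space d => F z.1 * heat d r (z.1 - z.2))
      (volume.prod μ) := by
    obtain ⟨C, hC⟩ := hF.bounded
    exact (integrable_prod_heat_sub hr).bdd_mul
      (hF.measurable.comp measurable_fst).aestronglyMeasurable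
      (Filter.Eventually.of_forall fun z => hC z.1)
  calc ∫ y, F y * heatFlow μ r y = ∫ y, ∫ x, F y * heat d r (y - x) ∂μ := by
        simp_rw [integral_const_mul]; rfl
    _ = ∫ x, ∫ y, F y * heat d r (y - x) ∂volume ∂μ := integral_integral_swap h
    _ = ∫ x, heatConv r F x ∂μ := by
        congr 1; ext x
        rw [heatConv, integral_heatMeasure hr, ← integral_add_left_eq_self _ x]
        congr 1; ext w
        rw [add_sub_cancel_left, mul_comm]

lemma heatConv_heatFlow (hr : 0 < r) (ht : 0 < t) (y : Space d) :
    heatConv t (heatFlow μ r) y = heatFlow μ (r + t) y := by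
  have h : Integrable (fun z : Space d × Space d => heat d t z.1 * heat d r (y + z.1 - z.2))
      (volume.prod μ) := by
    refine ((integrable_heat ht).comp_fst μ).mul_bdd
      ((measurable_heat r).comp (by fun_prop)).aestronglyMeasurable
      (c := (2 * Real.pi * r) ^ (-(d : ℝ) / 2)) (Filter.Eventually.of_forall fun z => ?_)
    rw [Real.norm_of_nonneg (heat_nonneg hr.le _)]
    exact heat_le hr _
  rw [heatConv, integral_heatMeasure ht]
  unfold heatFlow
  simp_rw [← integral_const_mul]
  rw [integral_integral_swap h]
  congr 1; ext x
  have h2 := integral_heat_mul_heat ht hr (x - y)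
  rw [← heat_neg, add_comm r t, neg_sub, ← h2]
  congr 1; ext w
  rw [← heat_neg r, show -(y + w - x) = x - y - w by abel]

lemma integral_heatFlow_mul_heatFlow {s : ℝ} (hr : 0 < r) (hs : 0 < s) :
    ∫ y, heatFlow μ r y * heatFlow μ s y = ∫ x, heatFlow μ (r + s) x ∂μ := by
  rw [integral_mul_heatFlow hs (isNice_heatFlow hr)]
  simp_rw [heatConv_heatFlow hr hs]

end Form

/-! ### Brownian energy and the Dirichlet principle -/

/-- The mutual energy of `μ` with itself for the Brownian Green function. -/
noncomputable def brownianEnergy {d : ℕ} (μ : Measure (Space d)) : ℝ≥0∞ :=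
  ∫⁻ x, ∫⁻ y, brownianGreen d x y ∂μ ∂μ

section Energy

variable {d : ℕ} {μ : Measure (Space d)} [IsFiniteMeasure μ] {r t : ℝ}

lemma measurable_heat_sub : Measurable fun p : (ℝ × Space d) × Space d =>
    ENNReal.ofReal (heat d p.1.1 (p.1.2 - p.2)) :=
  (measurable_heat_uncurry.comp (by fun_prop :
    Measurable fun p : (ℝ × Space d) × Space d => (p.1.1, p.1.2 - p.2))).ennreal_ofReal

lemma ofReal_heatFlow (hr : 0 < r) (x : Space d) :
    ENNReal.ofReal (heatFlow μ r x) = ∫⁻ y, ENNReal.ofReal (heat d r (x - y)) ∂μ :=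
  ofReal_integral_eq_lintegral_ofReal (integrable_heat_sub hr x)
    (Filter.Eventually.of_forall fun _ => heat_nonneg hr.le _)

lemma integrable_heatFlow (hr : 0 < r) : Integrable (heatFlow μ r) μ := by
  obtain ⟨C, hC⟩ := (isNice_heatFlow (μ := μ) hr).bounded
  exact Integrable.of_bound (isNice_heatFlow hr).measurable.aestronglyMeasurable C
    (Filter.Eventually.of_forall hC)

lemma measurable_lintegral_heat (μ : Measure (Space d)) [IsFiniteMeasure μ] : Measurable fun r : ℝ =>
    ∫⁻ x, ∫⁻ y, ENNReal.ofReal (heat d r (x - y)) ∂μ ∂μ :=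
  (measurable_heat_sub.lintegral_prod_right' (ν := μ)).lintegral_prod_right' (ν := μ)

lemma ofReal_integral_heatFlow (hr : 0 < r) :
    ENNReal.ofReal (∫ x, heatFlow μ r x ∂μ) =
      ∫⁻ x, ∫⁻ y, ENNReal.ofReal (heat d r (x - y)) ∂μ ∂μ := by
  rw [ofReal_integral_eq_lintegral_ofReal (integrable_heatFlow hr)
    (Filter.Eventually.of_forall fun _ => heatFlow_nonneg hr _)]
  simp_rw [ofReal_heatFlow hr]

lemma brownianEnergy_eq : brownianEnergy μ =
    ∫⁻ r in Set.Ioi (0 : ℝ), ∫⁻ x, ∫⁻ y, ENNReal.ofReal (heat d r (x - y)) ∂μ ∂μ := by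
  have h : ∀ x : Space d, ∫⁻ y, brownianGreen d x y ∂μ =
      ∫⁻ r in Set.Ioi (0 : ℝ), ∫⁻ y, ENNReal.ofReal (heat d r (x - y)) ∂μ := fun x =>
    lintegral_lintegral_swap (measurable_heat_sub.comp (by fun_prop : Measurable
      fun p : Space d × ℝ => ((p.2, x), p.1))).aemeasurable
  unfold brownianEnergy
  simp_rw [h]
  exact lintegral_lintegral_swap ((measurable_heat_sub.lintegral_prod_right' (ν := μ)).comp
    measurable_swap).aemeasurable

/-- Some arithmetic progression of step `t` has a Riemann sum below the integral. -/
lemma exists_riemann_sum_le {K : ℝ → ℝ≥0∞} (hK : Measurable K) (ht : 0 < t) :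
    ∃ s ∈ Set.Ioc 0 t, ENNReal.ofReal t * ∑' k : ℕ, K (s + k * t) ≤ ∫⁻ r in Set.Ioi (0 : ℝ), K r := by
  have hm : ∀ k : ℕ, Measurable fun s => K (s + k * t) := fun k => hK.comp (by fun_prop)
  -- As the offset `s` runs over `(0, t]`, the progressions tile `(0, ∞)`. Some offset does no worse
  -- than the average, so no regularity of `K` beyond measurability is needed.
  have hsum : ∫⁻ s in Set.Ioc 0 t, ∑' k : ℕ, K (s + k * t) ≤ ∫⁻ r in Set.Ioi (0 : ℝ), K r := by
    rw [lintegral_tsum fun k => (hm k).aemeasurable]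
    have e : ∀ k : ℕ, ∫⁻ s in Set.Ioc 0 t, K (s + k * t) =
        ∫⁻ s in Set.Ioc ((k : ℝ) * t) (((k + 1 : ℕ) : ℝ) * t), K s := by
      intro k
      rw [← (measurePreserving_add_right (volume : Measure ℝ) (k * t)).setLIntegral_comp_preimage
        measurableSet_Ioc hK]
      congr 2
      ext s
      simp only [Set.mem_Ioc, Set.mem_preimage]
      push_cast
      constructor <;> rintro ⟨h1, h2⟩ <;> constructor <;> linarith
    simp_rw [e]
    have hmono : Monotone fun k : ℕ => (k : ℝ) * t := fun a b hab => by
      have : (a : ℝ) ≤ b := by exact_mod_cast hab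
      simp only
      gcongr
    have hdisj := hmono.pairwise_disjoint_on_Ioc_succ
    simp only [Nat.succ_eq_succ, Nat.succ_eq_add_one] at hdisj
    rw [← lintegral_iUnion (fun k => measurableSet_Ioc) hdisj]
    refine lintegral_mono_set (Set.iUnion_subset fun k s hs => ?_)
    exact lt_of_le_of_lt (by positivity) hs.1
  obtain ⟨s, hs, hle⟩ := exists_le_setLAverage (μ := (volume : Measure ℝ)) (s := Set.Ioc 0 t)
    (f := fun s => ∑' k : ℕ, K (s + k * t)) (by simp [ht]) (by simp)
    (Measurable.tsum hm).aemeasurable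
  refine ⟨s, hs, ?_⟩
  rw [setLAverage_eq, Real.volume_Ioc, sub_zero] at hle
  calc _ ≤ ENNReal.ofReal t * ((∫⁻ s in Set.Ioc 0 t, ∑' k : ℕ, K (s + k * t)) / ENNReal.ofReal t) :=
        by gcongr
    _ = ∫⁻ s in Set.Ioc 0 t, ∑' k : ℕ, K (s + k * t) :=
        ENNReal.mul_div_cancel (by simpa using ht) ENNReal.ofReal_ne_top
    _ ≤ _ := hsum

variable {F : Space d → ℝ}

lemma heatForm_heatFlow (ht : 0 < t) (hr : 0 < r) (hF : IsNice F) :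
    heatForm t F (heatFlow μ r) =
      2 * ((∫ y, F y * heatFlow μ r y) - ∫ y, F y * heatFlow μ (r + t) y) := by
  rw [(heatForm_eq ht hF (isNice_heatFlow hr)).2]
  simp_rw [heatConv_heatFlow hr ht]

/-- Averaging over one Gaussian step advances the flow by `t`, so the sum along an arithmetic
progression telescopes. -/
lemma heatForm_sum_heatFlow (ht : 0 < t) (hr : 0 < r) (hF : IsNice F) (n : ℕ) :
    heatForm t F (fun y => ∑ k ∈ Finset.range n, heatFlow μ (r + k * t) y) =
      2 * ((∫ y, F y * heatFlow μ r y) - ∫ y, F y * heatFlow μ (r + n * t) y) := by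
  have e : heatForm t F (fun y => ∑ k ∈ Finset.range n, heatFlow μ (r + k * t) y) =
      ∑ k ∈ Finset.range n, heatForm t F (heatFlow μ (r + k * t)) := by
    unfold heatForm
    rw [← integral_finsetSum _ fun k _ => (heatForm_eq ht hF (isNice_heatFlow (by positivity))).1]
    congr 1; ext z
    rw [← Finset.sum_sub_distrib, Finset.mul_sum]
  have e2 : ∀ k : ℕ, heatForm t F (heatFlow μ (r + k * t)) = _ := fun k =>
    heatForm_heatFlow ht (by positivity) hF
  simp_rw [e, e2, ← Finset.mul_sum]
  congr 1
  have h := Finset.sum_range_sub' (fun k : ℕ => ∫ y, F y * heatFlow μ (r + k * t) y) n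
  simp only [Nat.cast_zero, zero_mul, add_zero] at h
  rw [← h]
  refine Finset.sum_congr rfl fun k _ => ?_
  rw [add_assoc, Nat.cast_add, Nat.cast_one, add_one_mul]

/-- Cauchy-Schwarz for `heatForm t` between `F` and `h`, where `t * h` is a Riemann sum for the
Brownian potential of the flow at time `r`. The mixed form telescopes; the form of `h` with itself
is at most twice its pairing with `heatFlow μ r`, a Riemann sum for the energy of `μ`. Times add in
the pairing, hence the offset `2 * r`. -/
lemma sq_sub_le_of_heatForm_le (ht : 0 < t) (hr : 0 < r) (hF : IsNice F) {D e : ℝ}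
    (hD : 0 ≤ D) (hFD : heatForm t F F ≤ 2 * t * D) (n : ℕ)
    (he : t * ∑ k ∈ Finset.range n, ∫ x, heatFlow μ (2 * r + k * t) x ∂μ ≤ e) :
    ((∫ y, F y * heatFlow μ r y) - ∫ y, F y * heatFlow μ (r + n * t) y) ^ 2 ≤ D * e := by
  set h : Space d → ℝ := fun y => ∑ k ∈ Finset.range n, heatFlow μ (r + k * t) y with hh
  have hn : ∀ k : ℕ, 0 < r + k * t := fun k => by positivity
  have hnice : IsNice h := IsNice.sum fun k _ => isNice_heatFlow (hn k)
  have h0 : ∀ y, 0 ≤ h y := fun y => Finset.sum_nonneg fun k _ => heatFlow_nonneg (hn k) y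
  have hhh : heatForm t h h ≤ 2 * ∑ k ∈ Finset.range n, ∫ x, heatFlow μ (2 * r + k * t) x ∂μ := by
    rw [hh, heatForm_sum_heatFlow ht hr hnice]
    have h1 : 0 ≤ ∫ y, h y * heatFlow μ (r + n * t) y :=
      integral_nonneg fun y => mul_nonneg (h0 y) (heatFlow_nonneg (hn n) y)
    have h2 : ∫ y, h y * heatFlow μ r y =
        ∑ k ∈ Finset.range n, ∫ x, heatFlow μ (2 * r + k * t) x ∂μ := by
      simp_rw [hh, Finset.sum_mul]
      rw [integral_finsetSum _ fun k _ =>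
        (isNice_heatFlow (hn k)).integrable_mul (isNice_heatFlow hr)]
      refine Finset.sum_congr rfl fun k _ => ?_
      rw [integral_heatFlow_mul_heatFlow (hn k) hr]
      rw [show r + k * t + r = 2 * r + k * t by ring]
    rw [← h2]
    linarith
  have hcs := sq_heatForm_le ht hF hnice
  have h4 : heatForm t F F * heatForm t h h ≤ (2 * t * D) * (2 * (e / t)) := by
    refine mul_le_mul hFD (hhh.trans ?_) (integral_nonneg fun z => mul_self_nonneg _) (by positivity)
    gcongr
    rwa [le_div_iff₀ ht, mul_comm]
  rw [hh, heatForm_sum_heatFlow ht hr hF] at hcs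
  have h5 := hcs.trans h4
  have h6 : (2 * t * D) * (2 * (e / t)) = 4 * (D * e) := by field_simp; ring
  rw [h6] at h5
  nlinarith

/-- The supremum of the heat kernel decays like `n ^ (-d/2)`; this removes the far end of the
telescoped sum. -/
lemma tendsto_integral_mul_heatFlow (hd : 0 < d) (ht : 0 < t) (hr : 0 < r) (hF : IsNice F) :
    Filter.Tendsto (fun n : ℕ => ∫ y, F y * heatFlow μ (r + n * t) y) Filter.atTop (nhds 0) := by
  have hd' : (0 : ℝ) < d := by exact_mod_cast hd
  have hlim : Filter.Tendsto (fun n : ℕ => (∫ y, ‖F y‖) *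
      ((2 * Real.pi * (r + n * t)) ^ (-(d : ℝ) / 2) * μ.real Set.univ)) Filter.atTop (nhds 0) := by
    have h1 : Filter.Tendsto (fun n : ℕ => 2 * Real.pi * (r + n * t)) Filter.atTop Filter.atTop := by
      refine Filter.Tendsto.const_mul_atTop (by positivity) ?_
      exact Filter.tendsto_atTop_add_const_left _ _
        (tendsto_natCast_atTop_atTop.atTop_mul_const ht)
    have h2 := (tendsto_rpow_neg_atTop (y := (d : ℝ) / 2) (by positivity)).comp h1
    have h3 := (h2.mul_const (μ.real Set.univ)).const_mul (∫ y, ‖F y‖)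
    simp only [zero_mul, mul_zero, Function.comp_def] at h3
    simpa only [neg_div] using h3
  refine squeeze_zero_norm (fun n => ?_) hlim
  have hn : 0 < r + n * t := by positivity
  rw [← integral_mul_const]
  refine norm_integral_le_of_norm_le (hF.integrable.norm.mul_const _)
    (Filter.Eventually.of_forall fun y => ?_)
  rw [norm_mul]
  gcongr
  rw [Real.norm_of_nonneg (heatFlow_nonneg hn y)]
  exact heatFlow_le hn y

/-- Brownian scaling moves the time dependence into the argument of `F` and leaves a fixed density,
as dominated convergence for `t → 0` requires. -/
lemma heatConv_eq_scaled (ht : 0 < t) (x : Space d) :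
    heatConv t F x = ∫ w, heat d 1 w * F (x + Real.sqrt t • w) := by
  rw [heatConv, integral_heatMeasure ht]
  have h := Measure.integral_comp_smul (volume : Measure (Space d))
    (fun w => heat d t w * F (x + w)) (Real.sqrt t)
  have hs : 0 < Real.sqrt t ^ d := by positivity
  rw [finrank_euclideanSpace_fin, abs_of_pos (inv_pos.2 hs), smul_eq_mul,
    eq_inv_mul_iff_mul_eq₀ hs.ne', ← integral_const_mul] at h
  rw [← h]
  congr 1; ext w
  rw [← mul_assoc]
  congr 1
  unfold heat
  rw [norm_smul, mul_pow, Real.norm_of_nonneg (Real.sqrt_nonneg _), Real.sq_sqrt ht.le, ← mul_assoc,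
    Real.mul_rpow (by positivity) ht.le, mul_one, Real.sqrt_eq_rpow, ← Real.rpow_natCast,
    ← Real.rpow_mul ht.le, mul_left_comm, ← Real.rpow_add ht]
  rw [show 1 / 2 * (d : ℝ) + -(d : ℝ) / 2 = 0 by ring, Real.rpow_zero, mul_one, mul_one]
  congr 2
  field_simp

lemma tendsto_heatConv (hF : IsNice F) (hc : Continuous F) {s : ℕ → ℝ} (hs : ∀ n, 0 < s n)
    (hlim : Filter.Tendsto s Filter.atTop (nhds 0)) (x : Space d) :
    Filter.Tendsto (fun n => heatConv (s n) F x) Filter.atTop (nhds (F x)) := by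
  obtain ⟨C, hC⟩ := hF.bounded
  simp_rw [fun n => heatConv_eq_scaled (F := F) (hs n) x]
  have e : F x = ∫ w, heat d 1 w * F x := by
    rw [integral_mul_const, integral_heat one_pos, one_mul]
  rw [e]
  refine tendsto_integral_of_dominated_convergence (fun w => heat d 1 w * C)
    (fun n => ((continuous_heat 1).mul (hc.comp (by fun_prop))).aestronglyMeasurable)
    ((integrable_heat one_pos).mul_const C) (fun n => Filter.Eventually.of_forall fun w => ?_)
    (Filter.Eventually.of_forall fun w => ?_)
  · rw [norm_mul, Real.norm_of_nonneg (heat_nonneg zero_le_one w)]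
    exact mul_le_mul_of_nonneg_left (hC _) (heat_nonneg zero_le_one w)
  · refine Filter.Tendsto.const_mul _ ((hc.tendsto x).comp ?_)
    have h1 : Filter.Tendsto (fun n => Real.sqrt (s n)) Filter.atTop (nhds 0) := by
      simpa [Function.comp_def] using (Real.continuous_sqrt.tendsto 0).comp hlim
    simpa using (h1.smul_const w).const_add x

lemma norm_heatConv_le (ht : 0 < t) {C : ℝ} (hC : ∀ x, ‖F x‖ ≤ C) (x : Space d) :
    ‖heatConv t F x‖ ≤ C := by
  have := isProbabilityMeasure_heatMeasure (d := d) ht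
  simpa [heatConv] using norm_integral_le_of_norm_le_const (μ := heatMeasure d t)
    (f := fun w => F (x + w)) (Filter.Eventually.of_forall fun w => hC (x + w))

lemma measurable_heatConv (hF : IsNice F) : Measurable (heatConv t F) := by
  have : SFinite (heatMeasure d t) := by unfold heatMeasure; infer_instance
  have hm : Measurable fun z : Space d × Space d => F (z.1 + z.2) :=
    hF.measurable.comp (by fun_prop)
  exact (hm.stronglyMeasurable.integral_prod_right (ν := heatMeasure d t)).measurable

/-- A function is controlled against `μ` by its Dirichlet form and the energy of `μ`. -/
theorem sq_integral_le_of_heatForm_le (hd : 0 < d) (hF : IsNice F) (hc : Continuous F) {D e : ℝ}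
    (hD : 0 ≤ D) (he0 : 0 ≤ e) (hFD : ∀ t, 0 < t → heatForm t F F ≤ 2 * t * D)
    (he : brownianEnergy μ ≤ ENNReal.ofReal e) :
    (∫ x, F x ∂μ) ^ 2 ≤ D * e := by
  -- For mesh `t`, averaging selects an offset `σ` whose Riemann sum lies below the energy.
  -- Smoothing at time `σ / 2` makes the times `2 * (σ / 2) + k * t` fall on that progression.
  have key : ∀ t : ℝ, 0 < t → ∃ s ∈ Set.Ioc 0 t, (∫ x, heatConv s F x ∂μ) ^ 2 ≤ D * e := by
    intro t ht
    obtain ⟨σ, ⟨hσ0, hσt⟩, hσ⟩ := exists_riemann_sum_le (measurable_lintegral_heat μ) ht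
    rw [← brownianEnergy_eq] at hσ
    have hr : 0 < σ / 2 := by positivity
    refine ⟨σ / 2, ⟨hr, by linarith⟩, ?_⟩
    have hn : ∀ n : ℕ, ((∫ y, F y * heatFlow μ (σ / 2) y) -
        ∫ y, F y * heatFlow μ (σ / 2 + n * t) y) ^ 2 ≤ D * e := by
      intro n
      refine sq_sub_le_of_heatForm_le ht hr hF hD (hFD t ht) n ?_
      have hk : ∀ k : ℕ, 0 < σ + k * t := fun k => by positivity
      rw [mul_div_cancel₀ σ two_ne_zero, ← ENNReal.ofReal_le_ofReal_iff he0,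
        ENNReal.ofReal_mul ht.le, ENNReal.ofReal_sum_of_nonneg fun k _ =>
          integral_nonneg fun x => heatFlow_nonneg (hk k) x]
      refine le_trans ?_ (hσ.trans he)
      gcongr
      rw [Finset.sum_congr rfl fun k _ => ofReal_integral_heatFlow (hk k)]
      exact ENNReal.sum_le_tsum _
    have hlim := ((tendsto_integral_mul_heatFlow (μ := μ) hd ht hr hF).const_sub
      (∫ y, F y * heatFlow μ (σ / 2) y)).pow 2
    rw [sub_zero, integral_mul_heatFlow hr hF] at hlim
    exact le_of_tendsto' hlim fun n => by rw [← integral_mul_heatFlow hr hF]; exact hn n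
  choose s hs hle using fun n : ℕ => key (1 / ((n : ℝ) + 1)) (by positivity)
  have hs0 : Filter.Tendsto s Filter.atTop (nhds 0) :=
    squeeze_zero (fun n => (hs n).1.le) (fun n => (hs n).2) tendsto_one_div_add_atTop_nhds_zero_nat
  obtain ⟨C, hC⟩ := hF.bounded
  have hlim : Filter.Tendsto (fun n => ∫ x, heatConv (s n) F x ∂μ) Filter.atTop
      (nhds (∫ x, F x ∂μ)) :=
    tendsto_integral_of_dominated_convergence (fun _ => C)
      (fun n => (measurable_heatConv hF).aestronglyMeasurable) (integrable_const C)
      (fun n => Filter.Eventually.of_forall fun x => norm_heatConv_le (hs n).1 hC x)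
      (Filter.Eventually.of_forall fun x => tendsto_heatConv hF hc (fun n => (hs n).1) hs0 x)
  exact le_of_tendsto' (hlim.pow 2) hle

end Energy

/-! ### One-dimensional profiles -/

/-- The tent function, supported on `[-1,1]`. -/
noncomputable def tent (u : ℝ) : ℝ := max 0 (1 - |u|)

/-- The indicator function of `[0,1)`. -/
noncomputable def unitBox (u : ℝ) : ℝ := (Set.Ico (0 : ℝ) 1).indicator 1 u

/-- Bounded densities on the line whose integer translates sum to at most one. -/
structure IsProfile (κ : ℝ → ℝ) : Prop where
  measurable : Measurable κ
  nonneg : ∀ u, 0 ≤ κ u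
  le_one : ∀ u, κ u ≤ 1
  integrable : Integrable κ
  integral_le : ∫ u, κ u ≤ 1
  sum_le : ∀ (s : Finset ℤ) (u : ℝ), ∑ k ∈ s, κ (u - k) ≤ 1

lemma continuous_tent : Continuous tent := by unfold tent; fun_prop

lemma tent_nonneg (u : ℝ) : 0 ≤ tent u := le_max_left _ _

lemma tent_le_one (u : ℝ) : tent u ≤ 1 := max_le zero_le_one (by linarith [abs_nonneg u])

lemma tent_eq_zero {u : ℝ} (h : 1 ≤ |u|) : tent u = 0 := max_eq_left (by linarith)

lemma tent_of_nonneg {u : ℝ} (h0 : 0 ≤ u) (h1 : u ≤ 1) : tent u = 1 - u := by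
  rw [tent, abs_of_nonneg h0, max_eq_right (by linarith)]

lemma tent_of_nonpos {u : ℝ} (h0 : -1 ≤ u) (h1 : u ≤ 0) : tent u = 1 + u := by
  rw [tent, abs_of_nonpos h1, max_eq_right (by linarith), sub_neg_eq_add]

lemma tent_sub_intCast_eq_zero {u : ℝ} {k : ℤ} (h1 : k ≠ ⌊u⌋) (h2 : k ≠ ⌊u⌋ + 1) :
    tent (u - k) = 0 := by
  apply tent_eq_zero
  have h3 := Int.floor_le u
  have h4 := Int.lt_floor_add_one u
  rcases lt_or_gt_of_ne h1 with h | h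
  · have : (k : ℝ) + 1 ≤ ⌊u⌋ := by exact_mod_cast h
    exact le_abs.2 (Or.inl (by linarith))
  · have h5 : ⌊u⌋ + 2 ≤ k := by omega
    have : (⌊u⌋ : ℝ) + 2 ≤ k := by exact_mod_cast h5
    exact le_abs.2 (Or.inr (by linarith))

lemma tent_add_tent (u : ℝ) : tent (u - ⌊u⌋) + tent (u - (⌊u⌋ + 1 : ℤ)) = 1 := by
  have h3 := Int.floor_le u
  have h4 := Int.lt_floor_add_one u
  rw [tent_of_nonneg (by linarith) (by linarith)]
  push_cast
  rw [tent_of_nonpos (by linarith) (by linarith)]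
  ring

lemma sum_tent_le (s : Finset ℤ) (u : ℝ) : ∑ k ∈ s, tent (u - k) ≤ 1 := by
  calc ∑ k ∈ s, tent (u - k) ≤ ∑ k ∈ s ∪ {⌊u⌋, ⌊u⌋ + 1}, tent (u - k) :=
        Finset.sum_le_sum_of_subset_of_nonneg Finset.subset_union_left fun _ _ _ => tent_nonneg _
    _ = ∑ k ∈ {⌊u⌋, ⌊u⌋ + 1}, tent (u - k) := by
        refine (Finset.sum_subset Finset.subset_union_right fun k _ hk => ?_).symm
        simp only [Finset.mem_insert, Finset.mem_singleton, not_or] at hk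
        exact tent_sub_intCast_eq_zero hk.1 hk.2
    _ = 1 := by rw [Finset.sum_pair (by omega), tent_add_tent]

lemma sum_tent_eq {s : Finset ℤ} {u : ℝ} (h : ∀ k : ℤ, |u - k| < 1 → k ∈ s) :
    ∑ k ∈ s, tent (u - k) = 1 := by
  refine le_antisymm (sum_tent_le s u) ?_
  calc (1 : ℝ) = ∑ k ∈ {⌊u⌋, ⌊u⌋ + 1}, tent (u - k) := by
        rw [Finset.sum_pair (by omega), tent_add_tent]
    _ ≤ ∑ k ∈ s ∪ {⌊u⌋, ⌊u⌋ + 1}, tent (u - k) :=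
        Finset.sum_le_sum_of_subset_of_nonneg Finset.subset_union_right fun _ _ _ => tent_nonneg _
    _ = ∑ k ∈ s, tent (u - k) := by
        refine (Finset.sum_subset Finset.subset_union_left fun k _ hk => ?_).symm
        exact tent_eq_zero (not_lt.1 fun h' => hk (h k h'))

lemma integral_tent : ∫ u, tent u = 1 := by
  rw [← setIntegral_eq_integral_of_forall_compl_eq_zero (s := Set.Ioc (-1 : ℝ) 1),
    ← intervalIntegral.integral_of_le (by norm_num),
    ← intervalIntegral.integral_add_adjacent_intervals (b := 0)
      (continuous_tent.intervalIntegrable _ _) (continuous_tent.intervalIntegrable _ _)]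
  · have h1 : ∫ u in (-1 : ℝ)..0, tent u = ∫ u in (-1 : ℝ)..0, (1 + u) := by
      refine intervalIntegral.integral_congr fun u hu => ?_
      rw [Set.uIcc_of_le (by norm_num)] at hu
      exact tent_of_nonpos hu.1 hu.2
    have h2 : ∫ u in (0 : ℝ)..1, tent u = ∫ u in (0 : ℝ)..1, (1 - u) := by
      refine intervalIntegral.integral_congr fun u hu => ?_
      rw [Set.uIcc_of_le (by norm_num)] at hu
      exact tent_of_nonneg hu.1 hu.2
    rw [h1, h2, intervalIntegral.integral_add (by simp) (by simp),
      intervalIntegral.integral_sub (by simp) (by simp)]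
    simp
    norm_num
  · intro u hu
    apply tent_eq_zero
    rw [Set.mem_Ioc, not_and_or] at hu
    rcases hu with hu | hu
    · exact le_abs.2 (Or.inr (by linarith))
    · exact le_abs.2 (Or.inl (by linarith))

lemma isProfile_tent : IsProfile tent where
  measurable := continuous_tent.measurable
  nonneg := tent_nonneg
  le_one := tent_le_one
  integrable := Integrable.of_integral_ne_zero (by rw [integral_tent]; exact one_ne_zero)
  integral_le := integral_tent.le
  sum_le := sum_tent_le

lemma isProfile_unitBox : IsProfile unitBox where
  measurable := measurable_one.indicator measurableSet_Ico
  nonneg u := Set.indicator_nonneg (by simp) u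
  le_one u := Set.indicator_le_self' (by simp) u
  integrable := (integrable_indicator_iff measurableSet_Ico).2
    (integrableOn_const (by simp) (by simp))
  integral_le := by
    unfold unitBox
    rw [integral_indicator measurableSet_Ico]
    simp
  sum_le s u := by
    have h : ∀ k : ℤ, k ≠ ⌊u⌋ → unitBox (u - k) = 0 := by
      intro k hk
      refine Set.indicator_of_notMem (fun h => hk ?_) _
      rw [Set.mem_Ico] at h
      exact (Int.floor_eq_iff.2 ⟨by linarith, by linarith⟩).symm
    have h0 : ∀ v, 0 ≤ unitBox v := fun v => Set.indicator_nonneg (by simp) v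
    calc ∑ k ∈ s, unitBox (u - k) ≤ ∑ k ∈ s ∪ {⌊u⌋}, unitBox (u - k) :=
          Finset.sum_le_sum_of_subset_of_nonneg Finset.subset_union_left fun _ _ _ => h0 _
      _ = ∑ k ∈ {⌊u⌋}, unitBox (u - k) := by
          refine (Finset.sum_subset Finset.subset_union_right fun k _ hk => ?_).symm
          exact h k (by simpa using hk)
      _ ≤ 1 := by
          rw [Finset.sum_singleton]
          exact Set.indicator_le_self' (by simp) _

/-- Writing the slope as a difference of translates of one box allows a shift of the summation index
to turn derivatives of hats into increments of coefficients. -/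
lemma hasDerivAt_tent {u : ℝ} (hu : ∀ k : ℤ, u ≠ k) :
    HasDerivAt tent (unitBox (u + 1) - unitBox u) u := by
  have hm : u ≠ -1 := by simpa using hu (-1)
  have h0 : u ≠ 0 := by simpa using hu 0
  have h1 : u ≠ 1 := by simpa using hu 1
  have hbox : ∀ v, unitBox v = if 0 ≤ v ∧ v < 1 then 1 else 0 := fun v => by
    simp [unitBox, Set.indicator_apply]
  rcases lt_or_gt_of_ne hm with hlt | hgt
  · rw [hbox, hbox, if_neg (by rintro ⟨h, _⟩; linarith), if_neg (by rintro ⟨h, _⟩; linarith),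
      sub_zero]
    refine (hasDerivAt_const u (0 : ℝ)).congr_of_eventuallyEq ?_
    filter_upwards [Iio_mem_nhds hlt] with v hv
    exact tent_eq_zero (le_abs.2 (Or.inr (by linarith [Set.mem_Iio.1 hv])))
  rcases lt_or_gt_of_ne h0 with hlt | hgt'
  · rw [hbox, hbox, if_pos ⟨by linarith, by linarith⟩, if_neg (by rintro ⟨h, _⟩; linarith),
      sub_zero]
    refine ((hasDerivAt_id u).const_add (1 : ℝ)).congr_of_eventuallyEq ?_
    filter_upwards [Ioo_mem_nhds hgt hlt] with v hv
    exact tent_of_nonpos hv.1.le hv.2.le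
  rcases lt_or_gt_of_ne h1 with hlt | hgt''
  · rw [hbox, hbox, if_neg (by rintro ⟨_, h⟩; linarith), if_pos ⟨by linarith, by linarith⟩,
      zero_sub]
    refine ((hasDerivAt_id u).const_sub (1 : ℝ)).congr_of_eventuallyEq ?_
    filter_upwards [Ioo_mem_nhds hgt' hlt] with v hv
    exact tent_of_nonneg hv.1.le hv.2.le
  · rw [hbox, hbox, if_neg (by rintro ⟨_, h⟩; linarith), if_neg (by rintro ⟨_, h⟩; linarith),
      sub_zero]
    refine (hasDerivAt_const u (0 : ℝ)).congr_of_eventuallyEq ?_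
    filter_upwards [Ioi_mem_nhds hgt''] with v hv
    exact tent_eq_zero (le_abs.2 (Or.inl (le_of_lt hv)))

/-! ### Products of profiles -/

section Product

variable {d : ℕ} {κ : Fin d → ℝ → ℝ}

/-- Enlarging `S` to the product of its coordinate projections factors the sum into one-dimensional
sums, each at most one. -/
lemma sum_prod_profile_le (hκ : ∀ j, IsProfile (κ j)) (S : Finset (Lattice d)) (y : Space d) :
    ∑ x ∈ S, ∏ j, κ j (y j - x j) ≤ 1 := by
  have hsub : S ⊆ Fintype.piFinset fun j => S.image fun x => x j := by
    intro x hx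
    rw [Fintype.mem_piFinset]
    exact fun j => Finset.mem_image_of_mem _ hx
  calc ∑ x ∈ S, ∏ j, κ j (y j - x j)
      ≤ ∑ x ∈ Fintype.piFinset fun j => S.image fun x => x j, ∏ j, κ j (y j - x j) :=
        Finset.sum_le_sum_of_subset_of_nonneg hsub fun x _ _ =>
          Finset.prod_nonneg fun j _ => (hκ j).nonneg _
    _ = ∏ j, ∑ k ∈ S.image fun x => x j, κ j (y j - k) :=
        (Finset.prod_univ_sum _ fun j (k : ℤ) => κ j (y j - k)).symm
    _ ≤ 1 := Finset.prod_le_one (fun j _ => Finset.sum_nonneg fun k _ => (hκ j).nonneg _)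
        fun j _ => (hκ j).sum_le _ _

lemma measurable_prod_profile (hκ : ∀ j, IsProfile (κ j)) (x : Lattice d) :
    Measurable fun y : Space d => ∏ j, κ j (y j - x j) :=
  Finset.measurable_fun_prod _ fun j _ => (hκ j).measurable.comp (by fun_prop)

lemma integrable_prod_profile (hκ : ∀ j, IsProfile (κ j)) (x : Lattice d) :
    Integrable fun y : Space d => ∏ j, κ j (y j - x j) := by
  have h : Integrable (fun y : Fin d → ℝ => ∏ j, κ j (y j - x j)) :=
    Integrable.fintype_prod fun j => (hκ j).integrable.comp_sub_right (x j : ℝ)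
  exact ((PiLp.volume_preserving_ofLp (Fin d)).integrable_comp h.aestronglyMeasurable).2 h

lemma integral_prod_profile_le (hκ : ∀ j, IsProfile (κ j)) (x : Lattice d) :
    ∫ y : Space d, ∏ j, κ j (y j - x j) ≤ 1 := by
  have h := (PiLp.volume_preserving_ofLp (Fin d)).integral_comp
    (MeasurableEquiv.toLp 2 (Fin d → ℝ)).symm.measurableEmbedding
    (fun y : Fin d → ℝ => ∏ j, κ j (y j - x j))
  rw [h, integral_fintype_prod_volume_eq_prod fun j u => κ j (u - x j)]
  refine Finset.prod_le_one (fun j _ => integral_nonneg fun u => (hκ j).nonneg _) fun j _ => ?_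
  rw [integral_sub_right_eq_self]
  exact (hκ j).integral_le

/-- Jensen's inequality for a sub-partition of unity built from profiles. -/
lemma lintegral_sq_sum_profile_le (hκ : ∀ j, IsProfile (κ j)) (S : Finset (Lattice d))
    (a : Lattice d → ℝ) :
    ∫⁻ y : Space d, ENNReal.ofReal ((∑ x ∈ S, a x * ∏ j, κ j (y j - x j)) ^ 2) ≤
      ENNReal.ofReal (∑ x ∈ S, a x ^ 2) := by
  have h0 : ∀ (x : Lattice d) (y : Space d), 0 ≤ ∏ j, κ j (y j - x j) := fun x y =>
    Finset.prod_nonneg fun j _ => (hκ j).nonneg _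
  have hpt : ∀ y : Space d, (∑ x ∈ S, a x * ∏ j, κ j (y j - x j)) ^ 2 ≤
      ∑ x ∈ S, a x ^ 2 * ∏ j, κ j (y j - x j) := by
    intro y
    have h := Finset.sum_sq_le_sum_mul_sum_of_sq_le_mul S
      (r := fun x => a x * ∏ j, κ j (y j - x j)) (f := fun x => a x ^ 2 * ∏ j, κ j (y j - x j))
      (g := fun x => ∏ j, κ j (y j - x j)) (fun x _ => mul_nonneg (sq_nonneg _) (h0 x y))
      (fun x _ => h0 x y) (fun x _ => by simp only; rw [mul_pow, mul_assoc, ← sq])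
    exact h.trans (mul_le_of_le_one_right
      (Finset.sum_nonneg fun x _ => mul_nonneg (sq_nonneg _) (h0 x y)) (sum_prod_profile_le hκ S y))
  have hint : Integrable fun y : Space d => ∑ x ∈ S, a x ^ 2 * ∏ j, κ j (y j - x j) :=
    integrable_finsetSum _ fun x _ => (integrable_prod_profile hκ x).const_mul _
  calc _ ≤ ∫⁻ y : Space d, ENNReal.ofReal (∑ x ∈ S, a x ^ 2 * ∏ j, κ j (y j - x j)) :=
        lintegral_mono fun y => ENNReal.ofReal_le_ofReal (hpt y)
    _ = ENNReal.ofReal (∫ y : Space d, ∑ x ∈ S, a x ^ 2 * ∏ j, κ j (y j - x j)) :=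
        (ofReal_integral_eq_lintegral_ofReal hint (Filter.Eventually.of_forall fun y =>
          Finset.sum_nonneg fun x _ => mul_nonneg (sq_nonneg _) (h0 x y))).symm
    _ ≤ _ := by
        refine ENNReal.ofReal_le_ofReal ?_
        rw [integral_finsetSum _ fun x _ => (integrable_prod_profile hκ x).const_mul _]
        refine Finset.sum_le_sum fun x _ => ?_
        rw [integral_const_mul]
        exact mul_le_of_le_one_right (sq_nonneg _) (integral_prod_profile_le hκ x)

end Product

/-! ### Multilinear interpolation of lattice functions -/

section Interpolation

variable {d : ℕ}

/-- The multilinear hat function centered at the lattice point `x`. -/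
noncomputable def hat (x : Lattice d) (y : Space d) : ℝ := ∏ j, tent (y j - x j)

/-- The multilinear interpolation of a lattice function. -/
noncomputable def interp (f : Lattice d → ℝ) (y : Space d) : ℝ := ∑' x, f x * hat x y

/-- The profiles of the `i`-th partial derivative of a hat function. -/
noncomputable def edgeProfile (i j : Fin d) : ℝ → ℝ := if j = i then unitBox else tent

/-- The increment of a lattice function in the `i`-th direction. -/
def increment (f : Lattice d → ℝ) (i : Fin d) (x : Lattice d) : ℝ := f (x + Pi.single i 1) - f x

/-- The `i`-th partial derivative of the interpolation. -/
noncomputable def interpDeriv (f : Lattice d → ℝ) (i : Fin d) (y : Space d) : ℝ :=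
  ∑' x, increment f i x * ∏ j, edgeProfile i j (y j - x j)

variable {f : Lattice d → ℝ}

lemma summable_mul_of_support_finite {ι : Type*} {f : ι → ℝ} (hf : f.support.Finite)
    (c : ι → ℝ) : Summable fun x => f x * c x :=
  summable_of_hasFiniteSupport (hf.subset fun x hx => by
    simp only [Function.mem_support] at hx ⊢; exact left_ne_zero_of_mul hx)

lemma support_shift_finite (hf : f.support.Finite) (e : Lattice d) :
    (fun x => f (x + e)).support.Finite :=
  hf.preimage (add_left_injective e).injOn

lemma support_increment_finite (hf : f.support.Finite) (i : Fin d) :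
    (increment f i).support.Finite :=
  ((support_shift_finite hf (Pi.single i 1)).union hf).subset (Function.support_sub _ _)

lemma interp_eq_sum (hf : f.support.Finite) (y : Space d) :
    interp f y = ∑ x ∈ hf.toFinset, f x * hat x y :=
  tsum_eq_sum fun x hx => by
    rw [Set.Finite.mem_toFinset, Function.mem_support, not_not] at hx
    rw [hx, zero_mul]

lemma interpDeriv_eq_sum (hf : f.support.Finite) (i : Fin d) (y : Space d) :
    interpDeriv f i y = ∑ x ∈ (support_increment_finite hf i).toFinset,
      increment f i x * ∏ j, edgeProfile i j (y j - x j) :=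
  tsum_eq_sum fun x hx => by
    rw [Set.Finite.mem_toFinset, Function.mem_support, not_not] at hx
    rw [hx, zero_mul]

lemma isProfile_edgeProfile (i j : Fin d) : IsProfile (edgeProfile i j) := by
  unfold edgeProfile
  split_ifs
  exacts [isProfile_unitBox, isProfile_tent]

lemma prod_edgeProfile (i : Fin d) (u : Fin d → ℝ) :
    ∏ j, edgeProfile i j (u j) = unitBox (u i) * ∏ j ∈ Finset.univ.erase i, tent (u j) := by
  rw [← Finset.mul_prod_erase _ _ (Finset.mem_univ i)]
  congr 1
  · simp [edgeProfile]
  · refine Finset.prod_congr rfl fun j hj => ?_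
    rw [edgeProfile, if_neg (Finset.ne_of_mem_erase hj)]

lemma continuous_hat (x : Lattice d) : Continuous (hat x) :=
  continuous_finsetProd _ fun j _ => continuous_tent.comp (by fun_prop)

lemma hat_nonneg (x : Lattice d) (y : Space d) : 0 ≤ hat x y :=
  Finset.prod_nonneg fun _ _ => tent_nonneg _

lemma hat_le_one (x : Lattice d) (y : Space d) : hat x y ≤ 1 :=
  Finset.prod_le_one (fun _ _ => tent_nonneg _) fun _ _ => tent_le_one _

lemma isNice_hat (x : Lattice d) : IsNice (hat x) where
  measurable := (continuous_hat x).measurable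
  integrable := integrable_prod_profile (fun _ => isProfile_tent) x
  bounded := ⟨1, fun y => by rw [Real.norm_of_nonneg (hat_nonneg x y)]; exact hat_le_one x y⟩

lemma continuous_interp (hf : f.support.Finite) : Continuous (interp f) := by
  rw [show interp f = _ from funext (interp_eq_sum hf)]
  exact continuous_finsetSum _ fun x _ => continuous_const.mul (continuous_hat x)

lemma isNice_interp (hf : f.support.Finite) : IsNice (interp f) := by
  rw [show interp f = _ from funext (interp_eq_sum hf)]
  exact IsNice.sum fun x _ => (isNice_hat x).const_mul _

lemma measurable_interpDeriv (hf : f.support.Finite) (i : Fin d) :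
    Measurable (interpDeriv f i) := by
  rw [show interpDeriv f i = _ from funext (interpDeriv_eq_sum hf i)]
  exact Finset.measurable_fun_sum _ fun x _ =>
    (measurable_prod_profile (isProfile_edgeProfile i) x).const_mul _

lemma exists_interpDeriv_le (hf : f.support.Finite) (i : Fin d) :
    ∃ C, ∀ y, ‖interpDeriv f i y‖ ≤ C := by
  refine ⟨∑ x ∈ (support_increment_finite hf i).toFinset, ‖increment f i x‖, fun y => ?_⟩
  rw [interpDeriv_eq_sum hf]
  refine norm_sum_le_of_le _ fun x _ => ?_
  rw [norm_mul]
  refine mul_le_of_le_one_right (norm_nonneg _) ?_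
  rw [Real.norm_of_nonneg (Finset.prod_nonneg fun j _ => (isProfile_edgeProfile i j).nonneg _)]
  exact Finset.prod_le_one (fun j _ => (isProfile_edgeProfile i j).nonneg _)
    fun j _ => (isProfile_edgeProfile i j).le_one _

/-- Summation by parts: differentiating the hat functions is differencing the coefficients. -/
lemma sum_deriv_hat (hf : f.support.Finite) (i : Fin d) (y : Space d) :
    ∑ x ∈ hf.toFinset, f x * ((∏ j ∈ Finset.univ.erase i, tent (y j - x j)) *
      (unitBox (y i - x i + 1) - unitBox (y i - x i))) = interpDeriv f i y := by
  set c : Lattice d → ℝ := fun x => ∏ j, edgeProfile i j (y j - x j) with hc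
  set e : Lattice d := Pi.single i 1 with he
  have hshift : ∀ x, c (x - e) = unitBox (y i - x i + 1) *
      ∏ j ∈ Finset.univ.erase i, tent (y j - x j) := by
    intro x
    rw [hc]
    simp only
    rw [prod_edgeProfile i fun j => y j - ((x - e) j : ℤ)]
    congr 1
    · rw [he]; simp; congr 1; ring
    · refine Finset.prod_congr rfl fun j hj => ?_
      rw [he]; simp [Finset.ne_of_mem_erase hj]
  have h1 : ∀ x, f x * ((∏ j ∈ Finset.univ.erase i, tent (y j - x j)) *
      (unitBox (y i - x i + 1) - unitBox (y i - x i))) = f x * c (x - e) - f x * c x := by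
    intro x
    rw [hshift, hc]
    simp only
    rw [prod_edgeProfile i fun j => y j - (x j : ℤ)]
    ring
  have h2 : ∑' x, f x * c (x - e) = ∑' x, f (x + e) * c x := by
    rw [← (Equiv.addRight e).tsum_eq]
    simp
  have hs := summable_mul_of_support_finite hf
  have hs2 := summable_mul_of_support_finite (support_shift_finite hf e) c
  calc _ = ∑ x ∈ hf.toFinset, (f x * c (x - e) - f x * c x) :=
        Finset.sum_congr rfl fun x _ => h1 x
    _ = ∑' x, (f x * c (x - e) - f x * c x) := by
        refine (tsum_eq_sum fun x hx => ?_).symm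
        rw [Set.Finite.mem_toFinset, Function.mem_support, not_not] at hx
        rw [hx, zero_mul, zero_mul, sub_zero]
    _ = ∑' x, f (x + e) * c x - ∑' x, f x * c x := by
        rw [(hs fun x => c (x - e)).tsum_sub (hs c), h2]
    _ = ∑' x, (f (x + e) * c x - f x * c x) := (hs2.tsum_sub (hs c)).symm
    _ = interpDeriv f i y := by
        unfold interpDeriv increment
        congr 1; ext x; rw [sub_mul]

/-- The times at which a line meets a lattice hyperplane that it crosses. -/
def crossingTimes (y w : Space d) : Set ℝ :=
  {s | ∃ i, w i ≠ 0 ∧ ∃ k : ℤ, y i + s * w i = k}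

lemma countable_crossingTimes (y w : Space d) : (crossingTimes y w).Countable := by
  have h : crossingTimes y w ⊆ ⋃ (i : Fin d) (k : ℤ), {((k : ℝ) - y i) / w i} := by
    rintro s ⟨i, hi, k, hk⟩
    simp only [Set.mem_iUnion, Set.mem_singleton_iff]
    refine ⟨i, k, ?_⟩
    rw [← hk]
    field_simp
    ring
  exact (Set.countable_iUnion fun i => Set.countable_iUnion fun k =>
    Set.countable_singleton _).mono h

lemma hasDerivAt_interp_line (hf : f.support.Finite) (y w : Space d) {s : ℝ}
    (hs : s ∉ crossingTimes y w) :
    HasDerivAt (fun s : ℝ => interp f (y + s • w)) (∑ i, interpDeriv f i (y + s • w) * w i) s := by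
  have h1 : ∀ (x : Lattice d) (j : Fin d), HasDerivAt (fun s : ℝ => tent ((y + s • w) j - x j))
      ((unitBox ((y + s • w) j - x j + 1) - unitBox ((y + s • w) j - x j)) * w j) s := by
    intro x j
    -- A coordinate with `w j = 0` is constant along the line, so it may sit at a kink of `tent`
    -- without harm.
    by_cases hj : w j = 0
    · simp only [PiLp.add_apply, PiLp.smul_apply, hj, smul_zero, mul_zero]
      exact hasDerivAt_const _ _
    · have hline : HasDerivAt (fun s : ℝ => (y + s • w) j - x j) (w j) s := by
        simp only [PiLp.add_apply, PiLp.smul_apply, smul_eq_mul]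
        simpa using (((hasDerivAt_id s).mul_const (w j)).const_add (y j)).sub_const (x j : ℝ)
      have htent : HasDerivAt tent _ ((y + s • w) j - x j) :=
        hasDerivAt_tent fun k hk => hs ⟨j, hj, k + x j, by
          simp only [PiLp.add_apply, PiLp.smul_apply, smul_eq_mul] at hk
          push_cast
          linarith⟩
      have hcomp := htent.comp s hline
      exact hcomp
  have h2 : HasDerivAt (fun s : ℝ => ∑ x ∈ hf.toFinset, f x * hat x (y + s • w))
      (∑ x ∈ hf.toFinset, f x * ∑ i, (∏ j ∈ Finset.univ.erase i, tent ((y + s • w) j - x j)) •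
        ((unitBox ((y + s • w) i - x i + 1) - unitBox ((y + s • w) i - x i)) * w i)) s :=
    HasDerivAt.fun_sum fun x _ => (HasDerivAt.fun_finsetProd fun j _ => h1 x j).const_mul _
  simp_rw [interp_eq_sum hf]
  convert! h2 using 1
  simp_rw [← sum_deriv_hat hf, Finset.sum_mul, Finset.mul_sum]
  rw [Finset.sum_comm]
  refine Finset.sum_congr rfl fun x _ => Finset.sum_congr rfl fun i _ => ?_
  rw [smul_eq_mul]
  ring

/-- The fundamental theorem of calculus holds off the countable set of crossing times;
Cauchy-Schwarz on `[0, 1]` does the rest. -/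
lemma sq_interp_sub_le (hf : f.support.Finite) (y w : Space d) :
    ENNReal.ofReal ((interp f (y + w) - interp f y) ^ 2) ≤
      ∫⁻ s in Set.Ioc (0 : ℝ) 1,
        ENNReal.ofReal ((∑ i, interpDeriv f i (y + s • w) * w i) ^ 2) := by
  set ψ : ℝ → ℝ := fun s => ∑ i, interpDeriv f i (y + s • w) * w i with hψ
  have hmeas : Measurable ψ := Finset.measurable_fun_sum _ fun i _ =>
    ((measurable_interpDeriv hf i).comp (by fun_prop)).mul_const _
  choose C hC using exists_interpDeriv_le hf
  have hbound : ∀ s, ‖ψ s‖ ≤ ∑ i, C i * ‖w i‖ := fun s =>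
    norm_sum_le_of_le _ fun i _ => by rw [norm_mul]; gcongr; exact hC i _
  set B := ∑ i, C i * ‖w i‖
  have hint : Integrable ψ (volume.restrict (Set.Ioc (0 : ℝ) 1)) :=
    Integrable.of_bound hmeas.aestronglyMeasurable B (Filter.Eventually.of_forall hbound)
  have hint2 : Integrable (fun s => ψ s * ψ s) (volume.restrict (Set.Ioc (0 : ℝ) 1)) :=
    hint.mul_bdd hmeas.aestronglyMeasurable (Filter.Eventually.of_forall hbound)
  have hftc : ∫ s in (0 : ℝ)..1, ψ s = interp f (y + w) - interp f y := by
    have h := integral_eq_of_hasDerivAt_off_countable (fun s : ℝ => interp f (y + s • w)) ψ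
      (a := 0) (b := 1) (countable_crossingTimes y w)
      ((continuous_interp hf).comp (by fun_prop)).continuousOn
      (fun s hs => hasDerivAt_interp_line hf y w hs.2)
      ((intervalIntegrable_iff_integrableOn_Ioc_of_le zero_le_one).2 hint)
    simpa using h
  have hcs := sq_integral_mul_le (m := volume.restrict (Set.Ioc (0 : ℝ) 1)) (f := ψ)
    (g := fun _ => 1) hint2 (by simpa using hint) (by simp)
  rw [← hftc, intervalIntegral.integral_of_le zero_le_one]
  simp only [mul_one, integral_const, MeasurableSet.univ, measureReal_restrict_apply,
    Set.univ_inter, Real.volume_real_Ioc, sub_zero, smul_eq_mul, zero_le_one, max_eq_left] at hcs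
  calc _ ≤ ENNReal.ofReal (∫ s in Set.Ioc (0 : ℝ) 1, ψ s * ψ s) := ENNReal.ofReal_le_ofReal hcs
    _ = _ := by
      rw [ofReal_integral_eq_lintegral_ofReal hint2
        (Filter.Eventually.of_forall fun s => mul_self_nonneg _)]
      simp_rw [← sq]
      rfl

lemma lintegral_sq_interpDeriv_le (hf : f.support.Finite) (i : Fin d) :
    ∫⁻ y, ENNReal.ofReal (interpDeriv f i y ^ 2) ≤
      ENNReal.ofReal (∑' x, increment f i x ^ 2) := by
  simp_rw [interpDeriv_eq_sum hf]
  refine (lintegral_sq_sum_profile_le (isProfile_edgeProfile i) _ _).trans_eq ?_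
  congr 1
  refine (tsum_eq_sum fun x hx => ?_).symm
  rw [Set.Finite.mem_toFinset, Function.mem_support, not_not] at hx
  rw [hx, sq, zero_mul]

/-- Interpolation does not increase the Dirichlet energy. -/
theorem heatForm_interp_le (hf : f.support.Finite) {t : ℝ} (ht : 0 < t) :
    heatForm t (interp f) (interp f) ≤ t * ∑ i, ∑' x, increment f i x ^ 2 := by
  have hprob := isProbabilityMeasure_heatMeasure (d := d) ht
  have hnn : 0 ≤ ∑ i, ∑' x, increment f i x ^ 2 :=
    Finset.sum_nonneg fun i _ => tsum_nonneg fun x => sq_nonneg _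
  have hDm := measurable_interpDeriv hf
  have hjoint : Measurable fun p : (Space d × Space d) × ℝ =>
      ENNReal.ofReal ((∑ i, interpDeriv f i (p.1.1 + p.2 • p.1.2) * p.1.2 i) ^ 2) := by
    refine ((Finset.measurable_fun_sum _ fun i _ => ?_).pow_const 2).ennreal_ofReal
    exact ((hDm i).comp (by fun_prop)).mul (by fun_prop)
  have hjoint2 : Measurable fun p : Space d × Space d =>
      ENNReal.ofReal ((∑ i, interpDeriv f i p.1 * p.2 i) ^ 2) := by
    refine ((Finset.measurable_fun_sum _ fun i _ => ?_).pow_const 2).ennreal_ofReal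
    exact ((hDm i).comp (by fun_prop)).mul (by fun_prop)
  rw [← ENNReal.ofReal_le_ofReal_iff (by positivity), heatForm,
    ofReal_integral_eq_lintegral_ofReal (heatForm_eq ht (isNice_interp hf) (isNice_interp hf)).1
      (Filter.Eventually.of_forall fun z => mul_self_nonneg _)]
  calc _ ≤ ∫⁻ z : Space d × Space d, (∫⁻ s in Set.Ioc (0 : ℝ) 1,
          ENNReal.ofReal ((∑ i, interpDeriv f i (z.1 + s • z.2) * z.2 i) ^ 2))
          ∂(volume.prod (heatMeasure d t)) := by
        refine lintegral_mono fun z => ?_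
        rw [← sq]
        exact sq_interp_sub_le hf z.1 z.2
    _ = ∫⁻ w, ∫⁻ y, (∫⁻ s in Set.Ioc (0 : ℝ) 1,
          ENNReal.ofReal ((∑ i, interpDeriv f i (y + s • w) * w i) ^ 2)) ∂volume
          ∂(heatMeasure d t) :=
        lintegral_prod_symm _ hjoint.lintegral_prod_right'.aemeasurable
    _ = ∫⁻ w, ∫⁻ y, ENNReal.ofReal ((∑ i, interpDeriv f i y * w i) ^ 2) ∂volume
          ∂(heatMeasure d t) := by
        -- Translation by `s • w` preserves Lebesgue measure, so after exchanging the integrals the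
        -- variable `s` disappears.
        refine lintegral_congr fun w => ?_
        rw [lintegral_lintegral_swap (f := fun y s =>
          ENNReal.ofReal ((∑ i, interpDeriv f i (y + s • w) * w i) ^ 2)) (hjoint.comp
          (by fun_prop : Measurable fun p : Space d × ℝ => ((p.1, w), p.2))).aemeasurable]
        simp_rw [fun s : ℝ => lintegral_add_right_eq_self (μ := (volume : Measure (Space d)))
          (fun y => ENNReal.ofReal ((∑ i, interpDeriv f i y * w i) ^ 2)) (s • w)]
        simp
    _ = ∫⁻ y, ∫⁻ w, ENNReal.ofReal ((∑ i, interpDeriv f i y * w i) ^ 2) ∂(heatMeasure d t) := by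
        rw [lintegral_lintegral_swap]
        exact (hjoint2.comp measurable_swap).aemeasurable
    _ ≤ ∫⁻ y, ∑ i, ENNReal.ofReal t * ENNReal.ofReal (interpDeriv f i y ^ 2) := by
        -- For fixed `y`, the displacement `w` has covariance `t` times the identity; it is tested
        -- against the gradient of the interpolation at `y`.
        refine lintegral_mono fun y => ?_
        have h := lintegral_heatMeasure_inner_sq_le ht
          (WithLp.toLp 2 fun i => interpDeriv f i y : Space d)
        simp only [PiLp.inner_apply, EuclideanSpace.norm_sq_eq, Real.norm_eq_abs, sq_abs,
          RCLike.inner_apply, conj_trivial] at h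
        rw [ENNReal.ofReal_mul ht.le, ENNReal.ofReal_sum_of_nonneg fun i _ => sq_nonneg _,
          Finset.mul_sum] at h
        simpa only [mul_comm] using h
    _ = ∑ i, ENNReal.ofReal t * ∫⁻ y, ENNReal.ofReal (interpDeriv f i y ^ 2) := by
        rw [lintegral_finsetSum _ fun i _ =>
          (((hDm i).pow_const 2).ennreal_ofReal).const_mul _]
        exact Finset.sum_congr rfl fun i _ =>
          lintegral_const_mul _ ((hDm i).pow_const 2).ennreal_ofReal
    _ ≤ ∑ i, ENNReal.ofReal t * ENNReal.ofReal (∑' x, increment f i x ^ 2) := by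
        gcongr with i
        exact lintegral_sq_interpDeriv_le hf i
    _ = ENNReal.ofReal (t * ∑ i, ∑' x, increment f i x ^ 2) := by
        rw [← Finset.mul_sum, ENNReal.ofReal_mul ht.le,
          ENNReal.ofReal_sum_of_nonneg fun i _ => tsum_nonneg fun x => sq_nonneg _]

end Interpolation

/-! ### The averaging operator of simple random walk -/

section Average

/-- The step of simple random walk attached to a direction and a sign. -/
def stepVec {d : ℕ} (p : Fin d × Bool) : Lattice d := Pi.single p.1 (if p.2 then (1 : ℤ) else -1)

/-- The transition operator of simple random walk. -/
noncomputable def avg (d : ℕ) : (Lattice d → ℝ) →ₗ[ℝ] (Lattice d → ℝ) where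
  toFun f x := (2 * d : ℝ)⁻¹ * ∑ p : Fin d × Bool, f (x + stepVec p)
  map_add' f g := by ext x; simp [Finset.sum_add_distrib, mul_add]
  map_smul' c f := by ext x; simp [← Finset.mul_sum]; ring

variable {d : ℕ}

lemma avg_apply (f : Lattice d → ℝ) (x : Lattice d) :
    avg d f x = (2 * d : ℝ)⁻¹ * ∑ p : Fin d × Bool, f (x + stepVec p) := rfl

lemma avg_nonneg {f : Lattice d → ℝ} (hf : ∀ x, 0 ≤ f x) (x : Lattice d) : 0 ≤ avg d f x := by
  rw [avg_apply]
  exact mul_nonneg (by positivity) (Finset.sum_nonneg fun p _ => hf _)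

lemma avg_pow_succ (n : ℕ) (f : Lattice d → ℝ) :
    (avg d ^ (n + 1)) f = avg d ((avg d ^ n) f) := by
  rw [pow_succ']; rfl

lemma avg_pow_nonneg (n : ℕ) {f : Lattice d → ℝ} (hf : ∀ x, 0 ≤ f x) (x : Lattice d) :
    0 ≤ (avg d ^ n) f x := by
  induction n generalizing x with
  | zero => exact hf x
  | succ n ih => rw [avg_pow_succ]; exact avg_nonneg ih x

lemma support_avg_finite {f : Lattice d → ℝ} (hf : f.support.Finite) :
    (avg d f).support.Finite := by
  refine (Set.finite_iUnion fun p : Fin d × Bool => support_shift_finite hf (stepVec p)).subset ?_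
  intro x hx
  rw [Function.mem_support, avg_apply] at hx
  obtain ⟨p, _, hp⟩ := Finset.exists_ne_zero_of_sum_ne_zero (right_ne_zero_of_mul hx)
  exact Set.mem_iUnion.2 ⟨p, hp⟩

lemma support_avg_pow_finite (n : ℕ) {f : Lattice d → ℝ} (hf : f.support.Finite) :
    ((avg d ^ n) f).support.Finite := by
  induction n with
  | zero => exact hf
  | succ n ih => rw [avg_pow_succ]; exact support_avg_finite ih

lemma support_sum_finite {ι : Type*} {s : Finset ι} {f : ι → Lattice d → ℝ}
    (hf : ∀ i ∈ s, (f i).support.Finite) : (∑ i ∈ s, f i).support.Finite := by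
  classical
  induction s using Finset.induction_on with
  | empty => simp
  | insert a s ha ih =>
    rw [Finset.sum_insert ha]
    exact ((hf a (by simp)).union (ih fun i hi => hf i (by simp [hi]))).subset
      (Function.support_add _ _)

lemma tsum_mul_shift {f : Lattice d → ℝ} (i : Fin d) (b : Bool) :
    ∑' x, f x * f (x + stepVec (i, b)) = ∑' x, f x * f (x + Pi.single i 1) := by
  cases b
  · rw [← (Equiv.addRight (Pi.single i (1 : ℤ) : Lattice d)).tsum_eq]
    refine tsum_congr fun x => ?_
    have : (Pi.single i 1 : Lattice d) + Pi.single i (-1) = 0 := by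
      rw [← Pi.single_add]; simp
    simp [stepVec, add_assoc, this, mul_comm]
  · rfl

/-- The Dirichlet energy as a sum over edges. -/
lemma sum_tsum_sq_increment [NeZero d] {f : Lattice d → ℝ} (hf : f.support.Finite) :
    ∑ i, ∑' x, increment f i x ^ 2 = 2 * d * ∑' x, f x * (f x - avg d f x) := by
  have hs := summable_mul_of_support_finite hf
  have h1 : ∀ i : Fin d, ∑' x, increment f i x ^ 2 =
      2 * ∑' x, f x * f x - 2 * ∑' x, f x * f (x + Pi.single i 1) := by
    intro i
    have hshift : ∑' x : Lattice d, f (x + Pi.single i 1) * f (x + Pi.single i 1) = ∑' x, f x * f x :=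
      (Equiv.addRight (Pi.single i (1 : ℤ) : Lattice d)).tsum_eq fun x => f x * f x
    have hs2 := summable_mul_of_support_finite (support_shift_finite hf (Pi.single i 1))
      fun x => f (x + Pi.single i 1)
    have e : ∀ x, increment f i x ^ 2 = (f (x + Pi.single i 1) * f (x + Pi.single i 1) + f x * f x)
        - 2 * (f x * f (x + Pi.single i 1)) := fun x => by unfold increment; ring
    simp_rw [e]
    rw [(hs2.add (hs f)).tsum_sub ((hs _).mul_left 2), hs2.tsum_add (hs f), hshift, tsum_mul_left]
    ring
  have h2 : ∑' x, f x * (f x - avg d f x) =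
      ∑' x, f x * f x - (2 * d : ℝ)⁻¹ * ∑ p : Fin d × Bool, ∑' x, f x * f (x + stepVec p) := by
    simp_rw [mul_sub]
    rw [(hs f).tsum_sub (hs _)]
    congr 1
    rw [← Summable.tsum_finsetSum fun p _ => hs fun x => f (x + stepVec p), ← tsum_mul_left]
    refine tsum_congr fun x => ?_
    rw [avg_apply, ← Finset.mul_sum]
    ring
  have hd : (d : ℝ) ≠ 0 := by exact_mod_cast NeZero.ne d
  rw [h2, Fintype.sum_prod_type]
  simp_rw [tsum_mul_shift, h1]
  simp only [Finset.sum_const, Finset.sum_sub_distrib, Finset.card_univ, Fintype.card_fin,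
    Fintype.card_bool, nsmul_eq_mul, ← Finset.mul_sum]
  field_simp
  push_cast
  ring

/-- The discretization of a measure of finite energy has bounded truncated lattice energy. -/
theorem tsum_potential_le [NeZero d] {μ : Measure (Space d)} [IsFiniteMeasure μ] {e : ℝ}
    (he0 : 0 ≤ e) (he : brownianEnergy μ ≤ ENNReal.ofReal e) {ν : Lattice d → ℝ}
    (hν : ∀ x, ν x = ∫ y, hat x y ∂μ) (hfin : ν.support.Finite) (n : ℕ) :
    ∑ k ∈ Finset.range n, ∑' x, ν x * (avg d ^ k) ν x ≤ d * e := by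
  have hν0 : ∀ x, 0 ≤ ν x := fun x => by rw [hν]; exact integral_nonneg fun y => hat_nonneg x y
  -- The potential of `ν`, truncated at time `n`: it has finite support and makes sense before
  -- transience is known. The price is the term `A^n ν` in `(1 - A) f`, which has a favorable sign.
  set f : Lattice d → ℝ := ∑ k ∈ Finset.range n, (avg d ^ k) ν with hf
  have hf0 : ∀ x, 0 ≤ f x := fun x => by
    rw [hf, Finset.sum_apply]; exact Finset.sum_nonneg fun k _ => avg_pow_nonneg k hν0 x
  have hffin : f.support.Finite := support_sum_finite fun k _ => support_avg_pow_finite k hfin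
  have hlap : f - avg d f = ν - (avg d ^ n) ν := by
    rw [hf, map_sum, ← Finset.sum_sub_distrib]
    have h := Finset.sum_range_sub' (fun k => (avg d ^ k) ν) n
    simp only [avg_pow_succ, pow_zero, Module.End.one_apply] at h
    exact h
  set a := ∑' x, f x * ν x with ha
  have ha_eq : ∑ k ∈ Finset.range n, ∑' x, ν x * (avg d ^ k) ν x = a := by
    rw [← Summable.tsum_finsetSum fun k _ => summable_mul_of_support_finite hfin _, ha]
    refine tsum_congr fun x => ?_
    rw [hf, Finset.sum_apply, ← Finset.mul_sum, mul_comm]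
  have hform : ∑' x, f x * (f x - avg d f x) ≤ a := by
    refine Summable.tsum_le_tsum (fun x => ?_) (summable_mul_of_support_finite hffin _)
      (summable_mul_of_support_finite hffin _)
    have h := congrFun hlap x
    simp only [Pi.sub_apply] at h
    rw [h]
    exact mul_le_mul_of_nonneg_left (by linarith [avg_pow_nonneg n hν0 x]) (hf0 x)
  have hd : (0 : ℝ) < d := by exact_mod_cast Nat.pos_of_ne_zero (NeZero.ne d)
  have ha0 : 0 ≤ a := tsum_nonneg fun x => mul_nonneg (hf0 x) (hν0 x)
  have hhat : ∀ x, Integrable (hat x) μ := fun x =>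
    Integrable.of_bound (isNice_hat x).measurable.aestronglyMeasurable 1
      (Filter.Eventually.of_forall fun y => by
        rw [Real.norm_of_nonneg (hat_nonneg x y)]; exact hat_le_one x y)
  have hpair : ∫ y, interp f y ∂μ = a := by
    simp_rw [interp_eq_sum hffin]
    rw [integral_finsetSum _ fun x _ => (hhat x).const_mul _, ha]
    simp_rw [integral_const_mul, ← hν]
    refine (tsum_eq_sum fun x hx => ?_).symm
    rw [Set.Finite.mem_toFinset, Function.mem_support, not_not] at hx
    rw [hx, zero_mul]
  -- The constant `D = d * a`: the heat form is at most `t` times the edge sum `2 d ⟨f, f - A f⟩`,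
  -- hence at most `2 t (d a)`.
  have hmain := sq_integral_le_of_heatForm_le (μ := μ) (Nat.pos_of_ne_zero (NeZero.ne d))
    (isNice_interp hffin) (continuous_interp hffin) (D := d * a) (by positivity) he0
    (fun t ht => (heatForm_interp_le hffin ht).trans (by
      rw [sum_tsum_sq_increment hffin]
      nlinarith [mul_le_mul_of_nonneg_left hform (by positivity : 0 ≤ 2 * t * (d : ℝ))])) he
  rw [hpair] at hmain
  rw [ha_eq]
  rcases ha0.eq_or_lt with h | h
  · rw [← h]; positivity
  · nlinarith

end Average

/-! ### First-step analysis of simple random walk -/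

/-- Prepending an element to a sequence. -/
def seqCons {α : Type*} (z : α) (ξ : ℕ → α) : ℕ → α
  | 0 => z
  | n + 1 => ξ n

lemma measurable_seqCons {α : Type*} [MeasurableSpace α] :
    Measurable fun p : α × (ℕ → α) => seqCons p.1 p.2 := by
  refine measurable_pi_lambda _ fun n => ?_
  cases n with
  | zero => exact measurable_fst
  | succ n => exact (measurable_pi_apply n).comp measurable_snd

/-- A sequence of i.i.d. variables is one variable followed by an independent such sequence. -/
lemma map_seqCons_prod {α : Type*} [MeasurableSpace α] (m : Measure α) [IsProbabilityMeasure m] :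
    (m.prod (Measure.infinitePi fun _ : ℕ => m)).map (fun p => seqCons p.1 p.2) =
      Measure.infinitePi fun _ : ℕ => m := by
  classical
  refine Measure.eq_infinitePi _ fun s t ht => ?_
  rw [Measure.map_apply measurable_seqCons
    (MeasurableSet.pi s.countable_toSet fun i _ => ht i)]
  set s' := s.preimage Nat.succ (Nat.succ_injective.injOn) with hs'
  have hpre : (fun p : α × (ℕ → α) => seqCons p.1 p.2) ⁻¹' Set.pi s t =
      (if 0 ∈ s then t 0 else Set.univ) ×ˢ Set.pi s' fun n => t (n + 1) := by
    ext ⟨z, ξ⟩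
    simp only [Set.mem_preimage, Set.mem_pi, Finset.mem_coe, Set.mem_prod, hs',
      Finset.mem_preimage]
    constructor
    · intro h
      refine ⟨?_, fun n hn => h (n + 1) hn⟩
      split_ifs with h0
      · exact h 0 h0
      · trivial
    · rintro ⟨h0, h⟩ n hn
      cases n with
      | zero => rw [if_pos hn] at h0; exact h0
      | succ n => exact h n hn
  rw [hpre, Measure.prod_prod, Measure.infinitePi_pi _ fun i _ => ht (i + 1)]
  have himg : ∏ n ∈ s', m (t (n + 1)) = ∏ n ∈ s.erase 0, m (t n) := by
    refine Finset.prod_bij (fun n _ => n + 1) ?_ ?_ ?_ ?_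
    · intro n hn
      rw [hs', Finset.mem_preimage] at hn
      exact Finset.mem_erase.2 ⟨Nat.succ_ne_zero n, hn⟩
    · intro a _ b _ hab
      exact Nat.succ_injective hab
    · intro n hn
      obtain ⟨h0, hn⟩ := Finset.mem_erase.1 hn
      refine ⟨n - 1, ?_, Nat.succ_pred_eq_of_ne_zero h0⟩
      rw [hs', Finset.mem_preimage]
      rwa [show Nat.succ (n - 1) = n from Nat.succ_pred_eq_of_ne_zero h0]
    · intro n _; rfl
  rw [himg]
  split_ifs with h0
  · rw [Finset.mul_prod_erase s (fun n => m (t n)) h0]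
  · rw [measure_univ, one_mul, Finset.erase_eq_of_notMem h0]

section Walk

lemma measurableSet_eval_eq {d : ℕ} (k : ℕ) (y : Lattice d) :
    MeasurableSet {X : ℕ → Lattice d | X k = y} :=
  measurableSet_eq_fun (measurable_pi_apply k) measurable_const

variable {d : ℕ} [NeZero d]

instance isProbabilityMeasure_walkLaw (x : Lattice d) : IsProbabilityMeasure (walkLaw d x) :=
  Measure.isProbabilityMeasure_map (Measurable.aemeasurable (by fun_prop))

lemma stepPMF_apply_toReal_sum (F : Lattice d → ℝ≥0∞) :
    ∫⁻ z, F z ∂(stepPMF d).toMeasure =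
      ENNReal.ofReal (2 * d : ℝ)⁻¹ * ∑ p : Fin d × Bool, F (stepVec p) := by
  have hm : Measurable F := measurable_of_countable F
  have hcard : ((Fintype.card (Fin d × Bool) : ℕ) : ℝ≥0∞)⁻¹ = ENNReal.ofReal (2 * d : ℝ)⁻¹ := by
    have hd : (0 : ℝ) < d := by exact_mod_cast Nat.pos_of_ne_zero (NeZero.ne d)
    rw [ENNReal.ofReal_inv_of_pos (by positivity)]
    congr 1
    rw [Fintype.card_prod, Fintype.card_fin, Fintype.card_bool,
      ENNReal.ofReal_mul (by norm_num), ENNReal.ofReal_natCast]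
    push_cast
    rw [ENNReal.ofReal_ofNat, mul_comm]
  rw [stepPMF, ← PMF.toMeasure_map _ _ (measurable_of_finite _),
    lintegral_map hm (measurable_of_finite _), lintegral_fintype, Finset.mul_sum]
  refine Finset.sum_congr rfl fun p _ => ?_
  rw [PMF.toMeasure_apply_singleton _ _ (measurableSet_singleton p), PMF.uniformOfFintype_apply,
    hcard, mul_comm]
  rfl

lemma walkLaw_apply (x : Lattice d) {A : Set (ℕ → Lattice d)} (hA : MeasurableSet A) :
    walkLaw d x A = Measure.infinitePi (fun _ : ℕ => (stepPMF d).toMeasure)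
      {ξ | (fun n => x + ∑ i ∈ Finset.range n, ξ i) ∈ A} := by
  rw [walkLaw, Measure.map_apply (by fun_prop) hA]
  rfl

/-- The Markov property at time one. -/
lemma walkLaw_shift (x : Lattice d) {A : Set (ℕ → Lattice d)} (hA : MeasurableSet A) :
    (walkLaw d x).real {X | (fun n => X (n + 1)) ∈ A} =
      avg d (fun z => (walkLaw d z).real A) x := by
  set Q := Measure.infinitePi fun _ : ℕ => (stepPMF d).toMeasure with hQ
  have hshift : MeasurableSet {X : ℕ → Lattice d | (fun n => X (n + 1)) ∈ A} := by
    refine measurableSet_preimage ?_ hA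
    fun_prop
  have hmeas : MeasurableSet {ξ : ℕ → Lattice d |
      (fun n => x + ∑ i ∈ Finset.range n, ξ i) ∈ {X : ℕ → Lattice d | (fun n => X (n + 1)) ∈ A}} := by
    refine measurableSet_preimage ?_ hshift
    fun_prop
  have h : walkLaw d x {X | (fun n => X (n + 1)) ∈ A} =
      ENNReal.ofReal (2 * d : ℝ)⁻¹ * ∑ p : Fin d × Bool, walkLaw d (x + stepVec p) A := by
    rw [walkLaw_apply x hshift, ← map_seqCons_prod, Measure.map_apply measurable_seqCons hmeas,
      Measure.prod_apply (measurable_seqCons hmeas),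
      ← stepPMF_apply_toReal_sum fun z => walkLaw d (x + z) A]
    refine lintegral_congr fun z => ?_
    rw [walkLaw_apply _ hA]
    congr 1
    ext ξ
    simp only [Set.mem_preimage, Set.mem_ofPred_eq]
    have e : (fun n => x + ∑ i ∈ Finset.range (n + 1), seqCons z ξ i) =
        fun n => x + z + ∑ i ∈ Finset.range n, ξ i := by
      ext1 n
      rw [Finset.sum_range_succ', add_comm _ (seqCons z ξ 0), ← add_assoc]
      rfl
    rw [e]
  rw [measureReal_def, h, avg_apply, ENNReal.toReal_mul, ENNReal.toReal_ofReal (by positivity),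
    ENNReal.toReal_sum fun p _ => measure_ne_top _ _]
  rfl

/-- The empty sum at time zero makes `X 0 = x` hold for every sequence of steps. -/
lemma walkLaw_start (x : Lattice d) {A : Set (ℕ → Lattice d)} (hA : MeasurableSet A) :
    (walkLaw d x).real A = (walkLaw d x).real {X | X 0 = x ∧ X ∈ A} := by
  have hm : MeasurableSet {X : ℕ → Lattice d | X 0 = x ∧ X ∈ A} :=
    (measurableSet_eq_fun (measurable_pi_apply 0) measurable_const).inter hA
  rw [measureReal_def, measureReal_def, walkLaw_apply x hA, walkLaw_apply x hm]
  simp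

/-- The transition probabilities of simple random walk. -/
noncomputable def trans (k : ℕ) (x y : Lattice d) : ℝ := (walkLaw d x).real {X | X k = y}

lemma trans_zero (x y : Lattice d) : trans 0 x y = if x = y then 1 else 0 := by
  rw [trans, walkLaw_start x (measurableSet_eval_eq 0 y)]
  split_ifs with h
  · have e : {X : ℕ → Lattice d | X 0 = x ∧ X ∈ {X : ℕ → Lattice d | X 0 = y}} =
        {X : ℕ → Lattice d | X 0 = x ∧ X ∈ Set.univ} := by
      ext X; simp [h]
    rw [e, ← walkLaw_start x MeasurableSet.univ]
    simp
  · have e : {X : ℕ → Lattice d | X 0 = x ∧ X ∈ {X : ℕ → Lattice d | X 0 = y}} = ∅ := by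
      ext X
      simp only [Set.mem_ofPred_eq, Set.mem_empty_iff_false, iff_false, not_and]
      rintro rfl
      exact h
    rw [e]
    simp

lemma trans_succ (k : ℕ) (x y : Lattice d) :
    trans (k + 1) x y = avg d (fun z => trans k z y) x :=
  walkLaw_shift x (measurableSet_eval_eq k y)

lemma trans_nonneg (k : ℕ) (x y : Lattice d) : 0 ≤ trans k x y := measureReal_nonneg

lemma avg_pow_apply (k : ℕ) {f : Lattice d → ℝ} (hf : f.support.Finite) (x : Lattice d) :
    (avg d ^ k) f x = ∑ y ∈ hf.toFinset, f y * trans k x y := by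
  induction k generalizing x with
  | zero =>
    simp_rw [trans_zero]
    simp only [pow_zero, Module.End.one_apply, mul_ite, mul_one, mul_zero, Finset.sum_ite_eq,
      Set.Finite.mem_toFinset, Function.mem_support]
    split_ifs with h
    · rfl
    · exact not_not.1 h
  | succ k ih =>
    rw [avg_pow_succ, avg_apply]
    simp_rw [ih, trans_succ, avg_apply]
    rw [Finset.sum_comm, Finset.mul_sum]
    refine Finset.sum_congr rfl fun y _ => ?_
    rw [← Finset.mul_sum]
    ring

end Walk

/-! ### Transience in dimension at least three -/

section Transience

variable {d : ℕ}

/-- The cube of side `2R` centered at the origin. -/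
def solidCube (d : ℕ) (R : ℝ) : Set (Space d) := {y | ∀ i, |y i| ≤ R}

lemma isCompact_solidCube (R : ℝ) : IsCompact (solidCube d R) := by
  have h : solidCube d R = (EuclideanSpace.equiv (Fin d) ℝ) ⁻¹'
      (Set.pi Set.univ fun _ => Set.Icc (-R) R) := by
    ext y
    simp only [solidCube, abs_le, Set.mem_ofPred_eq, Set.mem_preimage, Set.mem_pi, Set.mem_univ,
      true_imp_iff, Set.mem_Icc]
    rfl
  rw [h]
  exact (EuclideanSpace.equiv (Fin d) ℝ).toHomeomorph.isCompact_preimage.2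
    (isCompact_univ_pi fun _ => isCompact_Icc)

lemma measurableSet_solidCube (R : ℝ) : MeasurableSet (solidCube d R) :=
  (isCompact_solidCube R).measurableSet

instance isFiniteMeasure_restrict_solidCube (R : ℝ) :
    IsFiniteMeasure ((volume : Measure (Space d)).restrict (solidCube d R)) :=
  ⟨by simpa using (isCompact_solidCube R).measure_lt_top⟩

lemma hat_eq_zero {x : Lattice d} {y : Space d} (h : ∃ j, 1 ≤ |y j - x j|) : hat x y = 0 := by
  obtain ⟨j, hj⟩ := h
  exact Finset.prod_eq_zero (Finset.mem_univ j) (tent_eq_zero hj)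

lemma mem_box_iff {n : ℕ} {x : Lattice d} : x ∈ box d n ↔ ∀ i, |x i| ≤ n := by
  simp [box, Finset.mem_Icc, Pi.le_def, abs_le, forall_and]

lemma lintegral_heat_le {t : ℝ} (ht : 0 < t) (x : Space d) (A : Set (Space d)) :
    ∫⁻ y in A, ENNReal.ofReal (heat d t (x - y)) ≤ 1 := by
  refine (setLIntegral_le_lintegral _ _).trans_eq ?_
  rw [lintegral_sub_left_eq_self (fun y => ENNReal.ofReal (heat d t y)) x,
    ← ofReal_integral_eq_lintegral_ofReal (integrable_heat ht)
      (Filter.Eventually.of_forall fun v => heat_nonneg ht.le v), integral_heat ht,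
    ENNReal.ofReal_one]

/-- In dimension at least three, Lebesgue measure on a cube has finite energy. -/
lemma brownianEnergy_restrict_lt_top (hd : 3 ≤ d) (R : ℝ) :
    brownianEnergy ((volume : Measure (Space d)).restrict (solidCube d R)) < ⊤ := by
  set μ := (volume : Measure (Space d)).restrict (solidCube d R)
  set a := μ Set.univ with ha
  have hatop : a < ⊤ := measure_lt_top _ _
  -- For times up to `1` use that the heat kernel has mass one; beyond `1` use its supremum,
  -- integrable at infinity because `d / 2 > 1`.
  rw [brownianEnergy_eq, ← Set.Ioc_union_Ioi_eq_Ioi (zero_le_one' ℝ)]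
  refine (lintegral_union_le _ _ _).trans_lt (ENNReal.add_lt_top.2 ⟨?_, ?_⟩)
  · refine (setLIntegral_mono' (g := fun _ => a) measurableSet_Ioc fun r hr => ?_).trans_lt ?_
    · refine (lintegral_mono fun x => lintegral_heat_le hr.1 x _).trans_eq ?_
      simp [ha]
    · simpa using hatop
  · have hint : IntegrableOn (fun r : ℝ => (2 * Real.pi * r) ^ (-(d : ℝ) / 2)) (Set.Ioi 1) := by
      have hd' : -(d : ℝ) / 2 < -1 := by
        have : (3 : ℝ) ≤ d := by exact_mod_cast hd
        linarith
      refine IntegrableOn.congr_fun ((integrableOn_Ioi_rpow_of_lt hd' one_pos).const_mul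
        ((2 * Real.pi) ^ (-(d : ℝ) / 2))) (fun r hr => ?_) measurableSet_Ioi
      rw [Set.mem_Ioi] at hr
      exact (Real.mul_rpow (by positivity) (by linarith)).symm
    refine (setLIntegral_mono' (g := fun r => ENNReal.ofReal ((2 * Real.pi * r) ^ (-(d : ℝ) / 2)) *
      (a * a)) measurableSet_Ioi fun r hr => ?_).trans_lt ?_
    · have hr0 : 0 < r := one_pos.trans hr
      calc _ ≤ ∫⁻ x, ∫⁻ y, ENNReal.ofReal ((2 * Real.pi * r) ^ (-(d : ℝ) / 2)) ∂μ ∂μ :=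
            lintegral_mono fun x => lintegral_mono fun y =>
              ENNReal.ofReal_le_ofReal (heat_le hr0 _)
        _ = _ := by simp [mul_assoc, ha]
    · rw [lintegral_mul_const' _ _ (ENNReal.mul_lt_top hatop hatop).ne]
      exact ENNReal.mul_lt_top hint.lintegral_lt_top (ENNReal.mul_lt_top hatop hatop)

lemma support_integral_hat_finite {μ : Measure (Space d)} {R : ℝ} (hμ : μ (solidCube d R)ᶜ = 0) :
    (fun x => ∫ y, hat x y ∂μ).support.Finite := by
  obtain ⟨n, hn⟩ := exists_nat_gt (R + 1)
  refine (box d n).finite_toSet.subset fun x hx => ?_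
  by_contra hxn
  refine hx (integral_eq_zero_of_ae ?_)
  filter_upwards [measure_eq_zero_iff_ae_notMem.1 hμ] with y hy
  simp only [Set.mem_compl_iff, not_not] at hy
  rw [Finset.mem_coe, mem_box_iff] at hxn
  push Not at hxn
  obtain ⟨i, hi⟩ := hxn
  refine hat_eq_zero ⟨i, ?_⟩
  have h1 : (n : ℝ) < |(x i : ℝ)| := by exact_mod_cast hi
  have h2 := abs_sub_abs_le_abs_sub (x i : ℝ) (y i)
  rw [abs_sub_comm] at h2
  linarith [hy i]

lemma integral_hat_pos {x : Lattice d} {n : ℕ} (hx : x ∈ box d n) :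
    0 < ∫ y in solidCube d (n + 1), hat x y := by
  rw [integral_pos_iff_support_of_nonneg (hat_nonneg x) ((isNice_hat x).integrable.restrict)]
  have hopen : IsOpen (hat x).support := (continuous_hat x).isOpen_support
  have hsub : (hat x).support ⊆ solidCube d (n + 1) := by
    intro y hy i
    have h1 : |y i - x i| < 1 := by
      by_contra h
      exact hy (hat_eq_zero ⟨i, not_lt.1 h⟩)
    have h2 : |(x i : ℝ)| ≤ n := by exact_mod_cast mem_box_iff.1 hx i
    have h3 := abs_sub_abs_le_abs_sub (y i) (x i)
    linarith
  rw [Measure.restrict_apply hopen.measurableSet, Set.inter_eq_left.2 hsub]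
  refine hopen.measure_pos _ ⟨WithLp.toLp 2 fun i => (x i : ℝ), ?_⟩
  rw [Function.mem_support, hat]
  simp [tent]

lemma measurableSet_lastExit (K : Finset (Lattice d)) (n : ℕ) (y : Lattice d) :
    MeasurableSet {X : ℕ → Lattice d | X n = y ∧ ∀ m, n < m → X m ∉ K} := by
  have h : {X : ℕ → Lattice d | X n = y ∧ ∀ m, n < m → X m ∉ K} =
      {X | X n = y} ∩ ⋂ (m : ℕ) (_ : n < m), (fun X : ℕ → Lattice d => X m) ⁻¹' (K : Set _)ᶜ := by
    ext X; simp
  rw [h]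
  exact (measurableSet_eval_eq n y).inter (MeasurableSet.iInter fun m => MeasurableSet.iInter
    fun _ => measurable_pi_apply m (K.measurableSet.compl))

variable [NeZero d]

/-- Simple random walk is transient in dimension at least three. -/
theorem summable_trans (hd : 3 ≤ d) (x y : Lattice d) : Summable fun k => trans k x y := by
  obtain ⟨n, hxn, hyn⟩ : ∃ n : ℕ, x ∈ box d n ∧ y ∈ box d n := by
    refine ⟨∑ i, (x i).natAbs + ∑ i, (y i).natAbs, ?_⟩
    simp only [mem_box_iff]
    have h : ∀ (z : Lattice d) i, (z i).natAbs ≤ ∑ i, (z i).natAbs := fun z i =>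
      Finset.single_le_sum (f := fun i => (z i).natAbs) (fun _ _ => Nat.zero_le _)
        (Finset.mem_univ i)
    constructor <;> intro i
    · rw [Int.abs_eq_natAbs]
      exact_mod_cast (h x i).trans (Nat.le_add_right _ _)
    · rw [Int.abs_eq_natAbs]
      exact_mod_cast (h y i).trans (Nat.le_add_left _ _)
  set μ := (volume : Measure (Space d)).restrict (solidCube d (n + 1)) with hμ
  set ν : Lattice d → ℝ := fun z => ∫ y, hat z y ∂μ with hν
  have hν0 : ∀ z, 0 ≤ ν z := fun z => integral_nonneg (hat_nonneg z)
  have hfin : ν.support.Finite := support_integral_hat_finite (R := n + 1) (by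
    rw [hμ, Measure.restrict_apply (measurableSet_solidCube _).compl]; simp)
  have hνx : 0 < ν x := integral_hat_pos hxn
  have hνy : 0 < ν y := integral_hat_pos hyn
  have he := brownianEnergy_restrict_lt_top hd (n + 1 : ℝ)
  rw [← hμ] at he
  have hbound := tsum_potential_le (μ := μ) ENNReal.toReal_nonneg
    (ENNReal.ofReal_toReal he.ne).ge (fun z => rfl : ∀ z, ν z = _) hfin
  -- Both weights `ν x` and `ν y` are positive, so a single transition probability is controlled by
  -- the `k`-th term of the energy of `ν`, whose partial sums are bounded.
  have hle : ∀ k, ν x * ν y * trans k x y ≤ ∑' z, ν z * (avg d ^ k) ν z := by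
    intro k
    have h1 : ν y * trans k x y ≤ (avg d ^ k) ν x := by
      rw [avg_pow_apply k hfin]
      exact Finset.single_le_sum (f := fun y => ν y * trans k x y)
        (fun z _ => mul_nonneg (hν0 z) (trans_nonneg k x z)) (by simpa using hνy.ne')
    calc ν x * ν y * trans k x y ≤ ν x * (avg d ^ k) ν x := by
          rw [mul_assoc]; gcongr
      _ ≤ _ := (summable_mul_of_support_finite hfin _).le_tsum x fun z _ =>
          mul_nonneg (hν0 z) (avg_pow_nonneg k hν0 z)
  have hs : Summable fun k => ν x * ν y * trans k x y :=
    summable_of_sum_range_le (fun k => mul_nonneg (by positivity) (trans_nonneg k x y))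
      fun m => (Finset.sum_le_sum fun k _ => hle k).trans (hbound m)
  exact (summable_mul_left_iff (by positivity)).1 hs

/-! ### Green function and equilibrium measure -/

lemma green_eq_tsum (x y : Lattice d) : green d x y = ∑' k, trans k x y := rfl

/-- The Green function is harmonic off the diagonal. -/
lemma green_eq_avg (hd : 3 ≤ d) (x y : Lattice d) :
    green d x y = (if x = y then 1 else 0) + avg d (fun z => green d z y) x := by
  rw [green_eq_tsum, (summable_trans hd x y).tsum_eq_zero_add, trans_zero]
  congr 1
  simp_rw [trans_succ, avg_apply, green_eq_tsum]
  rw [tsum_mul_left, Summable.tsum_finsetSum fun p _ => summable_trans hd _ _]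

lemma escape_nonneg (K : Finset (Lattice d)) (x : Lattice d) : 0 ≤ escape d K x :=
  measureReal_nonneg

/-- The Markov property at time `n`, obtained by iterating the one at time one. -/
lemma walkLaw_lastExit (K : Finset (Lattice d)) (n : ℕ) (x y : Lattice d) :
    (walkLaw d x).real {X | X n = y ∧ ∀ m, n < m → X m ∉ K} = trans n x y * escape d K y := by
  induction n generalizing x with
  | zero =>
    rw [trans_zero, walkLaw_start x (measurableSet_lastExit K 0 y)]
    split_ifs with h
    · subst h
      have hm : MeasurableSet {X : ℕ → Lattice d | ∀ n : ℕ, 1 ≤ n → X n ∉ K} := by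
        have e : {X : ℕ → Lattice d | ∀ n : ℕ, 1 ≤ n → X n ∉ K} =
            ⋂ (m : ℕ) (_ : 1 ≤ m), (fun X : ℕ → Lattice d => X m) ⁻¹' (K : Set _)ᶜ := by
          ext X; simp
        rw [e]
        exact MeasurableSet.iInter fun m => MeasurableSet.iInter
          fun _ => measurable_pi_apply m (K.measurableSet.compl)
      rw [one_mul, escape, walkLaw_start x hm]
      congr 1
      ext X
      simp only [Set.mem_ofPred_eq, Nat.lt_iff_add_one_le, zero_add]
      tauto
    · rw [zero_mul]
      have e : {X : ℕ → Lattice d | X 0 = x ∧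
          X ∈ {X : ℕ → Lattice d | X 0 = y ∧ ∀ m, 0 < m → X m ∉ K}} = ∅ := by
        ext X
        simp only [Set.mem_ofPred_eq, Set.mem_empty_iff_false, iff_false, not_and]
        rintro rfl h'
        exact absurd h' h
      rw [e]
      simp
  | succ n ih =>
    have e : {X : ℕ → Lattice d | X (n + 1) = y ∧ ∀ m, n + 1 < m → X m ∉ K} =
        {X | (fun k => X (k + 1)) ∈ {X : ℕ → Lattice d | X n = y ∧ ∀ m, n < m → X m ∉ K}} := by
      ext X
      simp only [Set.mem_ofPred_eq]
      refine and_congr_right fun _ => ⟨fun h m hm => h (m + 1) (by omega), fun h m hm => ?_⟩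
      obtain ⟨m, rfl⟩ : ∃ k, m = k + 1 := ⟨m - 1, by omega⟩
      exact h m (by omega)
    rw [e, walkLaw_shift x (measurableSet_lastExit K n y), trans_succ]
    simp_rw [ih]
    simp only [avg_apply, ← Finset.sum_mul, mul_assoc]

lemma ae_eventually_notMem_of_transient (hd : 3 ≤ d) (K : Finset (Lattice d)) (x : Lattice d) :
    ∀ᵐ X ∂(walkLaw d x), ∀ᶠ n in Filter.atTop, X n ∉ K := by
  refine ae_eventually_notMem (s := fun n => {X : ℕ → Lattice d | X n ∈ K}) ?_
  have hle : ∀ n, walkLaw d x {X | X n ∈ K} ≤ ENNReal.ofReal (∑ y ∈ K, trans n x y) := by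
    intro n
    have e : {X : ℕ → Lattice d | X n ∈ K} = ⋃ y ∈ K, {X : ℕ → Lattice d | X n = y} := by
      ext X; simp
    rw [e, ENNReal.ofReal_sum_of_nonneg fun y _ => trans_nonneg n x y]
    refine (measure_biUnion_finset_le _ _).trans_eq (Finset.sum_congr rfl fun y _ => ?_)
    rw [trans, ofReal_measureReal]
  refine ne_top_of_le_ne_top ?_ (ENNReal.tsum_le_tsum hle)
  exact (summable_sum fun y _ => summable_trans hd x y).tsum_ofReal_ne_top

/-- The equilibrium potential equals one on the set. -/
theorem sum_green_mul_escape (hd : 3 ≤ d) {K : Finset (Lattice d)} {x : Lattice d} (hx : x ∈ K) :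
    ∑ y ∈ K, green d x y * escape d K y = 1 := by
  -- `s (y, n)` is the event that the last visit to `K` takes place at time `n`, in `y`. These
  -- events are disjoint; by transience and `x ∈ K` they cover almost everything. Summing their
  -- probabilities over `n` produces the Green function.
  set s : K × ℕ → Set (ℕ → Lattice d) :=
    fun p => {X | X p.2 = p.1 ∧ ∀ m, p.2 < m → X m ∉ K} with hs
  have hdisj : Pairwise (Function.onFun Disjoint s) := by
    rintro ⟨y, n⟩ ⟨z, m⟩ hne
    refine Set.disjoint_left.2 fun X h1 h2 => hne ?_
    have hnm : n = m := by
      rcases lt_trichotomy n m with h | h | h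
      · exact absurd (h2.1 ▸ z.2) (h1.2 m h)
      · exact h
      · exact absurd (h1.1 ▸ y.2) (h2.2 n h)
    subst hnm
    have : y = z := Subtype.ext (h1.1.symm.trans h2.1)
    rw [this]
  have hunion : walkLaw d x (⋃ p, s p) = 1 := by
    rw [← prob_compl_eq_zero_iff (MeasurableSet.iUnion fun p => measurableSet_lastExit K _ _)]
    have hstart : walkLaw d x {X | X 0 ≠ x} = 0 := by
      have h := trans_zero (d := d) x x
      rw [if_pos rfl, trans, measureReal_def, ENNReal.toReal_eq_one_iff,
        ← prob_compl_eq_zero_iff (measurableSet_eval_eq 0 x)] at h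
      exact h
    have h0 : ∀ᵐ X ∂(walkLaw d x), X 0 = x := hstart
    have hall : ∀ᵐ X ∂(walkLaw d x), X ∈ ⋃ p, s p := by
      filter_upwards [h0, ae_eventually_notMem_of_transient hd K x] with X hX0 hev
      classical
      obtain ⟨N, hN⟩ := Filter.eventually_atTop.1 hev
      have hX0K : X 0 ∈ K := hX0 ▸ hx
      set n := Nat.findGreatest (fun n => X n ∈ K) N
      have hn : X n ∈ K := Nat.findGreatest_spec (P := fun n => X n ∈ K) (Nat.zero_le N) hX0K
      refine Set.mem_iUnion.2 ⟨(⟨X n, hn⟩, n), rfl, fun m hm => ?_⟩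
      rcases le_total N m with h | h
      · exact hN m h
      · exact Nat.findGreatest_is_greatest hm h
    exact hall
  rw [measure_iUnion hdisj fun p => measurableSet_lastExit K _ _] at hunion
  have hsp : ∀ p : K × ℕ, walkLaw d x (s p) =
      ENNReal.ofReal (trans p.2 x p.1 * escape d K p.1) := by
    intro p
    rw [← walkLaw_lastExit, ofReal_measureReal]
  simp_rw [hsp] at hunion
  rw [ENNReal.tsum_prod (f := fun (y : K) n => ENNReal.ofReal (trans n x y * escape d K y)),
    tsum_fintype] at hunion
  have hk : ∀ y : K, ∑' n, ENNReal.ofReal (trans n x y * escape d K y) =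
      ENNReal.ofReal (green d x y * escape d K y) := by
    intro y
    rw [green_eq_tsum, ← tsum_mul_right, ENNReal.ofReal_tsum_of_nonneg
      (fun n => mul_nonneg (trans_nonneg n x y) (escape_nonneg K y))
      ((summable_trans hd x y).mul_right _)]
  simp_rw [hk] at hunion
  have hgn : ∀ y, 0 ≤ green d x y * escape d K y := fun y =>
    mul_nonneg (tsum_nonneg fun k => trans_nonneg k x y) (escape_nonneg K y)
  rw [Finset.sum_coe_sort K fun y => ENNReal.ofReal (green d x y * escape d K y),
    ← ENNReal.ofReal_sum_of_nonneg fun y _ => hgn y, ENNReal.ofReal_eq_one] at hunion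
  exact hunion

end Transience

/-! ### The Dirichlet problem on finite sets -/

section Dirichlet

variable {d : ℕ} [NeZero d]

/-- The maximum principle on a finite set. -/
lemma le_of_harmonic {U : Finset (Lattice d)} {h : Lattice d → ℝ} {c : ℝ}
    (hU : ∀ x ∈ U, h x = avg d h x)
    (hb : ∀ x ∈ U, ∀ p : Fin d × Bool, x + stepVec p ∈ U ∨ h (x + stepVec p) ≤ c) :
    ∀ x ∈ U, h x ≤ c := by
  classical
  by_contra! hcon
  obtain ⟨x₀, hx₀U, hx₀⟩ := hcon
  obtain ⟨x₁, hx₁U, hx₁⟩ := U.exists_max_image h ⟨x₀, hx₀U⟩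
  -- Among the maximizers choose one furthest in direction `i₀`. Averaging forces its neighbors to
  -- share the maximum, and the next point in direction `i₀` contradicts either this choice or the
  -- boundary bound.
  set V := U.filter fun x => h x = h x₁ with hV
  have i₀ : Fin d := ⟨0, Nat.pos_of_ne_zero (NeZero.ne d)⟩
  obtain ⟨x, hxV, hx⟩ := V.exists_max_image (fun x => x i₀)
    ⟨x₁, Finset.mem_filter.2 ⟨hx₁U, rfl⟩⟩
  obtain ⟨hxU, hxm⟩ := Finset.mem_filter.1 hxV
  have hle : ∀ p : Fin d × Bool, h (x + stepVec p) ≤ h x := by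
    intro p
    rcases hb x hxU p with hp | hp
    · rw [hxm]; exact hx₁ _ hp
    · rw [hxm]; exact hp.trans (hx₀.le.trans (hx₁ _ hx₀U))
  have hsum : ∑ p : Fin d × Bool, (h x - h (x + stepVec p)) = 0 := by
    have h1 := hU x hxU
    rw [avg_apply] at h1
    have hd : (d : ℝ) ≠ 0 := by exact_mod_cast NeZero.ne d
    rw [Finset.sum_sub_distrib, Finset.sum_const, Finset.card_univ, Fintype.card_prod,
      Fintype.card_fin, Fintype.card_bool, nsmul_eq_mul]
    field_simp at h1
    push_cast
    linarith
  have hzero := (Finset.sum_eq_zero_iff_of_nonneg fun p _ => sub_nonneg.2 (hle p)).1 hsum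
    (i₀, true) (Finset.mem_univ _)
  have heq : h (x + stepVec (i₀, true)) = h x₁ := by linarith
  rcases hb x hxU (i₀, true) with hp | hp
  · have := hx _ (Finset.mem_filter.2 ⟨hp, heq⟩)
    simp [stepVec] at this
  · have := hx₁ _ hx₀U
    linarith

/-- Uniqueness in the Dirichlet problem. -/
lemma eq_of_harmonic {U : Finset (Lattice d)} {h k : Lattice d → ℝ}
    (hU : ∀ x ∈ U, h x = avg d h x) (kU : ∀ x ∈ U, k x = avg d k x)
    (hb : ∀ x ∈ U, ∀ p : Fin d × Bool,
      x + stepVec p ∈ U ∨ h (x + stepVec p) = k (x + stepVec p)) :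
    ∀ x ∈ U, h x = k x := by
  intro x hx
  have h1 : ∀ f g : Lattice d → ℝ, (∀ x ∈ U, f x = avg d f x) → (∀ x ∈ U, g x = avg d g x) →
      (∀ x ∈ U, ∀ p : Fin d × Bool, x + stepVec p ∈ U ∨ f (x + stepVec p) = g (x + stepVec p)) →
      f x ≤ g x := by
    intro f g hf hg hfg
    have h2 := le_of_harmonic (h := f - g) (c := 0) (fun y hy => by
      rw [map_sub, Pi.sub_apply, Pi.sub_apply, ← hf y hy, ← hg y hy])
      (fun y hy p => (hfg y hy p).imp_right fun h => by rw [Pi.sub_apply, h, sub_self]) x hx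
    exact sub_nonpos.1 h2
  exact le_antisymm (h1 h k hU kU hb) (h1 k h kU hU fun y hy p => (hb y hy p).imp_right Eq.symm)

/-- Existence in the Dirichlet problem. -/
lemma exists_harmonic (U : Finset (Lattice d)) (b : Lattice d → ℝ) :
    ∃ h : Lattice d → ℝ, (∀ x ∉ U, h x = b x) ∧ ∀ x ∈ U, h x = avg d h x := by
  classical
  let ext : (U → ℝ) →ₗ[ℝ] (Lattice d → ℝ) :=
    { toFun := fun v x => if hx : x ∈ U then v ⟨x, hx⟩ else 0
      map_add' := fun v w => by ext x; by_cases hx : x ∈ U <;> simp [hx]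
      map_smul' := fun c v => by ext x; by_cases hx : x ∈ U <;> simp [hx] }
  have hext : ∀ v (x : U), ext v x = v x := fun v x => by simp [ext]
  have hext0 : ∀ v, ∀ x ∉ U, ext v x = 0 := fun v x hx => by simp [ext, hx]
  -- The operator `1 - avg` on `U` with zero values outside. Uniqueness makes it injective, hence
  -- surjective in finite dimension; the boundary data enter as a source term.
  let A : (U → ℝ) →ₗ[ℝ] (U → ℝ) :=
    { toFun := fun v x => v x - avg d (ext v) x
      map_add' := fun v w => by ext x; simp; ring
      map_smul' := fun c v => by ext x; simp; ring }
  have hA : Function.Injective A := by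
    rw [injective_iff_map_eq_zero]
    intro v hv
    have h1 : ∀ x ∈ U, ext v x = 0 := by
      refine eq_of_harmonic (k := 0) (fun x hx => ?_) (fun x _ => by simp) fun x _ p => ?_
      · have h2 := congrFun hv ⟨x, hx⟩
        rw [hext v ⟨x, hx⟩]
        exact sub_eq_zero.1 h2
      · by_cases h : x + stepVec p ∈ U
        · exact Or.inl h
        · exact Or.inr (hext0 v _ h)
    ext x
    rw [← hext v x, h1 x x.2]
    rfl
  let b₀ : Lattice d → ℝ := fun x => if x ∈ U then 0 else b x
  obtain ⟨v, hv⟩ := LinearMap.injective_iff_surjective.1 hA fun x => avg d b₀ x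
  refine ⟨ext v + b₀, fun x hx => ?_, fun x hx => ?_⟩
  · rw [Pi.add_apply, hext0 v x hx, zero_add]
    exact if_neg hx
  · have h1 : v ⟨x, hx⟩ - avg d (ext v) x = avg d b₀ x := congrFun hv ⟨x, hx⟩
    rw [map_add, Pi.add_apply, Pi.add_apply, hext v ⟨x, hx⟩, ← h1]
    simp [b₀, hx]

/-- The harmonic kernel of `U`: the harmonic function on `U` equal to `δ_y` off `U`. -/
noncomputable def harmonicKernel (U : Finset (Lattice d)) (y : Lattice d) : Lattice d → ℝ :=
  (exists_harmonic U (Pi.single y 1)).choose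

lemma harmonicKernel_of_notMem {U : Finset (Lattice d)} {x : Lattice d} (y : Lattice d)
    (hx : x ∉ U) : harmonicKernel U y x = (Pi.single y 1 : Lattice d → ℝ) x :=
  (exists_harmonic U (Pi.single y 1)).choose_spec.1 x hx

lemma harmonicKernel_eq_avg {U : Finset (Lattice d)} {x : Lattice d} (y : Lattice d)
    (hx : x ∈ U) : harmonicKernel U y x = avg d (harmonicKernel U y) x :=
  (exists_harmonic U (Pi.single y 1)).choose_spec.2 x hx

/-- The harmonic function on `U` whose values on the finite set `F` are those of `f`. -/
noncomputable def harmonicExt (U F : Finset (Lattice d)) (f : Lattice d → ℝ) (x : Lattice d) : ℝ :=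
  ∑ y ∈ F, f y * harmonicKernel U y x

lemma harmonicExt_eq_avg {U F : Finset (Lattice d)} (f : Lattice d → ℝ) {x : Lattice d}
    (hx : x ∈ U) : harmonicExt U F f x = avg d (harmonicExt U F f) x := by
  have e : harmonicExt U F f = ∑ y ∈ F, f y • harmonicKernel U y := by
    ext x; simp [harmonicExt]
  rw [e, map_sum, Finset.sum_apply, Finset.sum_apply]
  refine Finset.sum_congr rfl fun y _ => ?_
  rw [map_smul, Pi.smul_apply, Pi.smul_apply, ← harmonicKernel_eq_avg y hx]

lemma harmonicExt_of_mem {U F : Finset (Lattice d)} (hUF : Disjoint U F) (f : Lattice d → ℝ)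
    {x : Lattice d} (hx : x ∈ F) : harmonicExt U F f x = f x := by
  classical
  unfold harmonicExt
  simp_rw [harmonicKernel_of_notMem _ (Finset.disjoint_right.1 hUF hx), Pi.single_apply]
  simp [hx]

/-- With its pole outside `U`, the Green function is harmonic on `U`. This is what makes the
fluctuation of the field in `U` uncorrelated with the field on `F`. -/
lemma green_eq_harmonicExt (hd : 3 ≤ d) {U F : Finset (Lattice d)} (hUF : Disjoint U F)
    (hbd : ∀ x ∈ U, ∀ p : Fin d × Bool, x + stepVec p ∈ U ∨ x + stepVec p ∈ F)
    {x z : Lattice d} (hx : x ∈ U) (hz : z ∈ F) :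
    harmonicExt U F (fun y => green d y z) x = green d x z := by
  refine eq_of_harmonic (U := U) (k := fun y => green d y z)
    (fun y hy => harmonicExt_eq_avg _ hy) (fun y hy => ?_)
    (fun y hy p => (hbd y hy p).imp_right fun h => harmonicExt_of_mem hUF _ h) x hx
  have hyz : y ≠ z := fun h => Finset.disjoint_right.1 hUF hz (h ▸ hy)
  have h := green_eq_avg hd y z
  rwa [if_neg hyz, zero_add] at h

/-- The maximum principle sees only the points of `F` next to `U`. In the application `F` also
contains the explored clusters, where the field is large, but these do not touch `U`. -/
lemma harmonicExt_le {U F : Finset (Lattice d)} (hUF : Disjoint U F) {f : Lattice d → ℝ} {c : ℝ}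
    (hbd : ∀ x ∈ U, ∀ p : Fin d × Bool,
      x + stepVec p ∈ U ∨ (x + stepVec p ∈ F ∧ f (x + stepVec p) ≤ c))
    {x : Lattice d} (hx : x ∈ U) : harmonicExt U F f x ≤ c :=
  le_of_harmonic (fun _ hy => harmonicExt_eq_avg _ hy)
    (fun y hy p => (hbd y hy p).imp_right fun h => by
      rw [harmonicExt_of_mem hUF _ h.1]; exact h.2) x hx

end Dirichlet

/-! ### Linear functionals of the free field -/

section Field

variable {d : ℕ} [NeZero d] {P : Measure (Lattice d → ℝ)}

namespace IsGFF

lemma isProbabilityMeasure (hP : IsGFF d P) : IsProbabilityMeasure P :=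
  hP.gaussian.isProbabilityMeasure

lemma memLp_eval (hP : IsGFF d P) (x : Lattice d) : MemLp (fun φ : Lattice d → ℝ => φ x) 2 P :=
  (hP.gaussian.hasGaussianLaw_eval x).memLp_two

lemma integrable_eval_mul (hP : IsGFF d P) (x y : Lattice d) :
    Integrable (fun φ : Lattice d → ℝ => φ x * φ y) P :=
  (hP.memLp_eval x).integrable_mul (hP.memLp_eval y)

lemma integrable_eval (hP : IsGFF d P) (x : Lattice d) :
    Integrable (fun φ : Lattice d → ℝ => φ x) P :=
  (hP.gaussian.hasGaussianLaw_eval x).integrable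

/-- Finite linear combinations of the field form a Gaussian process. -/
lemma gaussian_linearCombination (hP : IsGFF d P) {S : Type*} (c : S → Lattice d →₀ ℝ) :
    IsGaussianProcess (fun s (φ : Lattice d → ℝ) => Finsupp.linearCombination ℝ φ (c s)) P := by
  refine hP.gaussian.of_isGaussianProcess fun s => ⟨(c s).support,
    ∑ x : (c s).support, c s x • ContinuousLinearMap.proj (R := ℝ) (φ := fun _ => ℝ) x,
    fun φ => ?_⟩
  rw [Finsupp.linearCombination_apply, Finsupp.sum, ← Finset.sum_coe_sort]
  simp

/-- The law of a weighted sum of the field. -/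
lemma map_sum_mul (hP : IsGFF d P) (K : Finset (Lattice d)) (a : Lattice d → ℝ) :
    Integrable (fun φ : Lattice d → ℝ => (∑ x ∈ K, a x * φ x) * ∑ x ∈ K, a x * φ x) P ∧
    P.map (fun φ => ∑ x ∈ K, a x * φ x) =
      gaussianReal 0 (∫ φ, (∑ x ∈ K, a x * φ x) * ∑ x ∈ K, a x * φ x ∂P).toNNReal := by
  have hg : HasGaussianLaw (fun φ : Lattice d → ℝ => ∑ x ∈ K, a x * φ x) P := by
    have h := (hP.gaussian_linearCombination (S := Unit)
      fun _ => ∑ x ∈ K, a x • Finsupp.single x 1).hasGaussianLaw_eval ()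
    simpa [map_sum, Finsupp.linearCombination_single] using h
  have hmean : ∫ φ, ∑ x ∈ K, a x * φ x ∂P = 0 := by
    rw [integral_finsetSum _ fun x _ => (hP.integrable_eval x).const_mul _]
    simp [integral_const_mul, hP.centered]
  refine ⟨hg.memLp_two.integrable_mul hg.memLp_two, ?_⟩
  rw [hg.map_eq_gaussianReal, hmean, variance_of_integral_eq_zero hg.aemeasurable hmean]
  simp_rw [← sq]

lemma integral_sum_mul_sum (hP : IsGFF d P) (K L : Finset (Lattice d)) (a b : Lattice d → ℝ) :
    Integrable (fun φ : Lattice d → ℝ => (∑ x ∈ K, a x * φ x) * ∑ y ∈ L, b y * φ y) P ∧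
    ∫ φ, (∑ x ∈ K, a x * φ x) * ∑ y ∈ L, b y * φ y ∂P =
      ∑ x ∈ K, a x * ∑ y ∈ L, green d x y * b y := by
  have e : (fun φ : Lattice d → ℝ => (∑ x ∈ K, a x * φ x) * ∑ y ∈ L, b y * φ y) =
      fun φ => ∑ x ∈ K, ∑ y ∈ L, a x * b y * (φ x * φ y) := by
    ext φ
    rw [Finset.sum_mul_sum]
    exact Finset.sum_congr rfl fun x _ => Finset.sum_congr rfl fun y _ => by ring
  have hi : ∀ x y, Integrable (fun φ : Lattice d → ℝ => a x * b y * (φ x * φ y)) P := fun x y =>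
    (hP.integrable_eval_mul x y).const_mul _
  rw [e]
  refine ⟨integrable_finsetSum _ fun x _ => integrable_finsetSum _ fun y _ => hi x y, ?_⟩
  rw [integral_finsetSum _ fun x _ => integrable_finsetSum _ fun y _ => hi x y]
  refine Finset.sum_congr rfl fun x _ => ?_
  rw [integral_finsetSum _ fun y _ => hi x y, Finset.mul_sum]
  refine Finset.sum_congr rfl fun y _ => ?_
  rw [integral_const_mul, hP.covariance]
  ring

/-- The charge carried by a set is controlled by its energy and the capacity. -/
lemma sq_sum_le_energy_mul_capacity (hP : IsGFF d P) (hd : 3 ≤ d) (K : Finset (Lattice d))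
    (a : Lattice d → ℝ) :
    (∑ x ∈ K, a x) ^ 2 ≤ (∑ x ∈ K, a x * ∑ y ∈ K, green d x y * a y) * capacity d K := by
  obtain ⟨i1, e1⟩ := hP.integral_sum_mul_sum K K a a
  obtain ⟨i2, e2⟩ := hP.integral_sum_mul_sum K K a (escape d K)
  obtain ⟨i3, e3⟩ := hP.integral_sum_mul_sum K K (escape d K) (escape d K)
  -- Cauchy-Schwarz for the Green form, realized as the covariance of the field. Since the
  -- equilibrium potential is one on `K`, the mixed term is the charge of `a` and the energy of the
  -- equilibrium measure is the capacity.
  have h := sq_integral_mul_le i1 i2 i3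
  rw [e1, e2, e3] at h
  have h1 : ∀ b : Lattice d → ℝ, ∑ x ∈ K, b x * ∑ y ∈ K, green d x y * escape d K y =
      ∑ x ∈ K, b x := fun b =>
    Finset.sum_congr rfl fun x hx => by rw [sum_green_mul_escape hd hx, mul_one]
  rwa [h1, h1] at h

lemma map_sum_escape_mul (hP : IsGFF d P) (hd : 3 ≤ d) (K : Finset (Lattice d)) :
    P.map (fun φ => ∑ x ∈ K, escape d K x * φ x) = gaussianReal 0 (capacity d K).toNNReal := by
  rw [(hP.map_sum_mul K (escape d K)).2, (hP.integral_sum_mul_sum K K _ _).2]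
  congr 2
  exact Finset.sum_congr rfl fun x hx => by rw [sum_green_mul_escape hd hx, mul_one]

lemma capacity_nonneg (K : Finset (Lattice d)) : 0 ≤ capacity d K :=
  Finset.sum_nonneg fun x _ => escape_nonneg K x

/-- Gaussian tail bound for the average of the field against the equilibrium measure. -/
lemma measure_sum_escape_mul_le (hP : IsGFF d P) (hd : 3 ≤ d) (K : Finset (Lattice d)) {α : ℝ}
    (hα : α ≤ 0) :
    P.real {φ | ∑ x ∈ K, escape d K x * φ x ≤ α * capacity d K} ≤
      Real.exp (-(1 / 2) * α ^ 2 * capacity d K) := by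
  have := hP.isProbabilityMeasure
  have hmap := hP.map_sum_escape_mul hd K
  have hint : Integrable (fun φ : Lattice d → ℝ =>
      Real.exp (α * ∑ x ∈ K, escape d K x * φ x)) P := by
    have h := integrable_exp_mul_gaussianReal (μ := 0) (v := (capacity d K).toNNReal) α
    rw [← hmap] at h
    exact h.comp_measurable (by fun_prop)
  -- Chernoff's bound at the optimal parameter `α`: the exponent is `-α² cap + α² cap / 2`.
  have h := measure_le_le_exp_mul_mgf (μ := P) (X := fun φ => ∑ x ∈ K, escape d K x * φ x)
    (α * capacity d K) hα hint
  rw [mgf_gaussianReal hmap, ← Real.exp_add] at h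
  refine h.trans_eq ?_
  rw [Real.coe_toNNReal _ (capacity_nonneg K)]
  congr 1
  ring

/-- Conditioning on the field on `F`, the field on `U` fluctuates symmetrically around the
harmonic extension of its boundary values. -/
lemma measure_inter_le (hP : IsGFF d P) (hd : 3 ≤ d) {U F K : Finset (Lattice d)} (hKU : K ⊆ U)
    (hUF : Disjoint U F)
    (hbd : ∀ x ∈ U, ∀ p : Fin d × Bool, x + stepVec p ∈ U ∨ x + stepVec p ∈ F)
    (a : Lattice d → ℝ) {c : ℝ} {A : Set (F → ℝ)} (hA : MeasurableSet A)
    (hAc : ∀ φ : Lattice d → ℝ, F.restrict φ ∈ A → ∑ x ∈ K, a x * harmonicExt U F φ x ≤ c) :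
    P.real {φ | F.restrict φ ∈ A} ≤
      2 * P.real {φ | F.restrict φ ∈ A ∧ ∑ x ∈ K, a x * φ x ≤ c} := by
  have := hP.isProbabilityMeasure
  set ψ : (Lattice d → ℝ) → ℝ := fun φ => ∑ x ∈ K, a x * (φ x - harmonicExt U F φ x) with hψ
  have hmeasExt : ∀ x, Measurable fun φ : Lattice d → ℝ => harmonicExt U F φ x := by
    intro x; unfold harmonicExt; fun_prop
  have hψm : Measurable ψ := by
    refine Finset.measurable_fun_sum _ fun x _ => Measurable.const_mul ?_ _
    exact (measurable_pi_apply x).sub (hmeasExt x)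
  set cψ : Lattice d →₀ ℝ := ∑ x ∈ K, a x • (Finsupp.single x 1 -
    ∑ y ∈ F, harmonicKernel U y x • Finsupp.single y 1) with hcψ
  have hψc : ∀ φ : Lattice d → ℝ, Finsupp.linearCombination ℝ φ cψ = ψ φ := by
    intro φ
    rw [hcψ, hψ]
    simp [map_sum, Finsupp.linearCombination_single, harmonicExt, mul_comm]
  have hgauss : IsGaussianProcess (Sum.elim (fun _ : Unit => ψ)
      (fun (z : F) (φ : Lattice d → ℝ) => φ z)) P := by
    have h := hP.gaussian_linearCombination
      (Sum.elim (fun _ : Unit => cψ) fun z : F => Finsupp.single (z : Lattice d) 1)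
    convert! h using 1
    ext s φ
    rcases s with s | z
    · simp [hψc]
    · simp [Finsupp.linearCombination_single]
  have hψL : HasGaussianLaw ψ P := hgauss.hasGaussianLaw_eval (Sum.inl ())
  have hintExt : ∀ x, Integrable (fun φ : Lattice d → ℝ => harmonicExt U F φ x) P := fun x =>
    integrable_finsetSum _ fun y _ => (hP.integrable_eval y).mul_const _
  have hmean : ∫ φ, ψ φ ∂P = 0 := by
    have hi : ∀ x, Integrable (fun φ : Lattice d → ℝ => a x * (φ x - harmonicExt U F φ x)) P :=
      fun x => ((hP.integrable_eval x).sub (hintExt x)).const_mul _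
    simp only [hψ]
    rw [integral_finsetSum _ fun x _ => hi x]
    refine Finset.sum_eq_zero fun x _ => ?_
    rw [integral_const_mul, integral_sub (hP.integrable_eval x) (hintExt x), hP.centered]
    unfold harmonicExt
    rw [integral_finsetSum _ fun y _ => (hP.integrable_eval y).mul_const _]
    simp [integral_mul_const, hP.centered]
  -- Joint Gaussianity turns this vanishing covariance into independence of `ψ` from the whole field
  -- on `F`.
  have hcov : ∀ z : F, cov[ψ, fun φ : Lattice d → ℝ => φ z; P] = 0 := by
    intro z
    rw [covariance_eq_sub hψL.memLp_two (hP.memLp_eval z), hmean, zero_mul, sub_zero]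
    have e : (ψ * fun φ : Lattice d → ℝ => φ z) = fun φ => ∑ x ∈ K, a x * (φ x * φ z -
        ∑ y ∈ F, harmonicKernel U y x * (φ y * φ z)) := by
      ext φ
      simp only [hψ, Pi.mul_apply, Finset.sum_mul, harmonicExt, mul_assoc, sub_mul]
      refine Finset.sum_congr rfl fun x _ => ?_
      congr 2
      exact Finset.sum_congr rfl fun y _ => by ring
    have hi : ∀ x, Integrable (fun φ : Lattice d → ℝ =>
        ∑ y ∈ F, harmonicKernel U y x * (φ y * φ z)) P := fun x =>
      integrable_finsetSum _ fun y _ => (hP.integrable_eval_mul y z).const_mul _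
    have hi2 : ∀ x, Integrable (fun φ : Lattice d → ℝ => a x * (φ x * φ z -
        ∑ y ∈ F, harmonicKernel U y x * (φ y * φ z))) P := fun x =>
      ((hP.integrable_eval_mul x z).sub (hi x)).const_mul _
    simp only [e]
    rw [integral_finsetSum _ fun x _ => hi2 x]
    refine Finset.sum_eq_zero fun x hx => ?_
    rw [integral_const_mul, integral_sub (hP.integrable_eval_mul x z) (hi x), hP.covariance,
      integral_finsetSum _ fun y _ => (hP.integrable_eval_mul y z).const_mul _]
    simp_rw [integral_const_mul, hP.covariance]
    rw [← green_eq_harmonicExt hd hUF hbd (hKU hx) z.2, harmonicExt]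
    simp_rw [mul_comm (harmonicKernel U _ x)]
    rw [sub_self, mul_zero]
  have hindep : IndepFun (fun φ (_ : Unit) => ψ φ) (fun (φ : Lattice d → ℝ) (z : F) => φ z) P :=
    hgauss.indepFun_of_covariance_eq_zero (fun _ => hψm.aemeasurable)
      (fun z => (measurable_pi_apply (z : Lattice d)).aemeasurable) fun _ z => hcov z
  -- A centered Gaussian law is symmetric, so `ψ ≤ 0` has probability at least `1/2`, also in the
  -- degenerate case.
  have hhalf : 1 ≤ 2 * P.real {φ | ψ φ ≤ 0} := by
    have hmap := hψL.map_eq_gaussianReal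
    rw [hmean] at hmap
    set v := Var[ψ; P].toNNReal
    have h1 : P.real {φ | ψ φ ≤ 0} = (gaussianReal 0 v).real (Set.Iic 0) := by
      rw [← hmap, map_measureReal_apply hψm measurableSet_Iic]; rfl
    have h2 : P.real {φ | 0 ≤ ψ φ} = (gaussianReal 0 v).real (Set.Iic 0) := by
      have h3 : (gaussianReal 0 v).map (fun x => -x) = gaussianReal 0 v := by
        rw [gaussianReal_map_neg, neg_zero]
      rw [← h3, map_measureReal_apply measurable_neg measurableSet_Iic, ← hmap,
        map_measureReal_apply hψm (measurable_neg measurableSet_Iic)]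
      congr 1
      ext φ; simp
    have h3 : (1 : ℝ) ≤ P.real {φ | ψ φ ≤ 0} + P.real {φ | 0 ≤ ψ φ} := by
      refine le_trans ?_ (measureReal_union_le _ _)
      rw [show {φ | ψ φ ≤ 0} ∪ {φ | 0 ≤ ψ φ} = Set.univ by ext φ; simp [le_total], probReal_univ]
    linarith
  have hprod : P.real ({φ | ψ φ ≤ 0} ∩ {φ | F.restrict φ ∈ A}) =
      P.real {φ | ψ φ ≤ 0} * P.real {φ | F.restrict φ ∈ A} := by
    have h := hindep.measure_inter_preimage_eq_mul {u : Unit → ℝ | u () ≤ 0} A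
      (measurableSet_le (measurable_pi_apply ()) measurable_const) hA
    rw [measureReal_def, measureReal_def, measureReal_def, ← ENNReal.toReal_mul]
    exact congrArg ENNReal.toReal h
  calc P.real {φ | F.restrict φ ∈ A}
      ≤ (2 * P.real {φ | ψ φ ≤ 0}) * P.real {φ | F.restrict φ ∈ A} :=
        le_mul_of_one_le_left measureReal_nonneg hhalf
    _ = 2 * P.real ({φ | ψ φ ≤ 0} ∩ {φ | F.restrict φ ∈ A}) := by rw [hprod, mul_assoc]
    _ ≤ _ := by
        refine mul_le_mul_of_nonneg_left (measureReal_mono fun φ hφ => ⟨hφ.2, ?_⟩) zero_le_two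
        have h1 : ψ φ = ∑ x ∈ K, a x * φ x - ∑ x ∈ K, a x * harmonicExt U F φ x := by
          rw [hψ, ← Finset.sum_sub_distrib]
          exact Finset.sum_congr rfl fun x _ => mul_sub _ _ _
        have h2 : ψ φ ≤ 0 := hφ.1
        linarith [hAc φ hφ.2]

end IsGFF

end Field

/-! ### Exploration of the clusters of the outer sphere -/

section Exploration

variable {d : ℕ}

lemma adj_iff_exists_stepVec {x y : Lattice d} : Adj x y ↔ ∃ p, y = x + stepVec p := by
  classical
  constructor
  · intro h
    unfold Adj at h
    obtain ⟨i, hi⟩ : ∃ i, x i - y i ≠ 0 := by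
      by_contra! hcon
      simp [hcon] at h
    have h1 := Finset.add_sum_erase Finset.univ (fun j => (x j - y j) ^ 2) (Finset.mem_univ i)
    rw [h] at h1
    have h2 : 0 ≤ ∑ j ∈ Finset.univ.erase i, (x j - y j) ^ 2 :=
      Finset.sum_nonneg fun j _ => sq_nonneg _
    have h3 : 0 < (x i - y i) ^ 2 := by positivity
    have h4 : (x i - y i) ^ 2 = 1 := by omega
    have h5 : ∑ j ∈ Finset.univ.erase i, (x j - y j) ^ 2 = 0 := by omega
    have h6 : ∀ j, j ≠ i → y j = x j := by
      intro j hj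
      have := (Finset.sum_eq_zero_iff_of_nonneg fun j _ => sq_nonneg _).1 h5 j
        (Finset.mem_erase.2 ⟨hj, Finset.mem_univ j⟩)
      have := pow_eq_zero_iff two_ne_zero |>.1 this
      omega
    rcases mul_self_eq_one_iff.1 (sq (x i - y i) ▸ h4) with h7 | h7
    · refine ⟨(i, false), funext fun j => ?_⟩
      by_cases hj : j = i
      · subst hj; simp [stepVec]; omega
      · simp [stepVec, hj, h6 j hj]
    · refine ⟨(i, true), funext fun j => ?_⟩
      by_cases hj : j = i
      · subst hj; simp [stepVec]; omega
      · simp [stepVec, hj, h6 j hj]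
  · rintro ⟨⟨i, b⟩, rfl⟩
    unfold Adj
    rw [Finset.sum_eq_single i]
    · cases b <;> simp [stepVec]
    · intro j _ hj
      simp [stepVec, hj]
    · simp

lemma adj_comm {x y : Lattice d} : Adj x y ↔ Adj y x := by
  unfold Adj
  simp_rw [sub_sq_comm]

lemma norm_eval_le (x : Lattice d) (i : Fin d) : |(x i : ℝ)| ≤ ‖x‖ :=
  (Int.norm_eq_abs (x i)).symm.trans_le (norm_le_pi_norm x i)

lemma mem_box_of_norm_le {n : ℕ} {x : Lattice d} (h : ‖x‖ ≤ n) : x ∈ box d n := by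
  rw [mem_box_iff]
  intro i
  have := (norm_eval_le x i).trans h
  exact_mod_cast this

lemma norm_le_of_mem_box {n : ℕ} {x : Lattice d} (h : x ∈ box d n) : ‖x‖ ≤ n := by
  rw [pi_norm_le_iff_of_nonneg (Nat.cast_nonneg n)]
  intro i
  rw [Int.norm_eq_abs]
  exact_mod_cast mem_box_iff.1 h i

lemma add_stepVec_mem_box {n : ℕ} {x : Lattice d} (hx : x ∈ box d n) (hs : x ∉ sphere d n)
    (p : Fin d × Bool) : x + stepVec p ∈ box d n := by
  have hlt : ‖x‖ < n := lt_of_le_of_ne (norm_le_of_mem_box hx) hs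
  rw [mem_box_iff]
  intro i
  have h1 := (norm_eval_le x i).trans_lt hlt
  have h2 : |x i| < n := by exact_mod_cast h1
  have h3 : |stepVec p i| ≤ 1 := by
    unfold stepVec
    by_cases hi : i = p.1
    · subst hi; split_ifs <;> simp
    · simp [hi]
  have h4 := abs_add_le (x i) (stepVec p i)
  rw [Pi.add_apply]
  omega

open Classical in
/-- The points revealed when exploring, inside the box of radius `R`, a union `C` of clusters of the
outer sphere. -/
noncomputable def explored (R : ℕ) (C : Finset (Lattice d)) : Finset (Lattice d) :=
  C ∪ (box d R).filter fun x => x ∈ sphere d R ∨ ∃ y ∈ C, Adj x y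

/-- `C` is a union of clusters attached to the outer sphere. -/
def IsAttached (R : ℕ) (C : Finset (Lattice d)) : Prop :=
  C ⊆ box d R ∧ ∀ x ∈ C, Connected {x} (C : Set (Lattice d)) (sphere d R)

/-- The event that the exploration of the level set from the outer sphere reveals exactly `C`. -/
def explorationEvent (R : ℕ) (α : ℝ) (C : Finset (Lattice d)) : Set (Lattice d → ℝ) :=
  {φ | (∀ x ∈ C, α ≤ φ x) ∧ ∀ x ∈ explored R C, x ∉ C → φ x < α}

variable {R : ℕ} {α : ℝ} {C C' : Finset (Lattice d)}

lemma subset_explored : C ⊆ explored R C := by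
  classical
  exact Finset.subset_union_left

lemma mem_explored_of_mem_sphere {x : Lattice d} (hx : x ∈ sphere d R) : x ∈ explored R C := by
  classical
  exact Finset.mem_union_right _
    (Finset.mem_filter.2 ⟨mem_box_of_norm_le (le_of_eq hx), Or.inl hx⟩)

lemma mem_explored_of_adj {x y : Lattice d} (hx : x ∈ box d R) (hy : y ∈ C) (hxy : Adj x y) :
    x ∈ explored R C := by
  classical
  exact Finset.mem_union_right _ (Finset.mem_filter.2 ⟨hx, Or.inr ⟨y, hy, hxy⟩⟩)

/-- Used in both directions, this shows that exploration events of distinct sets are disjoint.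
Follow a path in `C` from the sphere back to `x`: each vertex is revealed by `C'`, being on the
sphere or next to a point of `C'`, and a revealed vertex with `φ ≥ α` must belong to `C'`. -/
lemma subset_of_mem_explorationEvent (hC : IsAttached R C) {φ : Lattice d → ℝ}
    (h : φ ∈ explorationEvent R α C) (h' : φ ∈ explorationEvent R α C') : C ⊆ C' := by
  intro x hx
  obtain ⟨n, π, h0, hn, hU, hadj⟩ := hC.2 x hx
  have hback : ∀ k ≤ n, π (n - k) ∈ C' := by
    intro k
    induction k with
    | zero =>
      intro _
      by_contra hcon
      exact absurd (h.1 _ (hU n le_rfl)) (not_le.2 (h'.2 _ (mem_explored_of_mem_sphere hn) hcon))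
    | succ k ih =>
      intro hk
      by_contra hcon
      have hstep := hadj (n - (k + 1)) (by omega)
      rw [show n - (k + 1) + 1 = n - k by omega] at hstep
      have hmem := hU (n - (k + 1)) (by omega)
      exact absurd (h.1 _ hmem)
        (not_le.2 (h'.2 _ (mem_explored_of_adj (hC.1 hmem) (ih (by omega)) hstep) hcon))
  have := hback n le_rfl
  rw [Nat.sub_self, h0] at this
  exact this

/-- On the disconnection event, the exploration from the outer sphere never meets the boundary of
the inner box. -/
lemma exists_explorationEvent {N : ℕ} {φ : Lattice d → ℝ}
    (hφ : ¬ Connected (boundary (box d N : Set (Lattice d))) (excursion α φ) (sphere d R)) :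
    ∃ C : Finset (Lattice d), IsAttached R C ∧
      (∀ x ∈ C, x ∉ boundary (box d N : Set (Lattice d))) ∧ φ ∈ explorationEvent R α C := by
  classical
  set V : Set (Lattice d) := excursion α φ ∩ (box d R : Set (Lattice d)) with hV
  set C := (box d R).filter fun x => Connected {x} V (sphere d R) with hC
  have hmem : ∀ {x}, x ∈ C ↔ Connected {x} V (sphere d R) := by
    intro x
    rw [hC, Finset.mem_filter, and_iff_right_iff_imp]
    rintro ⟨n, π, h0, -, hU, -⟩
    rw [Set.mem_singleton_iff] at h0
    exact h0 ▸ (hU 0 (Nat.zero_le n)).2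
  have hexc : ∀ x ∈ C, α ≤ φ x := by
    intro x hx
    obtain ⟨n, π, h0, -, hU, -⟩ := hmem.1 hx
    rw [Set.mem_singleton_iff] at h0
    exact h0 ▸ (hU 0 (Nat.zero_le n)).1
  refine ⟨C, ⟨Finset.filter_subset _ _, fun x hx => ?_⟩, fun x hx hxb => ?_, hexc,
    fun x hx hxC => ?_⟩
  · obtain ⟨n, π, h0, hn, hU, hadj⟩ := hmem.1 hx
    refine ⟨n, π, h0, hn, fun i hi => ?_, hadj⟩
    -- The remainder of the path, from its `i`-th vertex on, shows that this vertex also belongs to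
    -- `C`.
    exact Finset.mem_coe.2 (hmem.2 ⟨n - i, fun k => π (i + k), rfl, by
      simpa [Nat.add_sub_cancel' hi] using hn, fun k hk => hU _ (by omega),
      fun k hk => hadj _ (by omega)⟩)
  · obtain ⟨n, π, h0, hn, hU, hadj⟩ := hmem.1 hx
    rw [Set.mem_singleton_iff] at h0
    exact hφ ⟨n, π, h0 ▸ hxb, hn, fun i hi => (hU i hi).1, hadj⟩
  · by_contra hge
    rcases Finset.mem_union.1 hx with hx | hx
    · exact hxC hx
    obtain ⟨hxbox, hx | ⟨y, hy, hxy⟩⟩ := Finset.mem_filter.1 hx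
    · exact hxC (hmem.2 ⟨0, fun _ => x, rfl, hx, fun _ _ => ⟨not_lt.1 hge, hxbox⟩,
        fun i hi => absurd hi (Nat.not_lt_zero i)⟩)
    · obtain ⟨n, π, h0, hn, hU, hadj⟩ := hmem.1 hy
      rw [Set.mem_singleton_iff] at h0
      refine hxC (hmem.2 ⟨n + 1, seqCons x π, rfl, hn, fun i hi => ?_, fun i hi => ?_⟩)
      · cases i with
        | zero => exact ⟨not_lt.1 hge, hxbox⟩
        | succ i => exact hU i (by omega)
      · cases i with
        | zero => exact (h0 ▸ hxy : Adj x (π 0))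
        | succ i => exact hadj i (by omega)

/-- A path in `C` from the inner box to the sphere, which lies outside that box, would have to step
on the boundary of the box. -/
lemma notMem_box_of_isAttached {N : ℕ} (hNR : N < R) (hC : IsAttached R C)
    (hCb : ∀ x ∈ C, x ∉ boundary (box d N : Set (Lattice d))) :
    ∀ x ∈ C, x ∉ box d N := by
  intro x hx hxB
  obtain ⟨n, π, h0, hn, hU, hadj⟩ := hC.2 x hx
  rw [Set.mem_singleton_iff] at h0
  have hall : ∀ i ≤ n, π i ∈ box d N := by
    intro i
    induction i with
    | zero => intro _; rwa [h0]
    | succ i ih =>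
      intro hi
      by_contra hcon
      exact hCb _ (hU (i + 1) hi)
        ⟨hcon, π i, ih (by omega), adj_comm.1 (hadj i (by omega))⟩
  have h1 := norm_le_of_mem_box (hall n le_rfl)
  have h2 : ‖π n‖ = (R : ℝ) := hn
  rw [h2] at h1
  exact absurd hNR (not_lt.2 (by exact_mod_cast h1))

/-- A revealed point of the inner box would be in `C`, on the sphere of radius `R > N`, or next to a
point of `C`, which would then lie on the boundary of the box. -/
lemma box_subset_sdiff_explored {N : ℕ} (hNR : N < R) (hC : IsAttached R C)
    (hCb : ∀ x ∈ C, x ∉ boundary (box d N : Set (Lattice d))) :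
    box d N ⊆ box d R \ explored R C := by
  classical
  intro x hx
  have hxn := norm_le_of_mem_box hx
  have hNR' : (N : ℝ) < R := by exact_mod_cast hNR
  have hCB := notMem_box_of_isAttached hNR hC hCb
  refine Finset.mem_sdiff.2 ⟨mem_box_of_norm_le (hxn.trans hNR'.le), fun hE => ?_⟩
  rw [explored, Finset.mem_union, Finset.mem_filter] at hE
  rcases hE with hE | ⟨-, hE | ⟨y, hy, hxy⟩⟩
  · exact hCB x hE hx
  · have : ‖x‖ = (R : ℝ) := hE
    linarith
  · exact hCb y hy ⟨hCB y hy, x, hx, adj_comm.1 hxy⟩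

/-- All neighbors of `C` in the large box are revealed, so an unrevealed point is never adjacent to
`C`. The sphere is revealed too, so one step from an unrevealed point stays in the large box. -/
lemma add_stepVec_mem_explored {x : Lattice d} (hx : x ∈ box d R \ explored R C)
    (p : Fin d × Bool) :
    x + stepVec p ∈ box d R \ explored R C ∨
      (x + stepVec p ∈ explored R C ∧ x + stepVec p ∉ C) := by
  rw [Finset.mem_sdiff] at hx
  by_cases hE : x + stepVec p ∈ explored R C
  · exact Or.inr ⟨hE, fun hC => hx.2
      (mem_explored_of_adj hx.1 hC (adj_iff_exists_stepVec.2 ⟨p, rfl⟩))⟩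
  · exact Or.inl (Finset.mem_sdiff.2
      ⟨add_stepVec_mem_box hx.1 (fun hs => hx.2 (mem_explored_of_mem_sphere hs)) p, hE⟩)

variable [NeZero d] {P : Measure (Lattice d → ℝ)}

lemma IsGFF.measure_explorationEvent_le (hP : IsGFF d P) (hd : 3 ≤ d) {N : ℕ} (hNR : N < R)
    (hC : IsAttached R C) (hCb : ∀ x ∈ C, x ∉ boundary (box d N : Set (Lattice d))) :
    MeasurableSet (explorationEvent R α C) ∧
    P.real (explorationEvent R α C) ≤ 2 * P.real (explorationEvent R α C ∩
      {φ | ∑ x ∈ box d N, escape d (box d N) x * φ x ≤ α * capacity d (box d N)}) := by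
  set F := explored R C with hF
  set U := box d R \ F with hU
  set A : Set (F → ℝ) := {v | ∀ x : F, (x.1 ∈ C → α ≤ v x) ∧ (x.1 ∉ C → v x < α)} with hA
  have hAm : MeasurableSet A := by
    have e : A = ⋂ x : F, {v | (x.1 ∈ C → α ≤ v x) ∧ (x.1 ∉ C → v x < α)} := by
      ext v; simp [hA]
    rw [e]
    refine MeasurableSet.iInter fun x => ?_
    by_cases hx : x.1 ∈ C
    · simpa [hx] using measurableSet_le measurable_const (measurable_pi_apply x)
    · simpa [hx] using measurableSet_lt (measurable_pi_apply x) measurable_const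
  have hev : explorationEvent R α C = {φ : Lattice d → ℝ | (F.restrict φ : F → ℝ) ∈ A} := by
    ext φ
    simp only [explorationEvent, hA, Set.mem_ofPred_eq, Subtype.forall]
    constructor
    · rintro ⟨h1, h2⟩ x hx
      exact ⟨h1 x, h2 x hx⟩
    · intro h
      exact ⟨fun x hx => (h x (subset_explored hx)).1 hx, fun x hx => (h x hx).2⟩
  have hdisj : Disjoint U F := Finset.sdiff_disjoint
  refine ⟨by rw [hev]; exact measurableSet_preimage (by fun_prop) hAm, ?_⟩
  have h := hP.measure_inter_le hd (box_subset_sdiff_explored hNR hC hCb) hdisj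
    (fun x hx p => (add_stepVec_mem_explored hx p).imp_right And.left)
    (escape d (box d N)) (c := α * capacity d (box d N)) hAm fun φ hφ => ?_
  · rw [hev]; exact h
  have hφ' : φ ∈ explorationEvent R α C := by rw [hev]; exact hφ
  rw [capacity, Finset.mul_sum]
  refine Finset.sum_le_sum fun x hx => ?_
  rw [mul_comm α]
  refine mul_le_mul_of_nonneg_left ?_ (escape_nonneg _ x)
  exact harmonicExt_le hdisj (fun y hy p => (add_stepVec_mem_explored hy p).imp_right
    fun h => ⟨h.1, (hφ'.2 _ h.1 h.2).le⟩) (box_subset_sdiff_explored hNR hC hCb hx)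

/-- The disconnection event is at most twice as likely as an atypically low average of the field
against the equilibrium measure of the inner box. -/
theorem IsGFF.measure_not_connected_le (hP : IsGFF d P) (hd : 3 ≤ d) {N : ℕ} (hNR : N < R) :
    P.real {φ | ¬ Connected (boundary (box d N : Set (Lattice d))) (excursion α φ) (sphere d R)} ≤
      2 * P.real {φ | ∑ x ∈ box d N, escape d (box d N) x * φ x ≤ α * capacity d (box d N)} := by
  classical
  have := hP.isProbabilityMeasure
  set Y : Set (Lattice d → ℝ) :=
    {φ | ∑ x ∈ box d N, escape d (box d N) x * φ x ≤ α * capacity d (box d N)} with hY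
  have hYm : MeasurableSet Y := measurableSet_le (by fun_prop) measurable_const
  set 𝓒 := (box d R).powerset.filter fun C => IsAttached R C ∧
    ∀ x ∈ C, x ∉ boundary (box d N : Set (Lattice d)) with h𝓒
  have hmem : ∀ C ∈ 𝓒, IsAttached R C ∧ ∀ x ∈ C, x ∉ boundary (box d N : Set (Lattice d)) :=
    fun C hC => (Finset.mem_filter.1 hC).2
  calc _ ≤ P.real (⋃ C ∈ 𝓒, explorationEvent R α C) := by
        refine measureReal_mono (fun φ hφ => ?_) (measure_ne_top _ _)
        obtain ⟨C, hC, hCb, hev⟩ := exists_explorationEvent hφ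
        exact Set.mem_iUnion₂.2
          ⟨C, Finset.mem_filter.2 ⟨Finset.mem_powerset.2 hC.1, hC, hCb⟩, hev⟩
    _ ≤ ∑ C ∈ 𝓒, P.real (explorationEvent R α C) := measureReal_biUnion_finset_le _ _
    _ ≤ ∑ C ∈ 𝓒, 2 * P.real (explorationEvent R α C ∩ Y) :=
        Finset.sum_le_sum fun C hC =>
          (hP.measure_explorationEvent_le hd hNR (hmem C hC).1 (hmem C hC).2).2
    _ = 2 * P.real (⋃ C ∈ 𝓒, explorationEvent R α C ∩ Y) := by
        -- Disjointness of the exploration events keeps the constant at `2`, whatever the number of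
        -- possible sets `C`.
        rw [← Finset.mul_sum, measureReal_biUnion_finset]
        · intro C hC C' hC' hne
          refine Set.disjoint_left.2 fun φ h h' => hne ?_
          exact Finset.Subset.antisymm (subset_of_mem_explorationEvent (hmem C hC).1 h.1 h'.1)
            (subset_of_mem_explorationEvent (hmem C' hC').1 h'.1 h.1)
        · exact fun C hC =>
            (hP.measure_explorationEvent_le hd hNR (hmem C hC).1 (hmem C hC).2).1.inter hYm
    _ ≤ 2 * P.real Y := by
        refine mul_le_mul_of_nonneg_left (measureReal_mono ?_) zero_le_two
        exact Set.iUnion₂_subset fun C _ => Set.inter_subset_right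

end Exploration

/-! ### Scaling of the Brownian capacity -/

section Scaling

variable {d : ℕ}

lemma heat_smul {a s : ℝ} (ha : 0 < a) (hs : 0 < s) (v : Space d) :
    heat d (a ^ 2 * s) (a • v) = (a ^ d)⁻¹ * heat d s v := by
  unfold heat
  have h1 : (2 * Real.pi * (a ^ 2 * s)) ^ (-(d : ℝ) / 2) =
      (a ^ d)⁻¹ * (2 * Real.pi * s) ^ (-(d : ℝ) / 2) := by
    rw [show 2 * Real.pi * (a ^ 2 * s) = a ^ 2 * (2 * Real.pi * s) by ring,
      Real.mul_rpow (by positivity) (by positivity), ← Real.rpow_natCast a 2,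
      ← Real.rpow_mul ha.le, ← Real.rpow_natCast a d, ← Real.rpow_neg ha.le]
    congr 2
    push_cast
    ring
  have h2 : -‖a • v‖ ^ 2 / (2 * (a ^ 2 * s)) = -‖v‖ ^ 2 / (2 * s) := by
    rw [norm_smul, Real.norm_of_nonneg ha.le]
    field_simp
  rw [h1, h2, mul_assoc]

/-- Brownian scaling: substitute `t = a ^ 2 * s` in the time integral. -/
lemma brownianGreen_smul {a : ℝ} (ha : 0 < a) (x y : Space d) :
    brownianGreen d (a • x) (a • y) = ENNReal.ofReal (a ^ 2 / a ^ d) * brownianGreen d x y := by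
  have himg : (fun s : ℝ => a ^ 2 * s) '' Set.Ioi 0 = Set.Ioi 0 := by
    rw [Set.image_mul_left_Ioi (by positivity), mul_zero]
  have h := lintegral_image_eq_lintegral_abs_deriv_mul (s := Set.Ioi (0 : ℝ))
    (f := fun s : ℝ => a ^ 2 * s) (f' := fun _ => a ^ 2) measurableSet_Ioi
    (fun s _ => by simpa using ((hasDerivAt_id s).const_mul (a ^ 2)).hasDerivWithinAt)
    (fun s _ t _ hst => mul_left_cancel₀ (by positivity) hst)
    (fun t => ENNReal.ofReal (heat d t (a • (x - y))))
  rw [himg] at h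
  change ∫⁻ t in Set.Ioi (0 : ℝ), ENNReal.ofReal (heat d t (a • x - a • y)) =
    _ * ∫⁻ t in Set.Ioi (0 : ℝ), ENNReal.ofReal (heat d t (x - y))
  rw [← smul_sub, h, ← lintegral_const_mul' _ _ ENNReal.ofReal_ne_top]
  refine setLIntegral_congr_fun measurableSet_Ioi fun s hs => ?_
  rw [heat_smul ha hs, abs_of_pos (by positivity), ← ENNReal.ofReal_mul (by positivity),
    ← ENNReal.ofReal_mul (by positivity), div_eq_mul_inv, mul_assoc]

lemma lintegral_map_smul {a : ℝ} (ha : 0 < a) (μ : Measure (Space d)) (f : Space d → ℝ≥0∞) :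
    ∫⁻ y, f y ∂(μ.map fun y => a • y) = ∫⁻ y, f (a • y) ∂μ :=
  (Homeomorph.smulOfNeZero a ha.ne').measurableEmbedding.lintegral_map f

lemma brownianEnergy_map_smul_le {a : ℝ} (ha : 0 < a) {μ : Measure (Space d)}
    (hμ : ∀ x, ∫⁻ y, brownianGreen d x y ∂μ ≤ 1) :
    brownianEnergy (μ.map fun y => a • y) ≤ ENNReal.ofReal (a ^ 2 / a ^ d) * μ Set.univ := by
  unfold brownianEnergy
  simp_rw [lintegral_map_smul ha, brownianGreen_smul ha,
    lintegral_const_mul' _ _ ENNReal.ofReal_ne_top]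
  refine mul_le_mul_right ((lintegral_mono hμ).trans_eq ?_) _
  simp

/-! ### Discretization of measures and comparison of capacities -/

lemma integral_hat_eq_zero {N : ℕ} {μ : Measure (Space d)} (hμ : μ (solidCube d N)ᶜ = 0)
    {x : Lattice d} (hx : x ∉ box d N) : ∫ y, hat x y ∂μ = 0 := by
  refine integral_eq_zero_of_ae ?_
  filter_upwards [measure_eq_zero_iff_ae_notMem.1 hμ] with y hy
  simp only [Set.mem_compl_iff, not_not] at hy
  rw [mem_box_iff] at hx
  push Not at hx
  obtain ⟨i, hi⟩ := hx
  refine hat_eq_zero ⟨i, ?_⟩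
  have h1 : (N : ℝ) + 1 ≤ |(x i : ℝ)| := by exact_mod_cast hi
  have h2 := abs_sub_abs_le_abs_sub (x i : ℝ) (y i)
  rw [abs_sub_comm] at h2
  linarith [hy i]

/-- Hats centered outside `box d N` vanish on this cube, so those of the box alone form a partition
of unity there. Discretization thus keeps the full mass without enlarging the box. -/
lemma sum_hat_eq_one {N : ℕ} {y : Space d} (hy : y ∈ solidCube d N) :
    ∑ x ∈ box d N, hat x y = 1 := by
  have hbox : box d N = Fintype.piFinset fun _ => Finset.Icc (-(N : ℤ)) N := rfl
  rw [hbox]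
  unfold hat
  rw [Finset.sum_prod_piFinset (Finset.Icc (-(N : ℤ)) N) fun j k => tent (y j - k)]
  refine Finset.prod_eq_one fun j _ => sum_tent_eq fun k hk => ?_
  rw [Finset.mem_Icc, ← abs_le]
  have h1 := abs_sub_abs_le_abs_sub (k : ℝ) (y j)
  rw [abs_sub_comm] at h1
  have h2 : |(k : ℝ)| < N + 1 := by linarith [hy j]
  have h3 : |k| < (N : ℤ) + 1 := by exact_mod_cast h2
  omega

lemma sum_integral_hat {N : ℕ} {μ : Measure (Space d)} [IsFiniteMeasure μ]
    (hμ : μ (solidCube d N)ᶜ = 0) : ∑ x ∈ box d N, ∫ y, hat x y ∂μ = μ.real Set.univ := by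
  rw [← integral_finsetSum _ fun x _ => ?_]
  · rw [integral_congr_ae (g := fun _ => (1 : ℝ)), integral_const, smul_eq_mul, mul_one]
    filter_upwards [measure_eq_zero_iff_ae_notMem.1 hμ] with y hy
    simp only [Set.mem_compl_iff, not_not] at hy
    exact sum_hat_eq_one hy
  · exact Integrable.of_bound (continuous_hat x).aestronglyMeasurable 1 (Filter.Eventually.of_forall
      fun y => by rw [Real.norm_of_nonneg (hat_nonneg x y)]; exact hat_le_one x y)

variable [NeZero d]

/-- The discretization of a measure by hat functions has lattice energy at most `d` times its
Brownian energy. -/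
lemma sum_green_hat_le (hd : 3 ≤ d) {N : ℕ} {μ : Measure (Space d)} [IsFiniteMeasure μ] {e : ℝ}
    (he0 : 0 ≤ e) (he : brownianEnergy μ ≤ ENNReal.ofReal e) (hμ : μ (solidCube d N)ᶜ = 0)
    {ν : Lattice d → ℝ} (hν : ∀ x, ν x = ∫ y, hat x y ∂μ) :
    ∑ x ∈ box d N, ν x * ∑ y ∈ box d N, green d x y * ν y ≤ d * e := by
  have hν0 : ∀ x, 0 ≤ ν x := fun x => by rw [hν]; exact integral_nonneg (hat_nonneg x)
  have hzero : ∀ x, x ∉ box d N → ν x = 0 := fun x hx => by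
    rw [hν]; exact integral_hat_eq_zero hμ hx
  have hfin : ν.support.Finite := by
    rw [funext hν]; exact support_integral_hat_finite hμ
  have hterm : ∀ k, ∑' x, ν x * (avg d ^ k) ν x =
      ∑ x ∈ box d N, ν x * ∑ y ∈ box d N, trans k x y * ν y := by
    intro k
    rw [tsum_eq_sum (s := box d N) fun x hx => by rw [hzero x hx, zero_mul]]
    refine Finset.sum_congr rfl fun x _ => ?_
    rw [avg_pow_apply k hfin]
    congr 1
    refine (Finset.sum_congr rfl fun y _ => mul_comm _ _).trans
      (Finset.sum_subset (fun y hy => ?_) fun y _ hy => ?_)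
    · by_contra hyb
      exact (hfin.mem_toFinset.1 hy) (hzero y hyb)
    · rw [hfin.mem_toFinset, Function.mem_support, not_not] at hy
      rw [hy, mul_zero]
  have hsum : HasSum (fun k => ∑ x ∈ box d N, ν x * ∑ y ∈ box d N, trans k x y * ν y)
      (∑ x ∈ box d N, ν x * ∑ y ∈ box d N, green d x y * ν y) :=
    hasSum_sum fun x _ => (hasSum_sum fun y _ =>
      ((summable_trans hd x y).hasSum.mul_right (ν y))).mul_left (ν x)
  refine le_of_tendsto hsum.tendsto_sum_nat (Filter.Eventually.of_forall fun n => ?_)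
  simpa only [hterm] using tsum_potential_le he0 he hν hfin n

variable {P : Measure (Lattice d → ℝ)}

/-- With `m` the mass of `μ`, the charge inequality gives `m² ≤ d N^(2-d) m cap(B_N)`; dividing by
`m` leaves a bound linear in the mass. -/
lemma IsGFF.pow_mul_measure_le (hP : IsGFF d P) (hd : 3 ≤ d) {N : ℕ} (hN : 1 ≤ N)
    {μ : Measure (Space d)} [IsFiniteMeasure μ] (hμ : μ (cube d)ᶜ = 0)
    (hpot : ∀ x, ∫⁻ y, brownianGreen d x y ∂μ ≤ 1) :
    (N : ℝ) ^ (d - 2) * μ.real Set.univ ≤ d * capacity d (box d N) := by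
  have hN0 : (0 : ℝ) < N := by exact_mod_cast hN
  set m := μ.real Set.univ with hm
  have hm0 : 0 ≤ m := measureReal_nonneg
  have hcap0 : 0 ≤ capacity d (box d N) := Finset.sum_nonneg fun x _ => escape_nonneg _ x
  have hmeas : Measurable fun y : Space d => (N : ℝ) • y := measurable_const_smul _
  set μN := μ.map fun y : Space d => (N : ℝ) • y with hμN
  have hmN : μN.real Set.univ = m := by
    rw [hμN, map_measureReal_apply hmeas MeasurableSet.univ, Set.preimage_univ]
  have hsupp : μN (solidCube d N)ᶜ = 0 := by
    rw [hμN, Measure.map_apply hmeas (measurableSet_solidCube _).compl]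
    rw [Set.preimage_compl]
    refine measure_mono_null (Set.compl_subset_compl.2 fun y hyc i => ?_) hμ
    rw [PiLp.smul_apply, smul_eq_mul, abs_mul, Nat.abs_cast]
    exact mul_le_of_le_one_right hN0.le (abs_le.2 (hyc i))
  have hen : brownianEnergy μN ≤ ENNReal.ofReal ((N : ℝ) ^ 2 / (N : ℝ) ^ d * m) := by
    rw [ENNReal.ofReal_mul (by positivity), hm, ofReal_measureReal]
    exact brownianEnergy_map_smul_le hN0 hpot
  have h1 := sum_green_hat_le hd (by positivity) hen hsupp (fun x => rfl)
  have h2 := hP.sq_sum_le_energy_mul_capacity hd (box d N) fun x => ∫ y, hat x y ∂μN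
  rw [sum_integral_hat hsupp, hmN] at h2
  have h3 : m ^ 2 ≤ d * ((N : ℝ) ^ 2 / (N : ℝ) ^ d * m) * capacity d (box d N) :=
    h2.trans (mul_le_mul_of_nonneg_right h1 hcap0)
  rcases hm0.eq_or_lt with h0 | hpos
  · rw [← h0, mul_zero]; positivity
  have hpow : (N : ℝ) ^ d = (N : ℝ) ^ 2 * (N : ℝ) ^ (d - 2) := by
    rw [← pow_add]; congr 1; omega
  have h4 : (N : ℝ) ^ 2 / (N : ℝ) ^ d = ((N : ℝ) ^ (d - 2))⁻¹ := by
    rw [hpow]; field_simp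
  rw [h4] at h3
  have hq : (0 : ℝ) < (N : ℝ) ^ (d - 2) := by positivity
  have h5 : m * ((N : ℝ) ^ (d - 2) * m) ≤ m * (d * capacity d (box d N)) := by
    calc m * ((N : ℝ) ^ (d - 2) * m) = (N : ℝ) ^ (d - 2) * m ^ 2 := by ring
      _ ≤ (N : ℝ) ^ (d - 2) *
          (d * (((N : ℝ) ^ (d - 2))⁻¹ * m) * capacity d (box d N)) :=
        mul_le_mul_of_nonneg_left h3 hq.le
      _ = m * (d * capacity d (box d N)) := by field_simp
  exact le_of_mul_le_mul_left h5 hpos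

theorem IsGFF.pow_mul_brownianCapacity_le (hP : IsGFF d P) (hd : 3 ≤ d) {N : ℕ} (hN : 1 ≤ N) :
    ENNReal.ofReal ((N : ℝ) ^ (d - 2)) * brownianCapacity d (cube d) ≤
      ENNReal.ofReal (d * capacity d (box d N)) := by
  unfold brownianCapacity
  rw [ENNReal.mul_sSup]
  refine iSup₂_le ?_
  rintro _ ⟨μ, hfin, hμ, hpot, rfl⟩
  rw [← ofReal_measureReal, ← ENNReal.ofReal_mul (by positivity)]
  exact ENNReal.ofReal_le_ofReal (hP.pow_mul_measure_le hd hN hμ hpot)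

/-- The comparison at `N = 1` already bounds it by a finite lattice capacity. -/
lemma IsGFF.brownianCapacity_cube_ne_top (hP : IsGFF d P) (hd : 3 ≤ d) :
    brownianCapacity d (cube d) ≠ ⊤ := by
  have h := hP.pow_mul_brownianCapacity_le hd le_rfl
  rw [Nat.cast_one, one_pow, ENNReal.ofReal_one, one_mul] at h
  exact (h.trans_lt ENNReal.ofReal_lt_top).ne

lemma IsGFF.pow_mul_toReal_brownianCapacity_le (hP : IsGFF d P) (hd : 3 ≤ d) {N : ℕ} (hN : 1 ≤ N) :
    (N : ℝ) ^ (d - 2) * (brownianCapacity d (cube d)).toReal ≤ d * capacity d (box d N) := by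
  have hcap0 : 0 ≤ capacity d (box d N) := Finset.sum_nonneg fun x _ => escape_nonneg _ x
  have h := ENNReal.toReal_mono ENNReal.ofReal_ne_top (hP.pow_mul_brownianCapacity_le hd hN)
  rwa [ENNReal.toReal_mul, ENNReal.toReal_ofReal (by positivity),
    ENNReal.toReal_ofReal (by positivity)] at h

end Scaling

/-! ### The disconnection estimate and its exponential rate -/

section Rate

variable {d : ℕ} [NeZero d] {P : Measure (Lattice d → ℝ)}

theorem IsGFF.measure_disconnection_le (hP : IsGFF d P) (hd : 3 ≤ d) {M α : ℝ} (hα : α ≤ 0)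
    {N : ℕ} (hN : (N : ℝ) + 1 ≤ M * N) :
    P.real (disconnection d M α N) ≤
      2 * Real.exp (-(1 / 2) * α ^ 2 * capacity d (box d N)) := by
  have hNR : N < ⌊M * N⌋₊ := Nat.le_floor (by push_cast; exact hN)
  exact (hP.measure_not_connected_le hd hNR).trans
    (mul_le_mul_of_nonneg_left (hP.measure_sum_escape_mul_le hd (box d N) hα) zero_le_two)

theorem IsGFF.limsup_log_measure_disconnection_le (hP : IsGFF d P) (hd : 3 ≤ d) {M α : ℝ}
    (hM : 1 < M) (hα : α ≤ 0) :
    Filter.limsup (fun N : ℕ => ((1 / (N : ℝ) ^ (d - 2) : ℝ) : EReal) *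
        ENNReal.log (P (disconnection d M α N))) Filter.atTop ≤
      ((-(1 / (2 * (d : ℝ))) * α ^ 2 * (brownianCapacity d (cube d)).toReal : ℝ) : EReal) := by
  have := hP.isProbabilityMeasure
  set c := (brownianCapacity d (cube d)).toReal with hc
  have hd0 : (0 : ℝ) < d := by exact_mod_cast (by omega : 0 < d)
  -- The prefactor `2` contributes only `log 2 / N^(d-2)`, which vanishes in the limit.
  have hlim : Filter.Tendsto (fun N : ℕ => 1 / (N : ℝ) ^ (d - 2) * Real.log 2 +
      -(1 / (2 * (d : ℝ))) * α ^ 2 * c) Filter.atTop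
      (nhds (-(1 / (2 * (d : ℝ))) * α ^ 2 * c)) := by
    have h : Filter.Tendsto (fun N : ℕ => 1 / (N : ℝ) ^ (d - 2)) Filter.atTop (nhds 0) := by
      simp_rw [one_div]
      exact tendsto_inv_atTop_zero.comp
        ((Filter.tendsto_pow_atTop (by omega)).comp tendsto_natCast_atTop_atTop)
    have h' := (h.mul_const (Real.log 2)).add_const (-(1 / (2 * (d : ℝ))) * α ^ 2 * c)
    rwa [zero_mul, zero_add] at h'
  rw [← ((continuous_coe_real_ereal.tendsto _).comp hlim).limsup_eq]
  refine Filter.limsup_le_limsup ?_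
  -- The condition `N ≥ 1 / (M - 1)` is `N + 1 ≤ M * N`.
  obtain ⟨n₀, hn₀⟩ := exists_nat_ge (1 / (M - 1))
  filter_upwards [Filter.eventually_ge_atTop (max 1 n₀)] with N hN
  have hN1 : 1 ≤ N := (le_max_left _ _).trans hN
  have hNn : (n₀ : ℝ) ≤ N := by exact_mod_cast (le_max_right _ _).trans hN
  have hMN : (N : ℝ) + 1 ≤ M * N := by
    have h := (div_le_iff₀ (sub_pos.2 hM)).1 (hn₀.trans hNn)
    linarith
  have hq : (0 : ℝ) < (N : ℝ) ^ (d - 2) := by positivity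
  set p := 2 * Real.exp (-(1 / 2) * α ^ 2 * capacity d (box d N)) with hp
  have hle : P (disconnection d M α N) ≤ ENNReal.ofReal p := by
    rw [← ofReal_measureReal]
    exact ENNReal.ofReal_le_ofReal (hP.measure_disconnection_le hd hα hMN)
  have hlog := ENNReal.log_le_log hle
  rw [ENNReal.log_ofReal_of_pos (by positivity), hp, Real.log_mul two_ne_zero (Real.exp_ne_zero _),
    Real.log_exp] at hlog
  refine (mul_le_mul_of_nonneg_left hlog (by exact_mod_cast (by positivity))).trans ?_
  rw [← EReal.coe_mul]
  refine EReal.coe_le_coe_iff.2 ?_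
  rw [mul_add]
  refine add_le_add_right ?_ _
  have hcap := hP.pow_mul_toReal_brownianCapacity_le hd hN1
  rw [← hc] at hcap
  have h1 : α ^ 2 * ((N : ℝ) ^ (d - 2) * c) ≤ α ^ 2 * (d * capacity d (box d N)) :=
    mul_le_mul_of_nonneg_left hcap (sq_nonneg α)
  rw [one_div, inv_mul_le_iff₀ hq, ← sub_nonneg]
  have e : (N : ℝ) ^ (d - 2) * (-(1 / (2 * (d : ℝ))) * α ^ 2 * c) -
      -(1 / 2) * α ^ 2 * capacity d (box d N) =
      (α ^ 2 * (d * capacity d (box d N)) - α ^ 2 * ((N : ℝ) ^ (d - 2) * c)) / (2 * d) := by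
    field_simp
    ring
  rw [e]
  exact div_nonneg (sub_nonneg.2 h1) (by positivity)

end Rate

end GFF

theorem theorem3p2 (d : ℕ) [NeZero d] (hd : 3 ≤ d) (M : ℝ) (hM : 1 < M) (α : ℝ) (hα : α < 0)
    (P : MeasureTheory.Measure (GFF.Lattice d → ℝ)) (hP : GFF.IsGFF d P) :
    (∀ N : ℕ, (N : ℝ) + 1 ≤ M * N →
      P.real (GFF.disconnection d M α N) ≤
        2 * Real.exp (-(1 / 2) * α ^ 2 * GFF.capacity d (GFF.box d N))) ∧
    Filter.limsup
        (fun N : ℕ => ((1 / (N : ℝ) ^ (d - 2) : ℝ) : EReal) *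
          ENNReal.log (P (GFF.disconnection d M α N)))
        Filter.atTop ≤
      ((-(1 / (2 * (d : ℝ))) * α ^ 2 : ℝ) : EReal) *
        (GFF.brownianCapacity d (GFF.cube d) : EReal) := by
  refine ⟨fun N hN => hP.measure_disconnection_le hd hα.le hN, ?_⟩
  rw [← EReal.coe_ennreal_toReal (hP.brownianCapacity_cube_ne_top hd), ← EReal.coe_mul]
  exact hP.limsup_log_measure_disconnection_le hd hM hα.le
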